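/- **Definitions.** Let $\mathbb{D}$ be a (pseudo) double category. A proarrow from $x$ to $y$ is written $x\rightsquigarrow y$, and a cell lies over a pair of arrows, its left and right boundaries. The double category $\mathbb{D}$ has *strong finite coproducts* if the following hold. 1. Every finite family of objects $x=(x_i)_{i\in I}$ has a chosen coproduct $\Sigma x$, with coprojections $\iota_i: x_i\to\Sigma x$, in the category of objects and arrows of $\mathbb{D}$. The choice is normalized: the coproduct of a single object $x$, as a family indexed by the one-point set, is $x$ itself with identity coprojection. 2. Given a finite span $I\xleftarrow{l} A\xrightarrow{r} J$, families of objects $x$ over $I$ and $y$ over $J$, and proarrows $m_a: x_{l(a)}\rightsquigarrow y_{r(a)}$ for $a\in A$, there are a chosen proarrow $\Sigma m:\Sigma x\rightsquigarrow \Sigma y$ and cells $\iota_a: m_a\Rightarrow\Sigma m$ over $\iota_{l(a)}$ and $\iota_{r(a)}$ with the following universal property. For all arrows $f:\Sigma x\to z$ and $g:\Sigma y\to w$, every proarrow $n:z\rightsquigarrow w$ and all cells $\varphi_a: m_a\Rightarrow n$ over $f\circ\iota_{l(a)}$ and $g\circ\iota_{r(a)}$, there is a unique cell $\psi:\Sigma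 m\Rightarrow n$ over $f$ and $g$ with $\psi\circ\iota_a=\varphi_a$ for all $a$. 3. These coproducts commute with external composition and external identities: the canonical comparison cells $\Sigma(m\odot n)\Rightarrow\Sigma m\odot\Sigma n$ (where $m\odot n$ is indexed by the composite of spans, formed by pullback) and $\Sigma(\mathrm{id}_x)\Rightarrow\mathrm{id}_{\Sigma x}$ are invertible. The *underlying bicategory* $\mathbf{D}$ of $\mathbb{D}$ consists of its objects, proarrows and globular cells. For a finite set $I$, let $\oplus:\mathbf{D}^I\to\mathbf{D}$ be the pseudofunctor sending parallel families of objects, proarrows and globular cells to their coproducts, let $\Delta:\mathbf{D}\to\mathbf{D}^I$ be the diagonal, and let $\nabla_z:\Sigma_{i\in I}z\to z$ be the codiagonal arrows. A bicategory has *direct sums* if every finite family of objects $(x_i)_{i \in I}$ has a bicategorical coproduct and a bicategorical product with the same underlying object $s$. That is, there are 1-cells $x_i\to s$ inducing equivalences $\mathbf{B}(s,z)\simeq\prod_i\mathbf{B}(x_i,z)$, and 1-cells $s\to x_i$ inducing equivalences $\mathbf{B}(z,s)\simeq\prod_i\mathbf{B}(z,x_i)$, for every object $z$. **Theorem.** Let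 $\mathbb{D}$ be a double category with strong finite coproducts. Then its underlying bicategory $\mathbf{D}$ has direct sums. More precisely, for every finite set $I$ there are biadjunctions $$(\iota_!,\nabla_!):\ \oplus\dashv\Delta:\ \mathbf{D}^I\rightleftarrows\mathbf{D}\qquad\text{and}\qquad(\nabla^*,\iota^*):\ \Delta\dashv\oplus:\ \mathbf{D}\rightleftarrows\mathbf{D}^I,$$ consisting of pseudofunctors, pseudonatural unit and counit, and invertible modifications satisfying the swallowtail identities. The unit $\iota_!$ and counit $\nabla_!$ of the first are obtained from the coprojections and codiagonals by taking companions, and the unit $\nabla^*$ and counit $\iota^*$ of the second are obtained from the codiagonals and coprojections by taking conjoints. That is, their component 1-cells are companions (respectively conjoints) of the component arrows, and their structure 2-cells are (respectively, are inverse to) the globular cells obtained by reshaping the component cells of the coprojections (respectively codiagonals) at proarrows by the companion (respectively conjoint) units and counits. For every family $x$ of objects indexed by $I$, the 1-cells $(\iota_i)_!: x_i\rightsquigarrow \Sigma x$ exhibit $\Sigma x$ as a bicategorical coproduct of $x$, and the 1-cells $(\iota_i)^*:\Sigma x\rightsquigarrow x_i$ exhibit it as a bicategorical product of $x$. -/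

import Mathlib

open CategoryTheory CategoryTheory.Limits CategoryTheory.Bicategory

universe t w v u w₂ v₂ u₂

/-- A (pseudo) double category. The objects of `D` and the arrows between them form a category
`D₀`; proarrows `Pro x y` and cells between proarrows form a category `D₁`; a cell `α : Cell m n`
has a left boundary arrow and a right boundary arrow, functorially in `α`. External composition
and external identities are functors `D₁ ×_{D₀} D₁ ⥤ D₁` and `D₀ ⥤ D₁`, associative and unital up
to globular natural isomorphisms which satisfy the pentagon and triangle identities.
External composition is written in diagrammatic order. -/
class DoubleCategory (D : Type u) extends Category.{v} D where
  Pro : D → D → Type w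
  Cell {x y x' y' : D} : Pro x y → Pro x' y' → Type t
  left {x y x' y' : D} {m : Pro x y} {n : Pro x' y'} : Cell m n → (x ⟶ x')
  right {x y x' y' : D} {m : Pro x y} {n : Pro x' y'} : Cell m n → (y ⟶ y')
  cellId {x y : D} (m : Pro x y) : Cell m m
  cellComp {x y x' y' x'' y'' : D} {m : Pro x y} {n : Pro x' y'} {p : Pro x'' y''} :
    Cell m n → Cell n p → Cell m p
  id_cellComp {x y x' y' : D} {m : Pro x y} {n : Pro x' y'} (α : Cell m n) :
    cellComp (cellId m) α = α
  cellComp_id {x y x' y' : D} {m : Pro x y} {n : Pro x' y'} (α : Cell m n) :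
    cellComp α (cellId n) = α
  cellComp_assoc {x₁ y₁ x₂ y₂ x₃ y₃ x₄ y₄ : D} {m : Pro x₁ y₁} {n : Pro x₂ y₂} {p : Pro x₃ y₃}
    {q : Pro x₄ y₄} (α : Cell m n) (β : Cell n p) (γ : Cell p q) :
    cellComp (cellComp α β) γ = cellComp α (cellComp β γ)
  left_cellId {x y : D} (m : Pro x y) : left (cellId m) = 𝟙 x
  right_cellId {x y : D} (m : Pro x y) : right (cellId m) = 𝟙 y
  left_cellComp {x y x' y' x'' y'' : D} {m : Pro x y} {n : Pro x' y'} {p : Pro x'' y''}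
    (α : Cell m n) (β : Cell n p) : left (cellComp α β) = left α ≫ left β
  right_cellComp {x y x' y' x'' y'' : D} {m : Pro x y} {n : Pro x' y'} {p : Pro x'' y''}
    (α : Cell m n) (β : Cell n p) : right (cellComp α β) = right α ≫ right β
  proId (x : D) : Pro x x
  idCell {x y : D} (f : x ⟶ y) : Cell (proId x) (proId y)
  left_idCell {x y : D} (f : x ⟶ y) : left (idCell f) = f
  right_idCell {x y : D} (f : x ⟶ y) : right (idCell f) = f
  idCell_id (x : D) : idCell (𝟙 x) = cellId (proId x)
  idCell_comp {x y z : D} (f : x ⟶ y) (g : y ⟶ z) :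
    idCell (f ≫ g) = cellComp (idCell f) (idCell g)
  proComp {x y z : D} : Pro x y → Pro y z → Pro x z
  hcomp {x y z x' y' z' : D} {m : Pro x y} {n : Pro y z} {m' : Pro x' y'} {n' : Pro y' z'}
    (α : Cell m m') (β : Cell n n') (h : right α = left β) : Cell (proComp m n) (proComp m' n')
  left_hcomp {x y z x' y' z' : D} {m : Pro x y} {n : Pro y z} {m' : Pro x' y'} {n' : Pro y' z'}
    (α : Cell m m') (β : Cell n n') (h : right α = left β) : left (hcomp α β h) = left α
  right_hcomp {x y z x' y' z' : D} {m : Pro x y} {n : Pro y z} {m' : Pro x' y'} {n' : Pro y' z'}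
    (α : Cell m m') (β : Cell n n') (h : right α = left β) : right (hcomp α β h) = right β
  hcomp_id {x y z : D} (m : Pro x y) (n : Pro y z) :
    hcomp (cellId m) (cellId n) ((right_cellId m).trans (left_cellId n).symm) =
      cellId (proComp m n)
  hcomp_cellComp {x y z x' y' z' x'' y'' z'' : D} {m : Pro x y} {n : Pro y z} {m' : Pro x' y'}
    {n' : Pro y' z'} {m'' : Pro x'' y''} {n'' : Pro y'' z''}
    (α : Cell m m') (β : Cell n n') (α' : Cell m' m'') (β' : Cell n' n'')
    (h : right α = left β) (h' : right α' = left β') :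
    hcomp (cellComp α α') (cellComp β β')
        (by rw [right_cellComp, left_cellComp, h, h']) =
      cellComp (hcomp α β h) (hcomp α' β' h')
  assocHom {x y z a : D} (m : Pro x y) (n : Pro y z) (p : Pro z a) :
    Cell (proComp (proComp m n) p) (proComp m (proComp n p))
  assocInv {x y z a : D} (m : Pro x y) (n : Pro y z) (p : Pro z a) :
    Cell (proComp m (proComp n p)) (proComp (proComp m n) p)
  left_assocHom {x y z a : D} (m : Pro x y) (n : Pro y z) (p : Pro z a) :
    left (assocHom m n p) = 𝟙 x
  right_assocHom {x y z a : D} (m : Pro x y) (n : Pro y z) (p : Pro z a) :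
    right (assocHom m n p) = 𝟙 a
  left_assocInv {x y z a : D} (m : Pro x y) (n : Pro y z) (p : Pro z a) :
    left (assocInv m n p) = 𝟙 x
  right_assocInv {x y z a : D} (m : Pro x y) (n : Pro y z) (p : Pro z a) :
    right (assocInv m n p) = 𝟙 a
  assoc_hom_inv {x y z a : D} (m : Pro x y) (n : Pro y z) (p : Pro z a) :
    cellComp (assocHom m n p) (assocInv m n p) = cellId _
  assoc_inv_hom {x y z a : D} (m : Pro x y) (n : Pro y z) (p : Pro z a) :
    cellComp (assocInv m n p) (assocHom m n p) = cellId _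
  assoc_naturality {x y z a x' y' z' a' : D} {m : Pro x y} {n : Pro y z} {p : Pro z a}
    {m' : Pro x' y'} {n' : Pro y' z'} {p' : Pro z' a'}
    (α : Cell m m') (β : Cell n n') (γ : Cell p p') (h : right α = left β)
    (h' : right β = left γ) :
    cellComp (hcomp (hcomp α β h) γ ((right_hcomp α β h).trans h')) (assocHom m' n' p') =
      cellComp (assocHom m n p) (hcomp α (hcomp β γ h') (h.trans (left_hcomp β γ h').symm))
  leftUnitorHom {x y : D} (m : Pro x y) : Cell (proComp (proId x) m) m
  leftUnitorInv {x y : D} (m : Pro x y) : Cell m (proComp (proId x) m)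
  left_leftUnitorHom {x y : D} (m : Pro x y) : left (leftUnitorHom m) = 𝟙 x
  right_leftUnitorHom {x y : D} (m : Pro x y) : right (leftUnitorHom m) = 𝟙 y
  left_leftUnitorInv {x y : D} (m : Pro x y) : left (leftUnitorInv m) = 𝟙 x
  right_leftUnitorInv {x y : D} (m : Pro x y) : right (leftUnitorInv m) = 𝟙 y
  leftUnitor_hom_inv {x y : D} (m : Pro x y) :
    cellComp (leftUnitorHom m) (leftUnitorInv m) = cellId _
  leftUnitor_inv_hom {x y : D} (m : Pro x y) :
    cellComp (leftUnitorInv m) (leftUnitorHom m) = cellId _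
  leftUnitorHom_naturality {x y x' y' : D} {m : Pro x y} {m' : Pro x' y'} (α : Cell m m') :
    cellComp (hcomp (idCell (left α)) α (right_idCell _)) (leftUnitorHom m') =
      cellComp (leftUnitorHom m) α
  rightUnitorHom {x y : D} (m : Pro x y) : Cell (proComp m (proId y)) m
  rightUnitorInv {x y : D} (m : Pro x y) : Cell m (proComp m (proId y))
  left_rightUnitorHom {x y : D} (m : Pro x y) : left (rightUnitorHom m) = 𝟙 x
  right_rightUnitorHom {x y : D} (m : Pro x y) : right (rightUnitorHom m) = 𝟙 y
  left_rightUnitorInv {x y : D} (m : Pro x y) : left (rightUnitorInv m) = 𝟙 x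
  right_rightUnitorInv {x y : D} (m : Pro x y) : right (rightUnitorInv m) = 𝟙 y
  rightUnitor_hom_inv {x y : D} (m : Pro x y) :
    cellComp (rightUnitorHom m) (rightUnitorInv m) = cellId _
  rightUnitor_inv_hom {x y : D} (m : Pro x y) :
    cellComp (rightUnitorInv m) (rightUnitorHom m) = cellId _
  rightUnitorHom_naturality {x y x' y' : D} {m : Pro x y} {m' : Pro x' y'} (α : Cell m m') :
    cellComp (hcomp α (idCell (right α)) (left_idCell _).symm) (rightUnitorHom m') =
      cellComp (rightUnitorHom m) α
  pro_pentagon {x y z a b : D} (m : Pro x y) (n : Pro y z) (p : Pro z a) (q : Pro a b) :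
    cellComp (hcomp (assocHom m n p) (cellId q)
        ((right_assocHom m n p).trans (left_cellId q).symm))
      (cellComp (assocHom m (proComp n p) q) (hcomp (cellId m) (assocHom n p q)
        ((right_cellId m).trans (left_assocHom n p q).symm))) =
    cellComp (assocHom (proComp m n) p q) (assocHom m n (proComp p q))
  pro_triangle {x y z : D} (m : Pro x y) (n : Pro y z) :
    cellComp (assocHom m (proId y) n) (hcomp (cellId m) (leftUnitorHom n)
        ((right_cellId m).trans (left_leftUnitorHom n).symm)) =
      hcomp (rightUnitorHom m) (cellId n) ((right_rightUnitorHom m).trans (left_cellId n).symm)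

namespace DoubleCategory

attribute [simp] id_cellComp cellComp_id cellComp_assoc left_cellId right_cellId left_cellComp
  right_cellComp left_idCell right_idCell idCell_id left_hcomp right_hcomp hcomp_id
  left_assocHom right_assocHom left_assocInv right_assocInv assoc_hom_inv assoc_inv_hom
  left_leftUnitorHom right_leftUnitorHom left_leftUnitorInv right_leftUnitorInv
  leftUnitor_hom_inv leftUnitor_inv_hom
  left_rightUnitorHom right_rightUnitorHom left_rightUnitorInv right_rightUnitorInv
  rightUnitor_hom_inv rightUnitor_inv_hom

variable {D : Type u} [DoubleCategory.{t, w, v} D]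

/-! ### The underlying bicategory -/

/-- A globular cell: a cell whose left and right boundary arrows are identities. -/
@[ext]
structure Globular {x y : D} (m n : Pro x y) where
  cell : Cell m n
  left_eq : left cell = 𝟙 x
  right_eq : right cell = 𝟙 y

attribute [simp] Globular.left_eq Globular.right_eq

end DoubleCategory

open DoubleCategory

/-- The objects of the underlying bicategory of the double category `D`. -/
structure Loose (D : Type u) where
  obj : D

section Underlying

variable {D : Type u} [DoubleCategory.{t, w, v} D]

instance : CategoryStruct (Loose D) where
  Hom X Y := Pro X.obj Y.obj
  id X := proId X.obj
  comp m n := proComp m n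

instance looseHomCategory (X Y : Loose D) : Category.{t} (X ⟶ Y) where
  Hom m n := Globular (D := D) m n
  id m := ⟨cellId (D := D) m, left_cellId _, right_cellId _⟩
  comp α β := ⟨cellComp α.cell β.cell, by simp, by simp⟩
  id_comp α := Globular.ext (id_cellComp _)
  comp_id α := Globular.ext (cellComp_id _)
  assoc α β γ := Globular.ext (cellComp_assoc _ _ _)

/-- The underlying bicategory of a double category: objects, proarrows, globular cells. -/
instance looseBicategory : Bicategory.{t, w} (Loose D) where
  homCategory := looseHomCategory
  whiskerLeft m _ _ α := Globular.mk (hcomp (cellId (D := D) m) α.cell (by simp)) (by simp) (by simp)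
  whiskerRight α p := Globular.mk (hcomp α.cell (cellId (D := D) p) (by simp)) (by simp) (by simp)
  associator m n p :=
    { hom := Globular.mk (assocHom (D := D) m n p) (by simp) (by simp)
      inv := Globular.mk (assocInv (D := D) m n p) (by simp) (by simp)
      hom_inv_id := Globular.ext (assoc_hom_inv _ _ _)
      inv_hom_id := Globular.ext (assoc_inv_hom _ _ _) }
  leftUnitor m :=
    { hom := Globular.mk (leftUnitorHom (D := D) m) (by simp) (by simp)
      inv := Globular.mk (leftUnitorInv (D := D) m) (by simp) (by simp)
      hom_inv_id := Globular.ext (leftUnitor_hom_inv _)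
      inv_hom_id := Globular.ext (leftUnitor_inv_hom _) }
  rightUnitor m :=
    { hom := Globular.mk (rightUnitorHom (D := D) m) (by simp) (by simp)
      inv := Globular.mk (rightUnitorInv (D := D) m) (by simp) (by simp)
      hom_inv_id := Globular.ext (rightUnitor_hom_inv _)
      inv_hom_id := Globular.ext (rightUnitor_inv_hom _) }
  whiskerLeft_id m n := Globular.ext (hcomp_id _ _)
  whiskerLeft_comp m _ _ _ α β := by
    apply Globular.ext
    change hcomp _ (cellComp _ _) _ = cellComp (hcomp _ _ _) (hcomp _ _ _)
    rw [← hcomp_cellComp]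
    congr 1
    exact (id_cellComp _).symm
  id_whiskerLeft {X Y m n} α := by
    apply Globular.ext
    change hcomp (cellId (proId _)) α.cell _ =
      cellComp (leftUnitorHom _) (cellComp α.cell (leftUnitorInv _))
    rw [← cellComp_assoc, ← leftUnitorHom_naturality, cellComp_assoc, leftUnitor_hom_inv,
      cellComp_id]
    congr 1
    rw [α.left_eq, idCell_id]
  comp_whiskerLeft m n _ _ α := by
    apply Globular.ext
    change hcomp (cellId (proComp _ _)) α.cell _ = cellComp (assocHom _ _ _)
      (cellComp (hcomp (cellId _) (hcomp (cellId _) α.cell _) _) (assocInv _ _ _))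
    rw [← cellComp_assoc, ← assoc_naturality, cellComp_assoc, assoc_hom_inv, cellComp_id]
    congr 1
    exact (hcomp_id _ _).symm
  id_whiskerRight m n := Globular.ext (hcomp_id _ _)
  comp_whiskerRight α β p := by
    apply Globular.ext
    change hcomp (cellComp _ _) _ _ = cellComp (hcomp _ _ _) (hcomp _ _ _)
    rw [← hcomp_cellComp]
    congr 1
    exact (id_cellComp _).symm
  whiskerRight_id {X Y m n} α := by
    apply Globular.ext
    change hcomp α.cell (cellId (proId _)) _ =
      cellComp (rightUnitorHom _) (cellComp α.cell (rightUnitorInv _))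
    rw [← cellComp_assoc, ← rightUnitorHom_naturality, cellComp_assoc, rightUnitor_hom_inv,
      cellComp_id]
    congr 1
    rw [α.right_eq, idCell_id]
  whiskerRight_comp {_ _ _ _ m m'} α n p := by
    apply Globular.ext
    change hcomp α.cell (cellId (proComp _ _)) _ = cellComp (assocInv _ _ _)
      (cellComp (hcomp (hcomp α.cell (cellId _) _) (cellId _) _) (assocHom _ _ _))
    rw [assoc_naturality α.cell (cellId (D := D) n) (cellId (D := D) p) (by simp) (by simp),
      ← cellComp_assoc, assoc_inv_hom, id_cellComp]
    congr 1
    exact (hcomp_id _ _).symm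
  whisker_assoc m _ _ α p := by
    apply Globular.ext
    change hcomp (hcomp (cellId _) α.cell _) (cellId _) _ = cellComp (assocHom _ _ _)
      (cellComp (hcomp (cellId _) (hcomp α.cell (cellId _) _) _) (assocInv _ _ _))
    rw [← cellComp_assoc, ← assoc_naturality, cellComp_assoc, assoc_hom_inv, cellComp_id]
  whisker_exchange α β := by
    apply Globular.ext
    change cellComp (hcomp _ _ _) (hcomp _ _ _) = cellComp (hcomp _ _ _) (hcomp _ _ _)
    rw [← hcomp_cellComp, ← hcomp_cellComp]
    congr 1 <;> simp
  pentagon m n p q := Globular.ext (pro_pentagon (D := D) m n p q)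
  triangle m n := Globular.ext (pro_triangle (D := D) m n)

end Underlying

/-! ### Products of bicategories, diagonals, biadjunctions, direct sums -/

section Bicategories

/-- The power `B ^ I` of a bicategory, with componentwise structure. -/
instance powerBicategory (I : Type) (B : Type u) [Bicategory.{w, v} B] :
    Bicategory.{w, v} (I → B) where
  Hom x y := ∀ i, x i ⟶ y i
  id x := fun i => 𝟙 (x i)
  comp f g := fun i => f i ≫ g i
  homCategory x y := CategoryTheory.pi fun i => (x i ⟶ y i)
  whiskerLeft f _ _ θ := fun i => f i ◁ θ i
  whiskerRight θ h := fun i => θ i ▷ h i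
  associator f g h :=
    { hom := fun i => (α_ (f i) (g i) (h i)).hom
      inv := fun i => (α_ (f i) (g i) (h i)).inv
      hom_inv_id := funext fun _ => Iso.hom_inv_id _
      inv_hom_id := funext fun _ => Iso.inv_hom_id _ }
  leftUnitor f :=
    { hom := fun i => (λ_ (f i)).hom
      inv := fun i => (λ_ (f i)).inv
      hom_inv_id := funext fun _ => Iso.hom_inv_id _
      inv_hom_id := funext fun _ => Iso.inv_hom_id _ }
  rightUnitor f :=
    { hom := fun i => (ρ_ (f i)).hom
      inv := fun i => (ρ_ (f i)).inv
      hom_inv_id := funext fun _ => Iso.hom_inv_id _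
      inv_hom_id := funext fun _ => Iso.inv_hom_id _ }
  whiskerLeft_id _ _ := funext fun _ => Bicategory.whiskerLeft_id _ _
  whiskerLeft_comp _ _ _ _ _ _ := funext fun _ => Bicategory.whiskerLeft_comp _ _ _
  id_whiskerLeft _ := funext fun _ => Bicategory.id_whiskerLeft _
  comp_whiskerLeft _ _ _ _ _ := funext fun _ => Bicategory.comp_whiskerLeft _ _ _
  id_whiskerRight _ _ := funext fun _ => Bicategory.id_whiskerRight _ _
  comp_whiskerRight _ _ _ := funext fun _ => Bicategory.comp_whiskerRight _ _ _
  whiskerRight_id _ := funext fun _ => Bicategory.whiskerRight_id _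
  whiskerRight_comp _ _ _ := funext fun _ => Bicategory.whiskerRight_comp _ _ _
  whisker_assoc _ _ _ _ _ := funext fun _ => Bicategory.whisker_assoc _ _ _
  whisker_exchange _ _ := funext fun _ => Bicategory.whisker_exchange _ _
  pentagon _ _ _ _ := funext fun _ => Bicategory.pentagon _ _ _ _
  triangle _ _ := funext fun _ => Bicategory.triangle _ _

/-- The diagonal pseudofunctor `B ⥤ᵖ B ^ I`. -/
def diagonal (I : Type) (B : Type u) [Bicategory.{w, v} B] : Pseudofunctor B (I → B) where
  obj b := fun _ => b
  map f := fun _ => f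
  map₂ η := fun _ => η
  map₂_id _ := rfl
  map₂_comp _ _ := rfl
  mapId _ := Iso.refl _
  mapComp _ _ := Iso.refl _
  map₂_whisker_left f _ _ η := by
    funext i
    change f ◁ η = 𝟙 _ ≫ f ◁ η ≫ 𝟙 _
    simp
  map₂_whisker_right η h := by
    funext i
    change η ▷ h = 𝟙 _ ≫ η ▷ h ≫ 𝟙 _
    simp
  map₂_associator f g h := by
    funext i
    change (α_ f g h).hom = 𝟙 _ ≫ 𝟙 _ ▷ h ≫ (α_ f g h).hom ≫ f ◁ 𝟙 _ ≫ 𝟙 _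
    simp
  map₂_left_unitor f := by
    funext i
    change (λ_ f).hom = 𝟙 _ ≫ 𝟙 _ ▷ f ≫ (λ_ f).hom
    simp
  map₂_right_unitor f := by
    funext i
    change (ρ_ f).hom = 𝟙 _ ≫ f ◁ 𝟙 _ ≫ (ρ_ f).hom
    simp

variable {B : Type u} [Bicategory.{w, v} B] {C : Type u₂} [Bicategory.{w₂, v₂} C]

/-- A biadjunction `F ⊣ G` between bicategories: pseudonatural unit and counit, and invertible
modifications from the identity of `F` to
`F unit ≫ counit F` and from `unit G ≫ G counit` to the identity of `G`, satisfying the swallowtail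
identities. All modifications and pasting diagrams are written out in components. -/
structure Biadjunction (F : Pseudofunctor B C) (G : Pseudofunctor C B) where
  unit : Pseudofunctor.StrongTrans (Pseudofunctor.id B) (F.comp G)
  counit : Pseudofunctor.StrongTrans (G.comp F) (Pseudofunctor.id C)
  triangulatorLeft (b : B) : 𝟙 (F.obj b) ≅ F.map (unit.app b) ≫ counit.app (F.obj b)
  triangulatorRight (c : C) : unit.app (G.obj c) ≫ G.map (counit.app c) ≅ 𝟙 (G.obj c)
  /-- `triangulatorLeft` is a modification. -/
  triangulatorLeft_naturality {b b' : B} (f : b ⟶ b') :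
    F.map f ◁ (triangulatorLeft b').hom ≫ (α_ _ _ _).inv ≫
        ((F.mapComp f (unit.app b')).inv ≫ F.map₂ (unit.naturality f).hom ≫
          (F.mapComp (unit.app b) (G.map (F.map f))).hom) ▷ counit.app (F.obj b') ≫
        (α_ _ _ _).hom ≫ F.map (unit.app b) ◁ (counit.naturality (F.map f)).hom ≫
        (α_ _ _ _).inv =
      (ρ_ (F.map f)).hom ≫ (λ_ (F.map f)).inv ≫ (triangulatorLeft b).hom ▷ F.map f
  /-- `triangulatorRight` is a modification. -/
  triangulatorRight_naturality {c c' : C} (g : c ⟶ c') :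
    G.map g ◁ (triangulatorRight c').hom ≫ (ρ_ (G.map g)).hom ≫ (λ_ (G.map g)).inv =
      (α_ _ _ _).inv ≫ (unit.naturality (G.map g)).hom ▷ G.map (counit.app c') ≫
        (α_ _ _ _).hom ≫ unit.app (G.obj c) ◁
          ((G.mapComp (F.map (G.map g)) (counit.app c')).inv ≫
            G.map₂ (counit.naturality g).hom ≫ (G.mapComp (counit.app c) g).hom) ≫
        (α_ _ _ _).inv ≫ (triangulatorRight c).hom ▷ G.map g
  /-- The first swallowtail identity. -/
  swallowtail_unit (b : B) :
    (ρ_ (unit.app b)).inv ≫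
      unit.app b ◁ ((G.mapId (F.obj b)).inv ≫ G.map₂ (triangulatorLeft b).hom ≫
        (G.mapComp (F.map (unit.app b)) (counit.app (F.obj b))).hom) ≫
      (α_ _ _ _).inv ≫ (unit.naturality (unit.app b)).inv ▷ G.map (counit.app (F.obj b)) ≫
      (α_ _ _ _).hom ≫ unit.app b ◁ (triangulatorRight (F.obj b)).hom ≫
      (ρ_ (unit.app b)).hom = 𝟙 (unit.app b)
  /-- The second swallowtail identity. -/
  swallowtail_counit (c : C) :
    (λ_ (counit.app c)).inv ≫ (triangulatorLeft (G.obj c)).hom ▷ counit.app c ≫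
      (α_ _ _ _).hom ≫ F.map (unit.app (G.obj c)) ◁ (counit.naturality (counit.app c)).inv ≫
      (α_ _ _ _).inv ≫
      ((F.mapComp (unit.app (G.obj c)) (G.map (counit.app c))).inv ≫
        F.map₂ (triangulatorRight c).hom ≫ (F.mapId (G.obj c)).hom) ▷ counit.app c ≫
      (λ_ (counit.app c)).hom = 𝟙 (counit.app c)

/-- The 1-cells `ι i : x i ⟶ s` exhibit `s` as a bicategorical coproduct of the family `x`:
for every object `z`, restriction along the `ι i` is an equivalence of categories
`B(s, z) ≌ ∏ i, B(x i, z)`. -/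
def IsBicategoricalCoproduct {I : Type} {x : I → B} {s : B} (ι : ∀ i, x i ⟶ s) : Prop :=
  ∀ z : B, (Functor.pi' fun i => Bicategory.precomp z (ι i)).IsEquivalence

/-- The 1-cells `π i : s ⟶ x i` exhibit `s` as a bicategorical product of the family `x`:
for every object `z`, composition with the `π i` is an equivalence of categories
`B(z, s) ≌ ∏ i, B(z, x i)`. -/
def IsBicategoricalProduct {I : Type} {x : I → B} {s : B} (π : ∀ i, s ⟶ x i) : Prop :=
  ∀ z : B, (Functor.pi' fun i => Bicategory.postcomp z (π i)).IsEquivalence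

/-- A bicategory has direct sums if every finite family of objects has a bicategorical coproduct
and a bicategorical product with the same underlying object. -/
def HasDirectSums (B : Type u) [Bicategory.{w, v} B] : Prop :=
  ∀ (I : Type) [Finite I] (x : I → B), ∃ (s : B) (ι : ∀ i, x i ⟶ s) (π : ∀ i, s ⟶ x i),
    IsBicategoricalCoproduct ι ∧ IsBicategoricalProduct π

end Bicategories

/-! ### Companions and conjoints -/

namespace DoubleCategory

variable {D : Type u} [DoubleCategory.{t, w, v} D]

/-- The structure of a companion of the arrow `f` on the proarrow `p`. -/
structure CompanionData {x y : D} (f : x ⟶ y) (p : Pro x y) where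
  unit : Cell (proId x) p
  counit : Cell p (proId y)
  left_unit : left unit = 𝟙 x
  right_unit : right unit = f
  left_counit : left counit = f
  right_counit : right counit = 𝟙 y
  unit_counit : cellComp unit counit = idCell f
  unit_hcomp_counit :
    cellComp (leftUnitorInv p) (cellComp (hcomp unit counit (right_unit.trans left_counit.symm))
      (rightUnitorHom p)) = cellId p

/-- The structure of a conjoint of the arrow `f` on the proarrow `p`. -/
structure ConjointData {x y : D} (f : x ⟶ y) (p : Pro y x) where
  unit : Cell (proId x) p
  counit : Cell p (proId y)
  left_unit : left unit = f
  right_unit : right unit = 𝟙 x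
  left_counit : left counit = 𝟙 y
  right_counit : right counit = f
  unit_counit : cellComp unit counit = idCell f
  counit_hcomp_unit :
    cellComp (rightUnitorInv p) (cellComp (hcomp counit unit (right_counit.trans left_unit.symm))
      (leftUnitorHom p)) = cellId p

/-- Given companions `p` of `f` and `q` of `g`, a cell `α : m ⟶ n` with left boundary `f` and right
boundary `g` is reshaped into the globular cell `m ⊙ q ⟶ p ⊙ n` given by pasting `α` with the unit
of `p` and the counit of `q`. -/
def companionSlide {x y x' y' : D} {f : x ⟶ x'} {g : y ⟶ y'} {p : Pro x x'} {q : Pro y y'}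
    (cf : CompanionData f p) (cg : CompanionData g q) {m : Pro x y} {n : Pro x' y'}
    (α : Cell m n) (hl : left α = f) (hr : right α = g) : Cell (proComp m q) (proComp p n) :=
  cellComp (hcomp (leftUnitorInv m) (cellId q) (by simp))
    (cellComp
      (hcomp (hcomp cf.unit α (by rw [cf.right_unit, hl])) cg.counit
        (by rw [right_hcomp, hr, cg.left_counit]))
      (rightUnitorHom (proComp p n)))

/-- Given conjoints `p` of `f` and `q` of `g`, a cell `α : m ⟶ n` with left boundary `f` and right
boundary `g` is reshaped into the globular cell `p ⊙ m ⟶ n ⊙ q` given by pasting `α` with the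
counit of `p` and the unit of `q`. -/
def conjointSlide {x y x' y' : D} {f : x ⟶ x'} {g : y ⟶ y'} {p : Pro x' x} {q : Pro y' y}
    (cf : ConjointData f p) (cg : ConjointData g q) {m : Pro x y} {n : Pro x' y'}
    (α : Cell m n) (hl : left α = f) (hr : right α = g) : Cell (proComp p m) (proComp n q) :=
  cellComp (hcomp (cellId p) (rightUnitorInv m) (by simp))
    (cellComp
      (hcomp cf.counit (hcomp α cg.unit (by rw [cg.left_unit, hr]))
        (by rw [left_hcomp, hl, cf.right_counit]))
      (leftUnitorHom (proComp n q)))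

/-! ### Strong finite coproducts

A span of sets from `I` to `J` is given by the family `A : I → J → Type` of fibres of its apex
over `I × J`; thus a family of proarrows from `x : I → D` to `y : J → D` indexed by the span
consists of a proarrow `m i j a : Pro (x i) (y j)` for all `i`, `j` and `a : A i j`.
In these terms the composite of spans (the pullback) has the fibres `Σ j, A i j × B j k`, and the
identity span has the fibres `PLift (i = j)`. -/

/-- The cells `κ i j a : m i j a ⟶ P`, lying over the arrows `s i` on the left and `r j` on the
right, exhibit `P` as a coproduct of the span-indexed family of proarrows `m`: for all arrows
`f`, `g` out of the source and target of `P`, every family of cells from `m` to a proarrow `n`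
lying over the arrows `s i ≫ f` and `r j ≫ g` factors through `κ` by a unique cell `P ⟶ n` lying
over `f` and `g`. -/
structure IsSpanCoproduct {I J : Type} {x : I → D} {y : J → D} {A : I → J → Type}
    (m : ∀ i j, A i j → Pro (x i) (y j)) {X Y : D} (s : ∀ i, x i ⟶ X) (r : ∀ j, y j ⟶ Y)
    (P : Pro X Y) (κ : ∀ i j (a : A i j), Cell (m i j a) P) : Prop where
  left_eq : ∀ i j a, left (κ i j a) = s i
  right_eq : ∀ i j a, right (κ i j a) = r j
  existsUnique : ∀ {z w : D} (n : Pro z w) (f : X ⟶ z) (g : Y ⟶ w)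
    (φ : ∀ i j (a : A i j), Cell (m i j a) n), (∀ i j a, left (φ i j a) = s i ≫ f) →
    (∀ i j a, right (φ i j a) = r j ≫ g) →
    ∃! ψ : Cell P n, left ψ = f ∧ right ψ = g ∧ ∀ i j a, cellComp (κ i j a) ψ = φ i j a

/-- The composite of two composable span-indexed families of proarrows. -/
def compFamily {I J K : Type} {x : I → D} {y : J → D} {z : K → D} {A : I → J → Type}
    {B : J → K → Type} (m : ∀ i j, A i j → Pro (x i) (y j)) (n : ∀ j k, B j k → Pro (y j) (z k)) :
    ∀ i k, (Σ j, A i j × B j k) → Pro (x i) (z k) :=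
  fun i k a => proComp (m i a.1 a.2.1) (n a.1 k a.2.2)

/-- A parallel family of proarrows, as a family indexed by the identity span. -/
def parallelFamily {I : Type} {x y : I → D} (m : ∀ i, Pro (x i) (y i)) :
    ∀ i j, PLift (i = j) → Pro (x i) (y j)
  | i, _, ⟨rfl⟩ => m i

/-- A parallel family of cells into a single proarrow, as a family indexed by the identity
span. -/
def parallelCells {I : Type} {x y : I → D} {m : ∀ i, Pro (x i) (y i)} {X Y : D} {P : Pro X Y}
    (κ : ∀ i, Cell (m i) P) : ∀ i j (a : PLift (i = j)), Cell (parallelFamily m i j a) P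
  | i, _, ⟨rfl⟩ => κ i

variable (D) in
/-- Strong finite coproducts in a double category: every finite family of objects has a (chosen)
coproduct, every finite span-indexed family of proarrows has a (chosen) coproduct between the
chosen coproducts of objects, and coproducts of span-indexed families commute with external
composition and external identities, in the sense that external composites and identities of
coproducts, with the composite and identity coprojections, are again coproducts. Equivalently, the
canonical comparison cells are invertible. The choice of coproducts is normalized: the coproduct
of a family consisting of a single object is the object itself. -/
structure StrongFiniteCoproducts where
  cofan {I : Type} [Finite I] (x : I → D) : Cofan x
  isColimit {I : Type} [Finite I] (x : I → D) : IsColimit (cofan x)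
  cofan_single (x : D) : cofan (fun _ : PUnit.{1} => x) = Cofan.mk x fun _ => 𝟙 x
  pro {I J : Type} [Finite I] [Finite J] {x : I → D} {y : J → D} {A : I → J → Type}
    [∀ i j, Finite (A i j)] (m : ∀ i j, A i j → Pro (x i) (y j)) : Pro (cofan x).pt (cofan y).pt
  incl {I J : Type} [Finite I] [Finite J] {x : I → D} {y : J → D} {A : I → J → Type}
    [∀ i j, Finite (A i j)] (m : ∀ i j, A i j → Pro (x i) (y j)) (i : I) (j : J) (a : A i j) :
    Cell (m i j a) (pro m)
  isSpanCoproduct {I J : Type} [Finite I] [Finite J] {x : I → D} {y : J → D} {A : I → J → Type}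
    [∀ i j, Finite (A i j)] (m : ∀ i j, A i j → Pro (x i) (y j)) :
    IsSpanCoproduct m (cofan x).inj (cofan y).inj (pro m) (incl m)
  isSpanCoproduct_comp {I J K : Type} [Finite I] [Finite J] [Finite K] {x : I → D} {y : J → D}
    {z : K → D} {A : I → J → Type} {B : J → K → Type} [∀ i j, Finite (A i j)]
    [∀ j k, Finite (B j k)] (m : ∀ i j, A i j → Pro (x i) (y j))
    (n : ∀ j k, B j k → Pro (y j) (z k)) :
    IsSpanCoproduct (compFamily m n) (cofan x).inj (cofan z).inj (proComp (pro m) (pro n))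
      (fun i k a => hcomp (incl m i a.1 a.2.1) (incl n a.1 k a.2.2)
        (((isSpanCoproduct m).right_eq _ _ _).trans ((isSpanCoproduct n).left_eq _ _ _).symm))
  isSpanCoproduct_id {I : Type} [Finite I] (x : I → D) :
    IsSpanCoproduct (parallelFamily fun i => proId (x i)) (cofan x).inj (cofan x).inj
      (proId (cofan x).pt) (parallelCells fun i => idCell ((cofan x).inj i))

namespace StrongFiniteCoproducts

/-- The universal property of coproducts of parallel families. -/
lemma existsUnique_of_isSpanCoproduct {I : Type} {x y : I → D} {m : ∀ i, Pro (x i) (y i)} {X Y : D}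
    {s : ∀ i, x i ⟶ X} {r : ∀ j, y j ⟶ Y} {P : Pro X Y} {κ : ∀ i, Cell (m i) P}
    (h : IsSpanCoproduct (parallelFamily m) s r P (parallelCells κ))
    {z w : D} (n : Pro z w) (f : X ⟶ z) (g : Y ⟶ w) (φ : ∀ i, Cell (m i) n)
    (hl : ∀ i, left (φ i) = s i ≫ f) (hr : ∀ i, right (φ i) = r i ≫ g) :
    ∃! ψ : Cell P n, left ψ = f ∧ right ψ = g ∧ ∀ i, cellComp (κ i) ψ = φ i := by
  obtain ⟨ψ, ⟨h1, h2, h3⟩, h4⟩ := h.existsUnique n f g (parallelCells φ)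
    (by rintro i _ ⟨rfl⟩; exact hl i) (by rintro i _ ⟨rfl⟩; exact hr i)
  refine ⟨ψ, ⟨h1, h2, fun i => h3 i i ⟨rfl⟩⟩, fun ψ' ⟨k1, k2, k3⟩ => h4 ψ' ⟨k1, k2, ?_⟩⟩
  rintro i _ ⟨rfl⟩
  exact k3 i

variable (S : StrongFiniteCoproducts D) {I : Type} [Finite I]

/-- The coproduct of a finite family of objects. -/
abbrev sum (x : I → D) : D := (S.cofan x).pt

/-- The coprojections. -/
abbrev inj (x : I → D) (i : I) : x i ⟶ S.sum x := (S.cofan x).inj i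

/-- The codiagonal. -/
def codiag (I : Type) [Finite I] (z : D) : S.sum (fun _ : I => z) ⟶ z :=
  Cofan.IsColimit.desc (S.isColimit _) fun _ => 𝟙 z

lemma inj_codiag (z : D) (i : I) : S.inj (fun _ : I => z) i ≫ S.codiag I z = 𝟙 z :=
  Cofan.IsColimit.fac (S.isColimit _) _ i

/-- The coproduct of a finite parallel family of proarrows. -/
def sumPro {x y : I → D} (m : ∀ i, Pro (x i) (y i)) : Pro (S.sum x) (S.sum y) :=
  S.pro (parallelFamily m)

/-- The coprojections of the coproduct of a finite parallel family of proarrows. -/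
def inclPro {x y : I → D} (m : ∀ i, Pro (x i) (y i)) (i : I) : Cell (m i) (S.sumPro m) :=
  S.incl (parallelFamily m) i i ⟨rfl⟩

@[simp]
lemma left_inclPro {x y : I → D} (m : ∀ i, Pro (x i) (y i)) (i : I) :
    left (S.inclPro m i) = S.inj x i :=
  (S.isSpanCoproduct (parallelFamily m)).left_eq i i ⟨rfl⟩

@[simp]
lemma right_inclPro {x y : I → D} (m : ∀ i, Pro (x i) (y i)) (i : I) :
    right (S.inclPro m i) = S.inj y i :=
  (S.isSpanCoproduct (parallelFamily m)).right_eq i i ⟨rfl⟩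

lemma incl_parallelFamily {x y : I → D} (m : ∀ i, Pro (x i) (y i)) :
    S.incl (parallelFamily m) = parallelCells (P := S.sumPro m) (S.inclPro m) := by
  funext i j a
  obtain ⟨rfl⟩ := a
  rfl

lemma isSpanCoproduct_sumPro {x y : I → D} (m : ∀ i, Pro (x i) (y i)) :
    IsSpanCoproduct (parallelFamily m) (S.inj x) (S.inj y) (S.sumPro m)
      (parallelCells (S.inclPro m)) :=
  S.incl_parallelFamily m ▸ S.isSpanCoproduct (parallelFamily m)

lemma isSpanCoproduct_sumPro_comp {x y z : I → D} (m : ∀ i, Pro (x i) (y i))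
    (n : ∀ i, Pro (y i) (z i)) :
    IsSpanCoproduct (parallelFamily fun i => proComp (m i) (n i)) (S.inj x) (S.inj z)
      (proComp (S.sumPro m) (S.sumPro n))
      (parallelCells fun i => hcomp (S.inclPro m i) (S.inclPro n i) (by simp)) where
  left_eq := by rintro i _ ⟨rfl⟩; exact (left_hcomp _ _ _).trans (S.left_inclPro m i)
  right_eq := by rintro i _ ⟨rfl⟩; exact (right_hcomp _ _ _).trans (S.right_inclPro n i)
  existsUnique {_ _} p f g φ hl hr := by
    obtain ⟨ψ, ⟨h1, h2, h3⟩, h4⟩ :=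
      (S.isSpanCoproduct_comp (parallelFamily m) (parallelFamily n)).existsUnique p f g
        (fun i k a => match i, k, a with
          | i, _, ⟨_, ⟨rfl⟩, ⟨rfl⟩⟩ => φ i i ⟨rfl⟩)
        (by rintro i _ ⟨_, ⟨rfl⟩, ⟨rfl⟩⟩; exact hl i i ⟨rfl⟩)
        (by rintro i _ ⟨_, ⟨rfl⟩, ⟨rfl⟩⟩; exact hr i i ⟨rfl⟩)
    refine ⟨ψ, ⟨h1, h2, ?_⟩, fun ψ' ⟨k1, k2, k3⟩ => h4 ψ' ⟨k1, k2, ?_⟩⟩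
    · rintro i _ ⟨rfl⟩
      exact h3 i i ⟨i, ⟨rfl⟩, ⟨rfl⟩⟩
    · rintro i _ ⟨_, ⟨rfl⟩, ⟨rfl⟩⟩
      exact k3 i i ⟨rfl⟩

/-- The cell out of a coproduct of proarrows determined by a family of cells. -/
noncomputable def descPro {x y : I → D} {m : ∀ i, Pro (x i) (y i)} {z w : D} {n : Pro z w}
    (f : S.sum x ⟶ z) (g : S.sum y ⟶ w) (φ : ∀ i, Cell (m i) n)
    (hl : ∀ i, left (φ i) = S.inj x i ≫ f) (hr : ∀ i, right (φ i) = S.inj y i ≫ g) :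
    Cell (S.sumPro m) n :=
  (existsUnique_of_isSpanCoproduct (S.isSpanCoproduct_sumPro m) n f g φ hl hr).choose

section

variable {x y : I → D} {m : ∀ i, Pro (x i) (y i)} {z w : D} {n : Pro z w}
    (f : S.sum x ⟶ z) (g : S.sum y ⟶ w) (φ : ∀ i, Cell (m i) n)
    (hl : ∀ i, left (φ i) = S.inj x i ≫ f) (hr : ∀ i, right (φ i) = S.inj y i ≫ g)

@[simp]
lemma left_descPro : left (S.descPro f g φ hl hr) = f :=
  (existsUnique_of_isSpanCoproduct
    (S.isSpanCoproduct_sumPro m) n f g φ hl hr).choose_spec.1.1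

@[simp]
lemma right_descPro : right (S.descPro f g φ hl hr) = g :=
  (existsUnique_of_isSpanCoproduct
    (S.isSpanCoproduct_sumPro m) n f g φ hl hr).choose_spec.1.2.1

@[simp]
lemma inclPro_descPro (i : I) : cellComp (S.inclPro m i) (S.descPro f g φ hl hr) = φ i :=
  (existsUnique_of_isSpanCoproduct
    (S.isSpanCoproduct_sumPro m) n f g φ hl hr).choose_spec.1.2.2 i

@[simp]
lemma inclPro_descPro_assoc (i : I) {z' w' : D} {p : Pro z' w'} (β : Cell n p) :
    cellComp (S.inclPro m i) (cellComp (S.descPro f g φ hl hr) β) = cellComp (φ i) β := by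
  rw [← cellComp_assoc, inclPro_descPro]

lemma sumPro_hom_ext {α β : Cell (S.sumPro m) n} (h1 : left α = left β) (h2 : right α = right β)
    (h : ∀ i, cellComp (S.inclPro m i) α = cellComp (S.inclPro m i) β) : α = β :=
  (existsUnique_of_isSpanCoproduct (S.isSpanCoproduct_sumPro m) n (left β) (right β)
    (fun i => cellComp (S.inclPro m i) β) (by simp) (by simp)).unique
    ⟨h1, h2, h⟩ ⟨rfl, rfl, fun _ => rfl⟩

end

/-- A coproduct of a parallel family is globularly isomorphic to the chosen one. -/
noncomputable def isoOfIsSpanCoproduct {x y : I → D} {m : ∀ i, Pro (x i) (y i)}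
    {P : Pro (S.sum x) (S.sum y)} {κ : ∀ i, Cell (m i) P}
    (h : IsSpanCoproduct (parallelFamily m) (S.inj x) (S.inj y) P (parallelCells κ)) :
    Iso (C := (Loose.mk (S.sum x) ⟶ Loose.mk (S.sum y))) (S.sumPro m) P :=
  have hl (i : I) : left (κ i) = S.inj x i := h.left_eq i i ⟨rfl⟩
  have hr (i : I) : right (κ i) = S.inj y i := h.right_eq i i ⟨rfl⟩
  have hs := existsUnique_of_isSpanCoproduct h (S.sumPro m) (𝟙 _) (𝟙 _) (S.inclPro m)
    (by simp) (by simp)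
  { hom := Globular.mk (S.descPro (𝟙 _) (𝟙 _) κ (by simp [hl]) (by simp [hr])) (by simp) (by simp)
    inv := Globular.mk hs.choose hs.choose_spec.1.1 hs.choose_spec.1.2.1
    hom_inv_id := by
      apply Globular.ext
      change cellComp (S.descPro (𝟙 _) (𝟙 _) κ (by simp [hl]) (by simp [hr])) hs.choose = cellId _
      apply S.sumPro_hom_ext
      · simp only [left_cellComp, left_descPro, left_cellId, Category.id_comp]
        exact hs.choose_spec.1.1
      · simp only [right_cellComp, right_descPro, right_cellId, Category.id_comp]
        exact hs.choose_spec.1.2.1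
      · intro i
        rw [inclPro_descPro_assoc, cellComp_id]
        exact hs.choose_spec.1.2.2 i
    inv_hom_id := by
      apply Globular.ext
      change cellComp hs.choose (S.descPro (𝟙 _) (𝟙 _) κ (by simp [hl]) (by simp [hr])) = cellId _
      refine (existsUnique_of_isSpanCoproduct h P (𝟙 _) (𝟙 _) κ (by simp [hl])
        (by simp [hr])).unique ⟨?_, ?_, ?_⟩ ⟨?_, ?_, ?_⟩
      · simp only [left_cellComp, left_descPro, Category.comp_id]
        exact hs.choose_spec.1.1
      · simp only [right_cellComp, right_descPro, Category.comp_id]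
        exact hs.choose_spec.1.2.1
      · intro i
        rw [← cellComp_assoc, hs.choose_spec.1.2.2 i, inclPro_descPro]
      · simp
      · simp
      · simp }

section

variable {x y : I → D} {m : ∀ i, Pro (x i) (y i)}
    {P : Pro (S.sum x) (S.sum y)} {κ : ∀ i, Cell (m i) P}
    (h : IsSpanCoproduct (parallelFamily m) (S.inj x) (S.inj y) P (parallelCells κ))

lemma inclPro_iso_hom (i : I) :
    cellComp (S.inclPro m i) (S.isoOfIsSpanCoproduct h).hom.cell = κ i :=
  S.inclPro_descPro (𝟙 _) (𝟙 _) κ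
    (fun i => (h.left_eq i i ⟨rfl⟩).trans (Category.comp_id _).symm)
    (fun i => (h.right_eq i i ⟨rfl⟩).trans (Category.comp_id _).symm) i

lemma inclPro_iso_inv (i : I) :
    cellComp (κ i) (S.isoOfIsSpanCoproduct h).inv.cell = S.inclPro m i := by
  rw [← S.inclPro_iso_hom h i, cellComp_assoc]
  have := congrArg Globular.cell (S.isoOfIsSpanCoproduct h).hom_inv_id
  change cellComp _ _ = cellId _ at this
  rw [this, cellComp_id]

end

/-- The globular cell between coproducts of parallel families induced by globular cells. -/
noncomputable def sumMap {x y : I → D} {m n : ∀ i, Pro (x i) (y i)}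
    (θ : ∀ i, Globular (m i) (n i)) : Globular (S.sumPro m) (S.sumPro n) where
  cell := S.descPro (𝟙 _) (𝟙 _) (fun i => cellComp (θ i).cell (S.inclPro n i))
    (by simp) (by simp)
  left_eq := by simp
  right_eq := by simp

lemma inclPro_sumMap {x y : I → D} {m n : ∀ i, Pro (x i) (y i)}
    (θ : ∀ i, Globular (m i) (n i)) (i : I) :
    cellComp (S.inclPro m i) (S.sumMap θ).cell = cellComp (θ i).cell (S.inclPro n i) :=
  S.inclPro_descPro (𝟙 _) (𝟙 _) (fun i => cellComp (θ i).cell (S.inclPro n i))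
    (by simp) (by simp) i

/-- The comparison `⊕ (m ⊙ n) ≅ (⊕ m) ⊙ (⊕ n)`. -/
noncomputable def sumComp {x y z : I → D} (m : ∀ i, Pro (x i) (y i)) (n : ∀ i, Pro (y i) (z i)) :
    Iso (C := (Loose.mk (S.sum x) ⟶ Loose.mk (S.sum z)))
      (S.sumPro fun i => proComp (m i) (n i)) (proComp (S.sumPro m) (S.sumPro n)) :=
  S.isoOfIsSpanCoproduct (S.isSpanCoproduct_sumPro_comp m n)

/-- The comparison `⊕ id ≅ id`. -/
noncomputable def sumId (x : I → D) :
    Iso (C := (Loose.mk (S.sum x) ⟶ Loose.mk (S.sum x)))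
      (S.sumPro fun i => proId (x i)) (proId (S.sum x)) :=
  S.isoOfIsSpanCoproduct (S.isSpanCoproduct_id x)

lemma inclPro_sumComp_hom {x y z : I → D} (m : ∀ i, Pro (x i) (y i)) (n : ∀ i, Pro (y i) (z i))
    (i : I) : cellComp (S.inclPro (fun i => proComp (m i) (n i)) i) (S.sumComp m n).hom.cell =
      hcomp (S.inclPro m i) (S.inclPro n i) (by simp) :=
  S.inclPro_iso_hom _ i

lemma inclPro_sumComp_inv {x y z : I → D} (m : ∀ i, Pro (x i) (y i)) (n : ∀ i, Pro (y i) (z i))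
    (i : I) : cellComp (hcomp (S.inclPro m i) (S.inclPro n i) (by simp)) (S.sumComp m n).inv.cell =
      S.inclPro (fun i => proComp (m i) (n i)) i :=
  S.inclPro_iso_inv (S.isSpanCoproduct_sumPro_comp m n) i

lemma inclPro_sumId_hom (x : I → D) (i : I) :
    cellComp (S.inclPro (fun i => proId (x i)) i) (S.sumId x).hom.cell = idCell (S.inj x i) :=
  S.inclPro_iso_hom _ i

/-- Horizontal composition of cells, keeping track of equations only. -/
lemma hcomp_congr {x y z x' y' z' : D} {m : Pro x y} {n : Pro y z} {m' : Pro x' y'}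
    {n' : Pro y' z'} {α α' : Cell m m'} {β β' : Cell n n'} (h : right α = left β) (hα : α = α')
    (hβ : β = β') : hcomp α β h = hcomp α' β' (hα ▸ hβ ▸ h) := by
  subst hα hβ
  rfl

variable (I) in
/-- The pseudofunctor of bicategories `⊕ : 𝐃 ^ I ⥤ᵖ 𝐃` underlying the coproduct double functor:
it sends parallel families of objects, proarrows and globular cells to their coproducts. -/
noncomputable def directSum : Pseudofunctor (I → Loose D) (Loose D) where
  obj x := ⟨S.sum fun i => (x i).obj⟩
  map m := S.sumPro (D := D) m
  map₂ θ := S.sumMap θ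
  map₂_id {x y} m := by
    apply Globular.ext
    apply S.sumPro_hom_ext
    · exact (Globular.left_eq _).trans (left_cellId _).symm
    · exact (Globular.right_eq _).trans (right_cellId _).symm
    · intro i
      rw [inclPro_sumMap]
      exact (id_cellComp _).trans (cellComp_id _).symm
  map₂_comp {x y m n p} θ θ' := by
    apply Globular.ext
    apply S.sumPro_hom_ext
    · exact (Globular.left_eq _).trans (Globular.left_eq _).symm
    · exact (Globular.right_eq _).trans (Globular.right_eq _).symm
    · intro i
      change _ = cellComp _ (cellComp (S.sumMap θ).cell (S.sumMap θ').cell)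
      rw [inclPro_sumMap, ← cellComp_assoc, inclPro_sumMap, cellComp_assoc, inclPro_sumMap,
        ← cellComp_assoc]
      rfl
  mapId x := S.sumId fun i => (x i).obj
  mapComp m n := S.sumComp (D := D) m n
  map₂_whisker_left {x y z} m n p θ := by
    apply Globular.ext
    apply S.sumPro_hom_ext
    · exact (Globular.left_eq _).trans (Globular.left_eq _).symm
    · exact (Globular.right_eq _).trans (Globular.right_eq _).symm
    · intro i
      change _ = cellComp (S.inclPro (fun i => proComp (m i) (n i)) i)
        (cellComp (S.sumComp (D := D) m n).hom.cell
        (cellComp (hcomp (cellId (S.sumPro (D := D) m)) (S.sumMap θ).cell _)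
          (S.sumComp (D := D) m p).inv.cell))
      rw [inclPro_sumMap, ← cellComp_assoc, inclPro_sumComp_hom, ← cellComp_assoc,
        ← hcomp_cellComp, hcomp_congr _ (cellComp_id _) (S.inclPro_sumMap θ i)]
      refine (congrArg (cellComp _) (S.inclPro_sumComp_inv (D := D) m p i).symm).trans ?_
      rw [← cellComp_assoc]
      congr 1
      refine (hcomp_cellComp (D := D) (cellId (D := D) (m i)) (θ i).cell (S.inclPro (D := D) m i)
        (S.inclPro (D := D) p i) (by simp) (by simp)).symm.trans ?_
      exact hcomp_congr _ (id_cellComp _) rfl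
  map₂_whisker_right {x y z m n} θ p := by
    apply Globular.ext
    apply S.sumPro_hom_ext
    · exact (Globular.left_eq _).trans (Globular.left_eq _).symm
    · exact (Globular.right_eq _).trans (Globular.right_eq _).symm
    · intro i
      change _ = cellComp (S.inclPro (fun i => proComp (m i) (p i)) i)
        (cellComp (S.sumComp (D := D) m p).hom.cell
        (cellComp (hcomp (S.sumMap θ).cell (cellId (S.sumPro (D := D) p)) _)
          (S.sumComp (D := D) n p).inv.cell))
      rw [inclPro_sumMap, ← cellComp_assoc, inclPro_sumComp_hom, ← cellComp_assoc,
        ← hcomp_cellComp, hcomp_congr _ (S.inclPro_sumMap θ i) (cellComp_id _)]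
      refine (congrArg (cellComp _) (S.inclPro_sumComp_inv (D := D) n p i).symm).trans ?_
      rw [← cellComp_assoc]
      congr 1
      refine (hcomp_cellComp (D := D) (θ i).cell (cellId (D := D) (p i)) (S.inclPro (D := D) n i)
        (S.inclPro (D := D) p i) (by simp) (by simp)).symm.trans ?_
      exact hcomp_congr _ rfl (id_cellComp _)
  map₂_associator {x y z a} m n p := by
    apply Globular.ext
    apply S.sumPro_hom_ext
    · exact (Globular.left_eq _).trans (Globular.left_eq _).symm
    · exact (Globular.right_eq _).trans (Globular.right_eq _).symm
    · intro i
      change _ = cellComp (S.inclPro (fun i => proComp (proComp (m i) (n i)) (p i)) i)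
        (cellComp (S.sumComp (D := D) (fun i => proComp (m i) (n i)) p).hom.cell
        (cellComp (hcomp (S.sumComp (D := D) m n).hom.cell (cellId (S.sumPro (D := D) p)) _)
        (cellComp (assocHom _ _ _)
        (cellComp (hcomp (cellId (S.sumPro (D := D) m)) (S.sumComp (D := D) n p).inv.cell _)
          (S.sumComp (D := D) m (fun i => proComp (n i) (p i))).inv.cell))))
      rw [inclPro_sumMap, ← cellComp_assoc, inclPro_sumComp_hom, ← cellComp_assoc,
        ← hcomp_cellComp, hcomp_congr _ (S.inclPro_sumComp_hom (D := D) m n i) (cellComp_id _),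
        ← cellComp_assoc, assoc_naturality _ _ _ (by simp) (by simp), cellComp_assoc,
        ← cellComp_assoc (hcomp _ _ _), ← hcomp_cellComp,
        hcomp_congr _ (cellComp_id _) (S.inclPro_sumComp_inv (D := D) n p i),
        inclPro_sumComp_inv]
      rfl
  map₂_left_unitor {x y} m := by
    apply Globular.ext
    apply S.sumPro_hom_ext
    · exact (Globular.left_eq _).trans (Globular.left_eq _).symm
    · exact (Globular.right_eq _).trans (Globular.right_eq _).symm
    · intro i
      change _ = cellComp (S.inclPro (fun i => proComp (proId (x i).obj) (m i)) i)
        (cellComp (S.sumComp (D := D) (fun i => proId (x i).obj) m).hom.cell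
        (cellComp (hcomp (S.sumId fun i => (x i).obj).hom.cell (cellId (S.sumPro (D := D) m)) _)
        (leftUnitorHom _)))
      rw [inclPro_sumMap, ← cellComp_assoc, inclPro_sumComp_hom, ← cellComp_assoc,
        ← hcomp_cellComp, hcomp_congr _ (S.inclPro_sumId_hom (fun i => (x i).obj) i) (cellComp_id _)]
      refine (leftUnitorHom_naturality (S.inclPro (D := D) m i)).symm.trans ?_
      congr 1
      exact hcomp_congr _ (congrArg idCell (S.left_inclPro (D := D) m i)) rfl
  map₂_right_unitor {x y} m := by
    apply Globular.ext
    apply S.sumPro_hom_ext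
    · exact (Globular.left_eq _).trans (Globular.left_eq _).symm
    · exact (Globular.right_eq _).trans (Globular.right_eq _).symm
    · intro i
      change _ = cellComp (S.inclPro (fun i => proComp (m i) (proId (y i).obj)) i)
        (cellComp (S.sumComp (D := D) m (fun i => proId (y i).obj)).hom.cell
        (cellComp (hcomp (cellId (S.sumPro (D := D) m)) (S.sumId fun i => (y i).obj).hom.cell _)
        (rightUnitorHom _)))
      rw [inclPro_sumMap, ← cellComp_assoc, inclPro_sumComp_hom, ← cellComp_assoc,
        ← hcomp_cellComp, hcomp_congr _ (cellComp_id _) (S.inclPro_sumId_hom (fun i => (y i).obj) i)]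
      refine (rightUnitorHom_naturality (S.inclPro (D := D) m i)).symm.trans ?_
      congr 1
      exact hcomp_congr _ rfl (congrArg idCell (S.right_inclPro (D := D) m i))

/-- The component of the codiagonal transformation at a proarrow. -/
noncomputable def codiagPro (I : Type) [Finite I] {z w : D} (n : Pro z w) :
    Cell (S.sumPro fun _ : I => n) n :=
  S.descPro (S.codiag I z) (S.codiag I w) (fun _ => cellId n)
    (fun i => (left_cellId n).trans (S.inj_codiag z i).symm)
    (fun i => (right_cellId n).trans (S.inj_codiag w i).symm)

lemma left_codiagPro (I : Type) [Finite I] {z w : D} (n : Pro z w) :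
    left (S.codiagPro I n) = S.codiag I z :=
  S.left_descPro _ _ _ _ _

lemma right_codiagPro (I : Type) [Finite I] {z w : D} (n : Pro z w) :
    right (S.codiagPro I n) = S.codiag I w :=
  S.right_descPro _ _ _ _ _

/-- The pseudonatural transformation `θ : 1 ⟶ Δ ∘ ⊕` is obtained from the coprojections by taking
companions: its component 1-cells are companions of the coprojections of objects, and its component
2-cells are the reshaped coprojections of proarrows. -/
def IsCompanionOfInj (θ : Pseudofunctor.StrongTrans (Pseudofunctor.id (I → Loose D))
    ((S.directSum I).comp (diagonal I (Loose D)))) : Prop :=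
  ∃ c : ∀ (x : I → Loose D) (i : I), CompanionData (S.inj (fun i => (x i).obj) i) (θ.app x i),
    ∀ (x y : I → Loose D) (m : x ⟶ y) (i : I), ((θ.naturality m).hom i).cell =
      companionSlide (c x i) (c y i) (S.inclPro (D := D) m i) (S.left_inclPro (D := D) m i)
        (S.right_inclPro (D := D) m i)

/-- The pseudonatural transformation `θ : ⊕ ∘ Δ ⟶ 1` is obtained from the codiagonals by taking
companions. -/
def IsCompanionOfCodiag (θ : Pseudofunctor.StrongTrans
    ((diagonal I (Loose D)).comp (S.directSum I)) (Pseudofunctor.id (Loose D))) : Prop :=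
  ∃ c : ∀ z : Loose D, CompanionData (S.codiag I z.obj) (θ.app z),
    ∀ (z z' : Loose D) (n : z ⟶ z'), ((θ.naturality n).hom).cell =
      companionSlide (c z) (c z') (S.codiagPro (D := D) I n) (S.left_codiagPro (D := D) I n)
        (S.right_codiagPro (D := D) I n)

/-- The pseudonatural transformation `θ : 1 ⟶ ⊕ ∘ Δ` is obtained from the codiagonals by taking
conjoints. -/
def IsConjointOfCodiag (θ : Pseudofunctor.StrongTrans (Pseudofunctor.id (Loose D))
    ((diagonal I (Loose D)).comp (S.directSum I))) : Prop :=
  ∃ c : ∀ z : Loose D, ConjointData (S.codiag I z.obj) (θ.app z),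
    ∀ (z z' : Loose D) (n : z ⟶ z'), ((θ.naturality n).inv).cell =
      conjointSlide (c z) (c z') (S.codiagPro (D := D) I n) (S.left_codiagPro (D := D) I n)
        (S.right_codiagPro (D := D) I n)

/-- The pseudonatural transformation `θ : Δ ∘ ⊕ ⟶ 1` is obtained from the coprojections by taking
conjoints. -/
def IsConjointOfInj (θ : Pseudofunctor.StrongTrans
    ((S.directSum I).comp (diagonal I (Loose D))) (Pseudofunctor.id (I → Loose D))) : Prop :=
  ∃ c : ∀ (x : I → Loose D) (i : I), ConjointData (S.inj (fun i => (x i).obj) i) (θ.app x i),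
    ∀ (x y : I → Loose D) (m : x ⟶ y) (i : I), ((θ.naturality m).inv i).cell =
      conjointSlide (c x i) (c y i) (S.inclPro (D := D) m i) (S.left_inclPro (D := D) m i)
        (S.right_inclPro (D := D) m i)

end StrongFiniteCoproducts
end DoubleCategory

/-! Among objects and arrows, coproduct is left adjoint to the diagonal: the coprojections `ι` are
the unit, the codiagonals `∇` the counit, and the triangle identities `ι i ≫ ∇ = 𝟙` and `Σ ι ≫ ∇ =
𝟙` hold strictly. Both families also have components at proarrows. Companions keep the direction of
an arrow and conjoints reverse it, so this single adjunction yields two biadjunctions, `⊕ ⊣ Δ` and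
`Δ ⊣ ⊕`. Two facts make this work: `ι` and `∇` have companions and conjoints, and reshaping their
components at proarrows gives invertible globular cells, so that the resulting transformations are
pseudonatural and not just lax or oplax.

Both facts come from coproducts over spans other than identity spans. The companion of `ι i` is the
coproduct of the one-member family `id` on `x i` over the span `1 ← 1 → I` whose right leg picks
`i`; the companion of `∇` at `z` is the coproduct of the constant family `id` on `z` over `I ← I →
1`; conjoints use the opposite spans. Normalization makes the one-point ends of these spans land on
the object itself. The universal property makes the cell from the identity proarrow into this
coproduct opcartesian. It is the unit, and factoring `idCell f` through it gives the counit
(`IsOpcartesian.exists_companionData`). Since coproducts commute with external composition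
(`isSpanCoproduct_hcomp`), pasting the unit with a component of `ι` or `∇` at a proarrow is again
opcartesian, and `isIso_slide` turns this into invertibility of the reshaped cell.

The coherence equations are checked by following cells. A 2-cell into `p ≫ n`, with `p` a companion,
is determined by its composite with the projection to `n` given by the counit
(`CompanionData.cancel`), and `carries_slide` computes this composite for a reshaped cell. The
relation `Carries` is stable under pasting, so an equation of pasting diagrams reduces to tracking
one cell of the double category through each side.

The triangulators arise because companions compose and a companion of an identity arrow is
isomorphic to the identity proarrow (`isoId`), applied to the two strict triangle identities. Their
modification axioms are instances of `retraction_naturality`, and the swallowtails of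
`carries_swallowtail_unit` and `carries_swallowtail_counit`. The universal properties of `⊕` follow
from the equivalences of hom-categories given by a biadjunction (`homEquivalence`), which against
`Δ` are restriction along the companions of `ι` and composition with its conjoints. -/

namespace DoubleCategory

variable {D : Type u} [DoubleCategory.{t, w, v} D]

/-! ### Unitors and associators -/

lemma leftUnitorInv_naturality {x y x' y' : D} {m : Pro x y} {m' : Pro x' y'} (α : Cell m m') :
    cellComp (leftUnitorInv m) (hcomp (idCell (left α)) α (right_idCell _)) =
      cellComp α (leftUnitorInv m') := by
  rw [← cellComp_id (hcomp _ _ _), ← leftUnitor_hom_inv, ← cellComp_assoc (hcomp _ _ _),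
    leftUnitorHom_naturality, ← cellComp_assoc, ← cellComp_assoc, leftUnitor_inv_hom, id_cellComp]

lemma rightUnitorInv_naturality {x y x' y' : D} {m : Pro x y} {m' : Pro x' y'} (α : Cell m m') :
    cellComp (rightUnitorInv m) (hcomp α (idCell (right α)) (left_idCell _).symm) =
      cellComp α (rightUnitorInv m') := by
  rw [← cellComp_id (hcomp _ _ _), ← rightUnitor_hom_inv, ← cellComp_assoc (hcomp _ _ _),
    rightUnitorHom_naturality, ← cellComp_assoc, ← cellComp_assoc, rightUnitor_inv_hom, id_cellComp]

/-- Coherence of the underlying bicategory, read off on cells. It is what lets left and right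
reductions be exchanged over an identity proarrow. -/
lemma leftUnitorHom_proId (x : D) : leftUnitorHom (proId x) = rightUnitorHom (proId x) := by
  have h := unitors_equal (a := (Loose.mk x : Loose D))
  exact congrArg Globular.cell h

lemma leftUnitorInv_proId (x : D) : leftUnitorInv (proId x) = rightUnitorInv (proId x) := by
  have h := unitors_inv_equal (a := (Loose.mk x : Loose D))
  exact congrArg Globular.cell h

lemma assocHom_leftUnitorHom {x y z : D} (m : Pro x y) (n : Pro y z) :
    cellComp (assocHom (proId x) m n) (leftUnitorHom (proComp m n)) =
      hcomp (leftUnitorHom m) (cellId n) (by simp) := by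
  have h := congrArg Globular.cell
    (leftUnitor_comp (f := (show Loose.mk x ⟶ Loose.mk y from m))
      (g := (show Loose.mk y ⟶ Loose.mk z from n)))
  change leftUnitorHom (proComp m n) = cellComp (assocInv _ _ _)
    (hcomp (leftUnitorHom m) (cellId n) _) at h
  rw [h, ← cellComp_assoc, assoc_hom_inv, id_cellComp]

lemma assocHom_rightUnitorHom {x y z : D} (m : Pro x y) (n : Pro y z) :
    cellComp (assocHom m n (proId z)) (hcomp (cellId m) (rightUnitorHom n) (by simp)) =
      rightUnitorHom (proComp m n) :=
  (congrArg Globular.cell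
    (rightUnitor_comp (f := (show Loose.mk x ⟶ Loose.mk y from m))
      (g := (show Loose.mk y ⟶ Loose.mk z from n)))).symm

/-! ### Reductions of composite proarrows -/

/-- The external composite of a cell into an identity proarrow with a cell into `n`, as a cell
into `n`. -/
def leftReduce {x y z x' y' : D} {p : Pro x y} {q : Pro y z} {n : Pro x' y'}
    (a : Cell p (proId x')) (b : Cell q n) (h : right a = left b) : Cell (proComp p q) n :=
  cellComp (hcomp a b h) (leftUnitorHom n)

/-- The external composite of a cell into `n` with a cell into an identity proarrow, as a cell
into `n`. -/
def rightReduce {x y z x' y' : D} {p : Pro x y} {q : Pro y z} {n : Pro x' y'}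
    (a : Cell p n) (b : Cell q (proId y')) (h : right a = left b) : Cell (proComp p q) n :=
  cellComp (hcomp a b h) (rightUnitorHom n)

section

variable {x y z x' y' x'' y'' : D} {p : Pro x y} {q : Pro y z} {n : Pro x' y'} {n' : Pro x'' y''}

@[simp]
lemma left_leftReduce (a : Cell p (proId x')) (b : Cell q n) (h : right a = left b) :
    left (leftReduce a b h) = left a := by simp [leftReduce]

@[simp]
lemma right_leftReduce (a : Cell p (proId x')) (b : Cell q n) (h : right a = left b) :
    right (leftReduce a b h) = right b := by simp [leftReduce]

@[simp]
lemma left_rightReduce (a : Cell p n) (b : Cell q (proId y')) (h : right a = left b) :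
    left (rightReduce a b h) = left a := by simp [rightReduce]

@[simp]
lemma right_rightReduce (a : Cell p n) (b : Cell q (proId y')) (h : right a = left b) :
    right (rightReduce a b h) = right b := by simp [rightReduce]

lemma leftReduce_congr {a a' : Cell p (proId x')} {b b' : Cell q n} (h : right a = left b)
    (ha : a = a') (hb : b = b') : leftReduce a b h = leftReduce a' b' (ha ▸ hb ▸ h) := by
  subst ha hb
  rfl

lemma rightReduce_congr {a a' : Cell p n} {b b' : Cell q (proId y')} (h : right a = left b)
    (ha : a = a') (hb : b = b') : rightReduce a b h = rightReduce a' b' (ha ▸ hb ▸ h) := by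
  subst ha hb
  rfl

/-- Naturality of the unitor: a cell composed after a reduction acts fully on the factor landing in
`n`, while the factor landing in an identity proarrow only feels its left boundary. -/
lemma leftReduce_cellComp (a : Cell p (proId x')) (b : Cell q n) (h : right a = left b)
    (δ : Cell n n') :
    cellComp (leftReduce a b h) δ =
      leftReduce (cellComp a (idCell (left δ))) (cellComp b δ) (by simp [h]) := by
  rw [leftReduce, leftReduce, cellComp_assoc, ← leftUnitorHom_naturality, ← cellComp_assoc,
    ← hcomp_cellComp]

lemma rightReduce_cellComp (a : Cell p n) (b : Cell q (proId y')) (h : right a = left b)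
    (δ : Cell n n') :
    cellComp (rightReduce a b h) δ =
      rightReduce (cellComp a δ) (cellComp b (idCell (right δ))) (by simp [h]) := by
  rw [rightReduce, rightReduce, cellComp_assoc, ← rightUnitorHom_naturality, ← cellComp_assoc,
    ← hcomp_cellComp]

lemma hcomp_leftReduce {a b c : D} {p' : Pro a b} {q' : Pro b c} (σ : Cell p' p) (τ : Cell q' q)
    (h : right σ = left τ) (α : Cell p (proId x')) (β : Cell q n) (h' : right α = left β) :
    cellComp (hcomp σ τ h) (leftReduce α β h') =
      leftReduce (cellComp σ α) (cellComp τ β) (by simp [h, h']) := by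
  rw [leftReduce, leftReduce, ← cellComp_assoc, ← hcomp_cellComp]

lemma hcomp_rightReduce {a b c : D} {p' : Pro a b} {q' : Pro b c} (σ : Cell p' p) (τ : Cell q' q)
    (h : right σ = left τ) (α : Cell p n) (β : Cell q (proId y')) (h' : right α = left β) :
    cellComp (hcomp σ τ h) (rightReduce α β h') =
      rightReduce (cellComp σ α) (cellComp τ β) (by simp [h, h']) := by
  rw [rightReduce, rightReduce, ← cellComp_assoc, ← hcomp_cellComp]

/-- When both factors land in identity proarrows the two reductions differ only by the two unitors
of `proId`, which coincide. -/
lemma leftReduce_eq_rightReduce (a : Cell p (proId x')) (b : Cell q (proId x'))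
    (h : right a = left b) : leftReduce a b h = rightReduce a b h := by
  rw [leftReduce, rightReduce, leftUnitorHom_proId]

lemma leftReduce_idCell (b : Cell q n) (h : right (idCell (left b)) = left b) :
    leftReduce (idCell (left b)) b h = cellComp (leftUnitorHom q) b :=
  leftUnitorHom_naturality b

lemma rightReduce_idCell (a : Cell p n) (h : right a = left (idCell (right a))) :
    rightReduce a (idCell (right a)) h = cellComp (rightUnitorHom p) a :=
  rightUnitorHom_naturality a

end

/-- The globular cell `θ` carries the cell `π` to the cell `π'` under composition. -/
def Carries {x y x' y' : D} {p q : Pro x y} {n : Pro x' y'} (θ : Globular p q) (π : Cell p n)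
    (π' : Cell q n) : Prop :=
  cellComp θ.cell π' = π

/-! ### Calculus of carried cells: composition, whiskering, unitors and associators -/

namespace Carries

variable {X Y Z W : Loose D}

lemma congr {x y x' y' : D} {p q : Pro x y} {n : Pro x' y'} {θ : Globular p q} {π₁ π₂ : Cell p n}
    {π₁' π₂' : Cell q n} (h : Carries θ π₁ π₁') (hs : π₁ = π₂) (ht : π₁' = π₂') :
    Carries θ π₂ π₂' :=
  hs ▸ ht ▸ h

lemma post {x y x' y' x'' y'' : D} {p q : Pro x y} {n : Pro x' y'} {k : Pro x'' y''}
    {θ : Globular p q} {π : Cell p n} {π' : Cell q n} (h : Carries θ π π') (δ : Cell n k) :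
    Carries θ (cellComp π δ) (cellComp π' δ) :=
  (cellComp_assoc _ _ _).symm.trans (congrArg (cellComp · δ) h)

/-- This makes pasting diagrams computable: choose a cell out of each intermediate 1-cell and check
that each successive 2-cell carries one to the next. -/
lemma comp {p q r : X ⟶ Y} {x' y' : D} {n : Pro x' y'} {π : Cell (D := D) p n}
    {π' : Cell (D := D) q n} {π'' : Cell (D := D) r n} {θ : p ⟶ q} {τ : q ⟶ r}
    (h : Carries θ π π') (h' : Carries τ π' π'') : Carries (θ ≫ τ) π π'' :=
  (cellComp_assoc _ _ _).trans ((congrArg (cellComp θ.cell) h').trans h)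

lemma symm {p q : X ⟶ Y} {x' y' : D} {n : Pro x' y'} {π : Cell (D := D) p n}
    {π' : Cell (D := D) q n} {e : p ≅ q} (h : Carries e.hom π π') : Carries e.inv π' π := by
  have h2 := congrArg Globular.cell e.inv_hom_id
  change cellComp e.inv.cell e.hom.cell = cellId _ at h2
  rw [Carries, ← h, ← cellComp_assoc, h2, id_cellComp]

variable {x' y' z' : D} {n : Pro x' y'} {k : Pro y' z'}

/-- Interchange, with an identity cell on the whiskering 1-cell. -/
lemma whiskerLeft {p : X ⟶ Y} {q r : Y ⟶ Z} {θ : q ⟶ r} (a : Cell (D := D) p n)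
    {b : Cell (D := D) q k} {b' : Cell (D := D) r k} (h : Carries θ b b')
    (hs : right a = left b) (ht : right a = left b') :
    Carries (p ◁ θ) (hcomp a b hs) (hcomp a b' ht) := by
  refine (hcomp_cellComp (cellId (D := D) p) θ.cell a b' (by simp) ht).symm.trans ?_
  exact StrongFiniteCoproducts.hcomp_congr _ (id_cellComp _) h

lemma whiskerRight {p q : X ⟶ Y} {r : Y ⟶ Z} {θ : p ⟶ q} {a : Cell (D := D) p n}
    {a' : Cell (D := D) q n} (h : Carries θ a a') (b : Cell (D := D) r k)
    (hs : right a = left b) (ht : right a' = left b) :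
    Carries (θ ▷ r) (hcomp a b hs) (hcomp a' b ht) := by
  refine (hcomp_cellComp θ.cell (cellId (D := D) r) a' b (by simp) ht).symm.trans ?_
  exact StrongFiniteCoproducts.hcomp_congr _ h (id_cellComp _)

lemma whiskerLeft_leftReduce {p : X ⟶ Y} {q r : Y ⟶ Z} {θ : q ⟶ r}
    (a : Cell (D := D) p (proId x')) {b : Cell (D := D) q n} {b' : Cell (D := D) r n}
    (h : Carries θ b b') (hs : right a = left b) (ht : right a = left b') :
    Carries (p ◁ θ) (leftReduce a b hs) (leftReduce a b' ht) :=
  (whiskerLeft a h hs ht).post _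

lemma whiskerLeft_rightReduce {p : X ⟶ Y} {q r : Y ⟶ Z} {θ : q ⟶ r} (a : Cell (D := D) p n)
    {b : Cell (D := D) q (proId y')} {b' : Cell (D := D) r (proId y')}
    (h : Carries θ b b') (hs : right a = left b) (ht : right a = left b') :
    Carries (p ◁ θ) (rightReduce a b hs) (rightReduce a b' ht) :=
  (whiskerLeft a h hs ht).post _

lemma whiskerRight_leftReduce {p q : X ⟶ Y} {r : Y ⟶ Z} {θ : p ⟶ q}
    {a : Cell (D := D) p (proId x')} {a' : Cell (D := D) q (proId x')} (h : Carries θ a a')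
    (b : Cell (D := D) r n) (hs : right a = left b) (ht : right a' = left b) :
    Carries (θ ▷ r) (leftReduce a b hs) (leftReduce a' b ht) :=
  (whiskerRight h b hs ht).post _

lemma whiskerRight_rightReduce {p q : X ⟶ Y} {r : Y ⟶ Z} {θ : p ⟶ q} {a : Cell (D := D) p n}
    {a' : Cell (D := D) q n} (h : Carries θ a a') (b : Cell (D := D) r (proId y'))
    (hs : right a = left b) (ht : right a' = left b) :
    Carries (θ ▷ r) (rightReduce a b hs) (rightReduce a' b ht) :=
  (whiskerRight h b hs ht).post _

lemma leftUnitor {p : X ⟶ Y} (b : Cell (D := D) p n) :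
    Carries (λ_ p).hom (leftReduce (idCell (left b)) b (by simp)) b :=
  (leftReduce_idCell _ _).symm

lemma rightUnitor {p : X ⟶ Y} (a : Cell (D := D) p n) :
    Carries (ρ_ p).hom (rightReduce a (idCell (right a)) (by simp)) a :=
  (rightReduce_idCell _ _).symm

variable {p : X ⟶ Y} {q : Y ⟶ Z} {r : Z ⟶ W}

/-- `α ; a ⊙ (b ⊙ c ; λ) = (a ⊙ b ; ρ) ⊙ c` -/
lemma associator_hcomp_leftReduce (a : Cell (D := D) p n) (b : Cell (D := D) q (proId y'))
    (c : Cell (D := D) r k) (h : right a = left b) (h' : right b = left c) :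
    Carries (α_ p q r).hom (hcomp (rightReduce a b h) c (by simp [h']))
      (hcomp a (leftReduce b c h') (by simp [h])) := by
  change cellComp (assocHom _ _ _) (hcomp a (cellComp (hcomp b c h') (leftUnitorHom k)) _) =
    hcomp (cellComp (hcomp a b h) (rightUnitorHom n)) c _
  -- Writing `a` as `a` followed by an identity cell lets interchange split off the unitor, after
  -- which associator naturality and the triangle axiom apply.
  rw [← StrongFiniteCoproducts.hcomp_congr (by simpa using h) (cellComp_id a) rfl,
    hcomp_cellComp a _ (cellId n) (leftUnitorHom k) (by simpa using h) (by simp), ← cellComp_assoc,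
    ← assoc_naturality _ _ _ h h', cellComp_assoc, pro_triangle, ← hcomp_cellComp]
  exact StrongFiniteCoproducts.hcomp_congr _ rfl (cellComp_id c)

lemma associator_hcomp_rightReduce (a : Cell (D := D) p n) (b : Cell (D := D) q k)
    (c : Cell (D := D) r (proId z')) (h : right a = left b) (h' : right b = left c) :
    Carries (α_ p q r).hom (rightReduce (hcomp a b h) c (by simp [h']))
      (hcomp a (rightReduce b c h') (by simp [h])) := by
  change cellComp (assocHom _ _ _) (hcomp a (cellComp (hcomp b c h') (rightUnitorHom k)) _) =
    cellComp (hcomp (hcomp a b h) c _) (rightUnitorHom _)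
  rw [← StrongFiniteCoproducts.hcomp_congr (by simpa using h) (cellComp_id a) rfl,
    hcomp_cellComp a _ (cellId n) (rightUnitorHom k) (by simpa using h) (by simp), ← cellComp_assoc,
    ← assoc_naturality _ _ _ h h', cellComp_assoc, assocHom_rightUnitorHom]

lemma associator_leftReduce_hcomp (a : Cell (D := D) p (proId x')) (b : Cell (D := D) q n)
    (c : Cell (D := D) r k) (h : right a = left b) (h' : right b = left c) :
    Carries (α_ p q r).hom (hcomp (leftReduce a b h) c (by simp [h']))
      (leftReduce a (hcomp b c h') (by simp [h])) := by
  change cellComp (assocHom _ _ _) (cellComp (hcomp a (hcomp b c h') _) (leftUnitorHom _)) =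
    hcomp (cellComp (hcomp a b h) (leftUnitorHom n)) c _
  rw [← cellComp_assoc, ← assoc_naturality _ _ _ h h', cellComp_assoc, assocHom_leftUnitorHom,
    ← hcomp_cellComp]
  exact StrongFiniteCoproducts.hcomp_congr _ rfl (cellComp_id c)

/-- The mixed case followed by a unitor; the inner reduction may be taken on either side because `a`
and `b` both land in identity proarrows. -/
lemma associator_leftReduce_leftReduce (a : Cell (D := D) p (proId x'))
    (b : Cell (D := D) q (proId x')) (c : Cell (D := D) r n) (h : right a = left b)
    (h' : right b = left c) :
    Carries (α_ p q r).hom (leftReduce (leftReduce a b h) c (by simp [h']))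
      (leftReduce a (leftReduce b c h') (by simp [h])) :=
  ((associator_hcomp_leftReduce a b c h h').post _).congr
    (leftReduce_congr _ (leftReduce_eq_rightReduce _ _ _).symm rfl) rfl

lemma associator_leftReduce_rightReduce (a : Cell (D := D) p (proId x'))
    (b : Cell (D := D) q n) (c : Cell (D := D) r (proId y')) (h : right a = left b)
    (h' : right b = left c) :
    Carries (α_ p q r).hom (rightReduce (leftReduce a b h) c (by simp [h']))
      (leftReduce a (rightReduce b c h') (by simp [h])) := by
  refine ((associator_hcomp_rightReduce a b c h h').post _).congr
    ((rightReduce_cellComp _ _ _ _).trans (rightReduce_congr _ rfl ?_)) rfl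
  simp

lemma associator_rightReduce_leftReduce (a : Cell (D := D) p n)
    (b : Cell (D := D) q (proId y')) (c : Cell (D := D) r (proId y')) (h : right a = left b)
    (h' : right b = left c) :
    Carries (α_ p q r).hom (rightReduce (rightReduce a b h) c (by simp [h']))
      (rightReduce a (leftReduce b c h') (by simp [h])) :=
  (associator_hcomp_leftReduce a b c h h').post _

end Carries

end DoubleCategory

namespace DoubleCategory

variable {D : Type u} [DoubleCategory.{t, w, v} D]

open DoubleCategory.StrongFiniteCoproducts (hcomp_congr)

/-! ### Cancellation -/

/-- The equation `H` reconstructs any cell `θ` into `P` from `left θ` and `cellComp θ s`: naturality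
of the inverse unitor moves `θ` past it, and interchange absorbs `θ` into `s`. Hence `s` is
cancellable among cells with the same left boundary. -/
lemma eq_of_cellComp_eq_of_left_section {x y z x' y' : D} {p : Pro x y} {n : Pro y z} {P : Pro x z}
    {e : Cell (proId x) p} {s : Cell P n} (h : right e = left s) (u : Cell (proComp p n) P)
    (H : cellComp (leftUnitorInv P) (cellComp (hcomp e s h) u) = cellId P) {r : Pro x' y'}
    {θ θ' : Cell r P} (hl : left θ = left θ') (hs : cellComp θ s = cellComp θ' s) : θ = θ' := by
  have key (θ : Cell r P) : θ = cellComp (leftUnitorInv r)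
      (cellComp (hcomp (cellComp (idCell (left θ)) e) (cellComp θ s) (by simp [h])) u) := by
    rw [hcomp_cellComp _ _ _ _ (by simp) h, cellComp_assoc, ← cellComp_assoc (leftUnitorInv r),
      leftUnitorInv_naturality, cellComp_assoc, H, cellComp_id]
  rw [key θ, key θ', hcomp_congr _ (congrArg (cellComp · e) (congrArg idCell hl)) hs]

lemma eq_of_cellComp_eq_of_right_section {x y z x' y' : D} {n : Pro x y} {p : Pro y z}
    {P : Pro x z} {e : Cell (proId z) p} {s : Cell P n} (h : right s = left e)
    (u : Cell (proComp n p) P)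
    (H : cellComp (rightUnitorInv P) (cellComp (hcomp s e h) u) = cellId P) {r : Pro x' y'}
    {θ θ' : Cell r P} (hr : right θ = right θ') (hs : cellComp θ s = cellComp θ' s) : θ = θ' := by
  have key (θ : Cell r P) : θ = cellComp (rightUnitorInv r)
      (cellComp (hcomp (cellComp θ s) (cellComp (idCell (right θ)) e) (by simp [h])) u) := by
    rw [hcomp_cellComp _ _ _ _ (by simp) h, cellComp_assoc, ← cellComp_assoc (rightUnitorInv r),
      rightUnitorInv_naturality, cellComp_assoc, H, cellComp_id]
  rw [key θ, key θ', hcomp_congr _ hs (congrArg (cellComp · e) (congrArg idCell hr))]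

/-- Here the identity of `P` factors as `u` followed by a reduction of `s`, so a cell out of `P` is
recovered from its left boundary and its restriction along `s`. -/
lemma eq_of_cellComp_eq_of_left_retraction {x y z x' y' : D} {p : Pro x y} {n : Pro y z}
    {P : Pro x z} {e : Cell p (proId x)} {s : Cell n P} (h : right e = left s)
    (u : Cell P (proComp p n)) (H : cellComp u (leftReduce e s h) = cellId P) {r : Pro x' y'}
    {θ θ' : Cell P r} (hl : left θ = left θ') (hs : cellComp s θ = cellComp s θ') : θ = θ' := by
  have key (θ : Cell P r) : θ = cellComp u
      (leftReduce (cellComp e (idCell (left θ))) (cellComp s θ) (by simp [h])) := by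
    rw [← leftReduce_cellComp _ _ h, ← cellComp_assoc, H, id_cellComp]
  rw [key θ, key θ', leftReduce_congr _ (congrArg (cellComp e) (congrArg idCell hl)) hs]

lemma eq_of_cellComp_eq_of_right_retraction {x y z x' y' : D} {n : Pro x y} {p : Pro y z}
    {P : Pro x z} {e : Cell p (proId z)} {s : Cell n P} (h : right s = left e)
    (u : Cell P (proComp n p)) (H : cellComp u (rightReduce s e h) = cellId P) {r : Pro x' y'}
    {θ θ' : Cell P r} (hr : right θ = right θ') (hs : cellComp s θ = cellComp s θ') : θ = θ' := by
  have key (θ : Cell P r) : θ = cellComp u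
      (rightReduce (cellComp s θ) (cellComp e (idCell (right θ))) (by simp [h])) := by
    rw [← rightReduce_cellComp _ _ h, ← cellComp_assoc, H, id_cellComp]
  rw [key θ, key θ', rightReduce_congr _ hs (congrArg (cellComp e) (congrArg idCell hr))]

lemma leftUnitorInv_proComp {x y z : D} (m : Pro x y) (n : Pro y z) :
    leftUnitorInv (proComp m n) =
      cellComp (hcomp (leftUnitorInv m) (cellId n) (by simp)) (assocHom (proId x) m n) := by
  have h := leftUnitor_comp_inv (show Loose.mk x ⟶ Loose.mk y from m)
      (show Loose.mk y ⟶ Loose.mk z from n)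
  exact congrArg Globular.cell h

lemma rightUnitorInv_proComp {x y z : D} (m : Pro x y) (n : Pro y z) :
    rightUnitorInv (proComp m n) =
      cellComp (hcomp (cellId m) (rightUnitorInv n) (by simp)) (assocInv m n (proId z)) := by
  have h := rightUnitor_comp_inv (show Loose.mk x ⟶ Loose.mk y from m)
      (show Loose.mk y ⟶ Loose.mk z from n)
  exact congrArg Globular.cell h

/-- A cell `j : m ⟶ P` is opcartesian if every cell out of `m` whose boundary arrows factor through
those of `j` factors uniquely through `j`. -/
def IsOpcartesian {x y x' y' : D} {m : Pro x y} {P : Pro x' y'} (j : Cell m P) : Prop :=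
  ∀ {z w : D} (k : Pro z w) (a : x' ⟶ z) (b : y' ⟶ w) (φ : Cell m k),
    left φ = left j ≫ a → right φ = right j ≫ b →
      ∃! ψ : Cell P k, left ψ = a ∧ right ψ = b ∧ cellComp j ψ = φ

/-! ### Companions: cancellation, composition and reshaping -/

namespace CompanionData

section

variable {x y : D} {f : x ⟶ y} {p : Pro x y} (c : CompanionData f p)

attribute [simp] left_unit right_unit left_counit right_counit unit_counit

lemma leftUnitorInv_rightReduce :
    cellComp (leftUnitorInv p) (rightReduce c.unit c.counit (by simp)) = cellId p :=
  c.unit_hcomp_counit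

/-- The second companion equation whiskered by `n`; reassociating moves the counit next to the unit.
-/
lemma hcomp_unit_leftReduce {z : D} (n : Pro y z) :
    cellComp (leftUnitorInv (proComp p n))
      (hcomp c.unit (leftReduce c.counit (cellId n) (by simp)) (by simp)) =
      cellId (proComp p n) := by
  have h := Carries.associator_hcomp_leftReduce (X := Loose.mk x) (Y := Loose.mk x)
    (Z := Loose.mk y) (W := Loose.mk z) c.unit c.counit (cellId n) (by simp) (by simp)
  change cellComp (assocHom _ _ _) _ = _ at h
  rw [leftUnitorInv_proComp, cellComp_assoc, h, ← hcomp_cellComp,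
    hcomp_congr _ c.leftUnitorInv_rightReduce (id_cellComp _), hcomp_id]

/-- The projection `p ⊙ n ⟶ n` is left cancellable. -/
lemma cancel_leftReduce {z x' y' : D} {n : Pro y z} {r : Pro x' y'}
    {θ θ' : Cell r (proComp p n)} (hl : left θ = left θ')
    (h : cellComp θ (leftReduce c.counit (cellId n) (by simp)) =
      cellComp θ' (leftReduce c.counit (cellId n) (by simp))) : θ = θ' :=
  eq_of_cellComp_eq_of_left_section (e := c.unit) (by simp) (cellId _)
    (by rw [cellComp_id, hcomp_unit_leftReduce]) hl h

lemma cancel_counit {x' y' : D} {r : Pro x' y'} {θ θ' : Cell r p} (hl : left θ = left θ')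
    (h : cellComp θ c.counit = cellComp θ' c.counit) : θ = θ' :=
  eq_of_cellComp_eq_of_left_section _ (rightUnitorHom p) c.unit_hcomp_counit hl h

/-- The second companion equation whiskered by `m` on the left. It exhibits the identity of `m ⊙ p`
as a reduction of the insertion of the unit, as required by the retraction form of cancellation. -/
lemma rightReduce_counit {z : D} (m : Pro z x) :
    rightReduce (cellComp (rightUnitorInv m) (hcomp (cellId m) c.unit (by simp))) c.counit
      (by simp) = cellId (proComp m p) := by
  have h := (Carries.associator_hcomp_rightReduce (X := Loose.mk z) (Y := Loose.mk x)
    (Z := Loose.mk x) (W := Loose.mk y) (cellId m) c.unit c.counit (by simp) (by simp)).symm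
  change cellComp (assocInv _ _ _) _ = _ at h
  have h2 : hcomp (rightUnitorInv m) (cellId p) (by simp) =
      cellComp (hcomp (cellId m) (leftUnitorInv p) (by simp)) (assocInv m (proId x) p) :=
    congrArg Globular.cell (triangle_assoc_comp_left_inv (show Loose.mk z ⟶ Loose.mk x from m)
      (show Loose.mk x ⟶ Loose.mk y from p)).symm
  calc _ = cellComp (hcomp (rightUnitorInv m) (cellId p) (by simp))
        (rightReduce (hcomp (cellId m) c.unit (by simp)) c.counit (by simp)) := by
        rw [hcomp_rightReduce, rightReduce_congr _ rfl (id_cellComp _)]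
    _ = _ := by
        rw [h2, cellComp_assoc, h, ← hcomp_cellComp,
          hcomp_congr _ (cellComp_id _) c.leftUnitorInv_rightReduce, hcomp_id]

lemma ext_of_unit {z x' y' : D} {m : Pro z x} {r : Pro x' y'} {θ θ' : Cell (proComp m p) r}
    (hr : right θ = right θ')
    (h : cellComp (cellComp (rightUnitorInv m) (hcomp (cellId m) c.unit (by simp))) θ =
      cellComp (cellComp (rightUnitorInv m) (hcomp (cellId m) c.unit (by simp))) θ') : θ = θ' :=
  eq_of_cellComp_eq_of_right_retraction (e := c.counit) (by simp) (cellId _)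
    (by rw [id_cellComp, rightReduce_counit]) hr h

end

/-- Companions, from cancellability of the counit in place of the second equation. -/
def ofCancel {x y : D} {f : x ⟶ y} {p : Pro x y} (unit : Cell (proId x) p)
    (counit : Cell p (proId y)) (left_unit : left unit = 𝟙 x) (right_unit : right unit = f)
    (left_counit : left counit = f) (right_counit : right counit = 𝟙 y)
    (unit_counit : cellComp unit counit = idCell f)
    (cancel : ∀ θ : Cell p p, left θ = 𝟙 x → right θ = 𝟙 y → cellComp θ counit = counit →
      θ = cellId p) : CompanionData f p where
  unit := unit
  counit := counit
  left_unit := left_unit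
  right_unit := right_unit
  left_counit := left_counit
  right_counit := right_counit
  unit_counit := unit_counit
  unit_hcomp_counit := by
    have h : right unit = left counit := right_unit.trans left_counit.symm
    -- After composition with the counit, the first equation turns the `unit` factor into `idCell
    -- f`, and unitor naturality leaves just the counit.
    refine cancel _ (by simp [left_unit]) (by simp [right_counit]) ?_
    change cellComp (cellComp _ (rightReduce unit counit h)) _ = _
    rw [cellComp_assoc, rightReduce_cellComp,
      ← leftReduce_eq_rightReduce (cellComp unit counit) _ (by simp [h]),
      leftReduce_congr _ (unit_counit.trans (congrArg idCell left_counit.symm))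
        ((congrArg (fun g => cellComp counit (idCell g)) right_counit).trans
          ((congrArg _ (idCell_id y)).trans (cellComp_id _))),
      leftReduce_idCell, ← cellComp_assoc, leftUnitor_inv_hom, id_cellComp]

/-- Companions compose. -/
def comp {x y z : D} {f : x ⟶ y} {g : y ⟶ z} {p : Pro x y} {q : Pro y z}
    (c : CompanionData f p) (d : CompanionData g q) : CompanionData (f ≫ g) (proComp p q) :=
  ofCancel
    (cellComp (leftUnitorInv (proId x))
      (hcomp c.unit (cellComp (idCell f) d.unit) (by simp)))
    (leftReduce (cellComp c.counit (idCell g)) d.counit (by simp))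
    (by simp) (by simp) (by simp) (by simp)
    (by
      rw [cellComp_assoc, hcomp_leftReduce, leftReduce_congr (b' := idCell (f ≫ g)) (n := proId z)
        (a' := idCell (left (idCell (f ≫ g)))) _ ?_ ?_, leftReduce_idCell, ← cellComp_assoc,
        leftUnitor_inv_hom, id_cellComp]
      · rw [← cellComp_assoc, c.unit_counit, ← idCell_comp, left_idCell]
      · rw [cellComp_assoc, d.unit_counit, ← idCell_comp])
    (by
      intro θ hl hr h
      -- The composite counit cancels in two stages, since it is the projection `p ⊙ q ⟶ q` followed
      -- by the counit of `q`.
      refine c.cancel_leftReduce (by simp [hl]) (d.cancel_counit (by simp [hl]) ?_)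
      rw [cellComp_assoc, cellComp_assoc, leftReduce_cellComp, leftReduce_congr _ (congrArg _
        (congrArg idCell d.left_counit)) (id_cellComp _), h, id_cellComp])

/-- A companion of an identity arrow is isomorphic to the identity proarrow. -/
def isoId {X : Loose D} {p : X ⟶ X} {f : X.obj ⟶ X.obj} (c : CompanionData f p)
    (hf : f = 𝟙 X.obj) : p ≅ 𝟙 X where
  hom := Globular.mk c.counit (by simp [hf]) (by simp)
  inv := Globular.mk c.unit (by simp) (by simp [hf])
  hom_inv_id := by
    subst hf
    apply Globular.ext
    change cellComp c.counit c.unit = cellId p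
    refine c.cancel_counit (by simp) ?_
    rw [cellComp_assoc, c.unit_counit, idCell_id, id_cellComp, cellComp_id]
  inv_hom_id := Globular.ext (by
    subst hf
    exact c.unit_counit.trans (idCell_id _))

section

variable {x y x' y' : D} {f : x ⟶ x'} {g : y ⟶ y'} {p : Pro x x'} {q : Pro y y'}
  (c : CompanionData f p) (d : CompanionData g q) {m : Pro x y} {n : Pro x' y'} (α : Cell m n)
  (hl : left α = f) (hr : right α = g)

lemma left_companionSlide : left (companionSlide c d α hl hr) = 𝟙 x := by simp [companionSlide]

lemma right_companionSlide : right (companionSlide c d α hl hr) = 𝟙 y' := by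
  simp [companionSlide]

end

section Slide

variable {X Y X' Y' : Loose D} {f : X.obj ⟶ X'.obj} {g : Y.obj ⟶ Y'.obj} {p : X ⟶ X'}
  {q : Y ⟶ Y'} (c : CompanionData f p) (d : CompanionData g q) {m : X ⟶ Y} {n : X' ⟶ Y'}
  (α : Cell (D := D) m n) (hl : left α = f) (hr : right α = g)

/-- The reshaping of a cell by companions, as a 2-cell of the underlying bicategory. -/
def slide : m ≫ q ⟶ p ≫ n :=
  Globular.mk (companionSlide c d α hl hr) (left_companionSlide c d α hl hr)
    (right_companionSlide c d α hl hr)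

/-- The unit inside the reshaping meets the counit in the projection and collapses to `idCell f`. As
this projection is cancellable, the statement characterizes the reshaped cell, and all later
computations use it in place of the definition. -/
lemma carries_slide :
    Carries (c.slide d α hl hr) (rightReduce α d.counit (by simp [hr]))
      (leftReduce c.counit (cellId n) (by simp)) := by
  change cellComp (cellComp _ (rightReduce (hcomp c.unit α (by simp [hl])) d.counit _)) _ = _
  rw [cellComp_assoc, rightReduce_cellComp, hcomp_rightReduce]
  refine rightReduce_congr _ ?_ ?_
  · rw [hcomp_leftReduce, leftReduce_congr _ (c.unit_counit.trans (congrArg idCell hl.symm))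
      (cellComp_id _), leftReduce_idCell, ← cellComp_assoc]
    exact (congrArg (cellComp · α) (leftUnitor_inv_hom _)).trans (id_cellComp _)
  · simp

/-- The dual computation: inserting the unit of `q` cancels the counit used in the reshaping,
leaving `α` pasted with the unit of `p`. -/
lemma unit_slide :
    cellComp (cellComp (rightUnitorInv m) (hcomp (cellId m) d.unit (by simp)))
      (c.slide d α hl hr).cell =
      cellComp (leftUnitorInv m) (hcomp c.unit α (by simp [hl])) := by
  change cellComp _ (cellComp _ (rightReduce (hcomp c.unit α (by simp [hl])) d.counit _)) = _
  rw [cellComp_assoc, hcomp_rightReduce, hcomp_rightReduce,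
    rightReduce_congr (a' := cellComp (leftUnitorInv m) (hcomp c.unit α (by simp [hl]))) _
      (id_cellComp _) (b' := idCell (right (cellComp (leftUnitorInv m)
        (hcomp c.unit α (by simp [hl]))))) ?_, rightReduce_idCell, ← cellComp_assoc,
        rightUnitor_inv_hom, id_cellComp]
  simp [hr]

/-- By `unit_slide`, reshaping sends the inserted unit of `q` to the cell assumed opcartesian.
Factoring that inserted unit through the opcartesian cell gives the inverse; one composite is
identified by `ext_of_unit`, the other by uniqueness of opcartesian factorizations. -/
lemma isIso_slide
    (h : IsOpcartesian (cellComp (leftUnitorInv m) (hcomp c.unit α (by simp [hl])))) :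
    IsIso (c.slide d α hl hr) := by
  obtain ⟨τ, ⟨h1, h2, h3⟩, -⟩ := h (proComp m q) (𝟙 _) (𝟙 _)
    (cellComp (rightUnitorInv m) (hcomp (cellId m) d.unit (by simp))) (by simp) (by simp [hr])
  refine ⟨⟨τ, h1, h2⟩, Globular.ext ?_, Globular.ext ?_⟩
  · change cellComp (c.slide d α hl hr).cell τ = cellId (proComp m q)
    refine d.ext_of_unit (by simp [h2]) ?_
    rw [← cellComp_assoc, unit_slide, h3, cellComp_id]
  · change cellComp τ (c.slide d α hl hr).cell = cellId (proComp p n)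
    refine (h (proComp p n) (𝟙 _) (𝟙 _) (cellComp (leftUnitorInv m)
      (hcomp c.unit α (by simp [hl]))) (by simp) (by simp)).unique ⟨?_, ?_, ?_⟩ ⟨?_, ?_, ?_⟩
    · simp [h1]
    · simp [h2]
    · rw [← cellComp_assoc, h3, unit_slide]
    · simp
    · simp
    · simp

end Slide

end CompanionData

end DoubleCategory

namespace DoubleCategory

variable {D : Type u} [DoubleCategory.{t, w, v} D]

open DoubleCategory.StrongFiniteCoproducts (hcomp_congr)

/-! ### Conjoints: the mirror image, with left and right exchanged -/

namespace ConjointData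

section

variable {x y : D} {f : x ⟶ y} {p : Pro y x} (c : ConjointData f p)

attribute [simp] left_unit right_unit left_counit right_counit unit_counit

lemma rightUnitorInv_leftReduce :
    cellComp (rightUnitorInv p) (leftReduce c.counit c.unit (by simp)) = cellId p :=
  c.counit_hcomp_unit

lemma hcomp_rightReduce_unit {z : D} (n : Pro z y) :
    cellComp (rightUnitorInv (proComp n p))
      (hcomp (rightReduce (cellId n) c.counit (by simp)) c.unit (by simp)) =
      cellId (proComp n p) := by
  have h := (Carries.associator_hcomp_leftReduce (X := Loose.mk z) (Y := Loose.mk y)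
    (Z := Loose.mk x) (W := Loose.mk x) (cellId n) c.counit c.unit (by simp) (by simp)).symm
  change cellComp (assocInv _ _ _) _ = _ at h
  rw [rightUnitorInv_proComp, cellComp_assoc, h, ← hcomp_cellComp,
    hcomp_congr _ (id_cellComp _) c.rightUnitorInv_leftReduce, hcomp_id]

/-- The projection `n ⊙ p ⟶ n` is left cancellable. -/
lemma cancel_rightReduce {z x' y' : D} {n : Pro z y} {r : Pro x' y'}
    {θ θ' : Cell r (proComp n p)} (hr : right θ = right θ')
    (h : cellComp θ (rightReduce (cellId n) c.counit (by simp)) =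
      cellComp θ' (rightReduce (cellId n) c.counit (by simp))) : θ = θ' :=
  eq_of_cellComp_eq_of_right_section (e := c.unit) (by simp) (cellId _)
    (by rw [cellComp_id, hcomp_rightReduce_unit]) hr h

lemma cancel_counit {x' y' : D} {r : Pro x' y'} {θ θ' : Cell r p} (hr : right θ = right θ')
    (h : cellComp θ c.counit = cellComp θ' c.counit) : θ = θ' :=
  eq_of_cellComp_eq_of_right_section _ (leftUnitorHom p) c.counit_hcomp_unit hr h

lemma leftReduce_counit {z : D} (m : Pro x z) :
    leftReduce c.counit (cellComp (leftUnitorInv m) (hcomp c.unit (cellId m) (by simp)))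
      (by simp) = cellId (proComp p m) := by
  have h := Carries.associator_leftReduce_hcomp (X := Loose.mk y) (Y := Loose.mk x)
    (Z := Loose.mk x) (W := Loose.mk z) c.counit c.unit (cellId m) (by simp) (by simp)
  change cellComp (assocHom _ _ _) _ = _ at h
  have h2 : hcomp (cellId p) (leftUnitorInv m) (by simp) =
      cellComp (hcomp (rightUnitorInv p) (cellId m) (by simp)) (assocHom p (proId x) m) :=
    congrArg Globular.cell (triangle_assoc_comp_right_inv (show Loose.mk y ⟶ Loose.mk x from p)
      (show Loose.mk x ⟶ Loose.mk z from m)).symm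
  calc _ = cellComp (hcomp (cellId p) (leftUnitorInv m) (by simp))
        (leftReduce c.counit (hcomp c.unit (cellId m) (by simp)) (by simp)) := by
        rw [hcomp_leftReduce, leftReduce_congr _ (id_cellComp _) rfl]
    _ = _ := by
        rw [h2, cellComp_assoc, h, ← hcomp_cellComp,
          hcomp_congr _ c.rightUnitorInv_leftReduce (cellComp_id _), hcomp_id]

lemma ext_of_unit {z x' y' : D} {m : Pro x z} {r : Pro x' y'} {θ θ' : Cell (proComp p m) r}
    (hl : left θ = left θ')
    (h : cellComp (cellComp (leftUnitorInv m) (hcomp c.unit (cellId m) (by simp))) θ =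
      cellComp (cellComp (leftUnitorInv m) (hcomp c.unit (cellId m) (by simp))) θ') : θ = θ' :=
  eq_of_cellComp_eq_of_left_retraction (e := c.counit) (by simp) (cellId _)
    (by rw [id_cellComp, leftReduce_counit]) hl h

end

/-- Conjoints, from cancellability of the counit in place of the second equation. -/
def ofCancel {x y : D} {f : x ⟶ y} {p : Pro y x} (unit : Cell (proId x) p)
    (counit : Cell p (proId y)) (left_unit : left unit = f) (right_unit : right unit = 𝟙 x)
    (left_counit : left counit = 𝟙 y) (right_counit : right counit = f)
    (unit_counit : cellComp unit counit = idCell f)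
    (cancel : ∀ θ : Cell p p, left θ = 𝟙 y → right θ = 𝟙 x → cellComp θ counit = counit →
      θ = cellId p) : ConjointData f p where
  unit := unit
  counit := counit
  left_unit := left_unit
  right_unit := right_unit
  left_counit := left_counit
  right_counit := right_counit
  unit_counit := unit_counit
  counit_hcomp_unit := by
    have h : right counit = left unit := right_counit.trans left_unit.symm
    refine cancel _ (by simp [left_counit]) (by simp [right_unit]) ?_
    change cellComp (cellComp _ (leftReduce counit unit h)) _ = _
    rw [cellComp_assoc, leftReduce_cellComp,
      leftReduce_eq_rightReduce _ (cellComp unit counit) (by simp [h]),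
      rightReduce_congr _ ((congrArg (fun g => cellComp counit (idCell g)) left_counit).trans
          ((congrArg _ (idCell_id y)).trans (cellComp_id _)))
        (unit_counit.trans (congrArg idCell right_counit.symm)),
      rightReduce_idCell, ← cellComp_assoc, rightUnitor_inv_hom, id_cellComp]

/-- Conjoints compose. -/
def comp {x y z : D} {f : x ⟶ y} {g : y ⟶ z} {p : Pro y x} {q : Pro z y}
    (c : ConjointData f p) (d : ConjointData g q) : ConjointData (f ≫ g) (proComp q p) :=
  ofCancel
    (cellComp (rightUnitorInv (proId x))
      (hcomp (cellComp (idCell f) d.unit) c.unit (by simp)))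
    (rightReduce d.counit (cellComp c.counit (idCell g)) (by simp))
    (by simp) (by simp) (by simp) (by simp)
    (by
      rw [cellComp_assoc, hcomp_rightReduce, rightReduce_congr (a' := idCell (f ≫ g))
        (n := proId z) (b' := idCell (right (idCell (f ≫ g)))) _ ?_ ?_, rightReduce_idCell,
        ← cellComp_assoc, rightUnitor_inv_hom, id_cellComp]
      · rw [cellComp_assoc, d.unit_counit, ← idCell_comp]
      · rw [← cellComp_assoc, c.unit_counit, ← idCell_comp, right_idCell])
    (by
      intro θ hl hr h
      refine c.cancel_rightReduce (by simp [hr]) (d.cancel_counit (by simp [hr]) ?_)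
      rw [cellComp_assoc, cellComp_assoc, rightReduce_cellComp, rightReduce_congr _ (id_cellComp _)
        (congrArg _ (congrArg idCell d.right_counit)), h, id_cellComp])

/-- A conjoint of an identity arrow is isomorphic to the identity proarrow. -/
def isoId {X : Loose D} {p : X ⟶ X} {f : X.obj ⟶ X.obj} (c : ConjointData f p)
    (hf : f = 𝟙 X.obj) : p ≅ 𝟙 X where
  hom := Globular.mk c.counit (by simp) (by simp [hf])
  inv := Globular.mk c.unit (by simp [hf]) (by simp)
  hom_inv_id := by
    subst hf
    apply Globular.ext
    change cellComp c.counit c.unit = cellId p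
    refine c.cancel_counit (by simp) ?_
    rw [cellComp_assoc, c.unit_counit, idCell_id, id_cellComp, cellComp_id]
  inv_hom_id := Globular.ext (by
    subst hf
    exact c.unit_counit.trans (idCell_id _))

section

variable {x y x' y' : D} {f : x ⟶ x'} {g : y ⟶ y'} {p : Pro x' x} {q : Pro y' y}
  (c : ConjointData f p) (d : ConjointData g q) {m : Pro x y} {n : Pro x' y'} (α : Cell m n)
  (hl : left α = f) (hr : right α = g)

lemma left_conjointSlide : left (conjointSlide c d α hl hr) = 𝟙 x' := by simp [conjointSlide]

lemma right_conjointSlide : right (conjointSlide c d α hl hr) = 𝟙 y := by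
  simp [conjointSlide]

end

section Slide

variable {X Y X' Y' : Loose D} {f : X.obj ⟶ X'.obj} {g : Y.obj ⟶ Y'.obj} {p : X' ⟶ X}
  {q : Y' ⟶ Y} (c : ConjointData f p) (d : ConjointData g q) {m : X ⟶ Y} {n : X' ⟶ Y'}
  (α : Cell (D := D) m n) (hl : left α = f) (hr : right α = g)

/-- The reshaping of a cell by conjoints, as a 2-cell of the underlying bicategory. -/
def slide : p ≫ m ⟶ n ≫ q :=
  Globular.mk (conjointSlide c d α hl hr) (left_conjointSlide c d α hl hr)
    (right_conjointSlide c d α hl hr)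

/-- For conjoints the cancellable projection is `n ⊙ q ⟶ n`, and the unit and counit of `q` are the
pair that collapses. -/
lemma carries_slide :
    Carries (c.slide d α hl hr) (leftReduce c.counit α (by simp [hl]))
      (rightReduce (cellId n) d.counit (by simp)) := by
  change cellComp (cellComp _ (leftReduce c.counit (hcomp α d.unit (by simp [hr])) _)) _ = _
  rw [cellComp_assoc, leftReduce_cellComp, hcomp_leftReduce]
  refine leftReduce_congr _ ?_ ?_
  · simp
  · rw [hcomp_rightReduce, rightReduce_congr _ (cellComp_id _)
      (d.unit_counit.trans (congrArg idCell hr.symm)), rightReduce_idCell, ← cellComp_assoc]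
    exact (congrArg (cellComp · α) (rightUnitor_inv_hom _)).trans (id_cellComp _)

lemma unit_slide :
    cellComp (cellComp (leftUnitorInv m) (hcomp c.unit (cellId m) (by simp)))
      (c.slide d α hl hr).cell =
      cellComp (rightUnitorInv m) (hcomp α d.unit (by simp [hr])) := by
  change cellComp _ (cellComp _ (leftReduce c.counit (hcomp α d.unit (by simp [hr])) _)) = _
  rw [cellComp_assoc, hcomp_leftReduce, hcomp_leftReduce,
    leftReduce_congr (b' := cellComp (rightUnitorInv m) (hcomp α d.unit (by simp [hr]))) _
      (a' := idCell (left (cellComp (rightUnitorInv m)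
        (hcomp α d.unit (by simp [hr]))))) ?_ (id_cellComp _), leftReduce_idCell, ← cellComp_assoc,
        leftUnitor_inv_hom, id_cellComp]
  simp [hl]

lemma isIso_slide
    (h : IsOpcartesian (cellComp (rightUnitorInv m) (hcomp α d.unit (by simp [hr])))) :
    IsIso (c.slide d α hl hr) := by
  obtain ⟨τ, ⟨h1, h2, h3⟩, -⟩ := h (proComp p m) (𝟙 _) (𝟙 _)
    (cellComp (leftUnitorInv m) (hcomp c.unit (cellId m) (by simp))) (by simp [hl]) (by simp)
  refine ⟨⟨τ, h1, h2⟩, Globular.ext ?_, Globular.ext ?_⟩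
  · change cellComp (c.slide d α hl hr).cell τ = cellId (proComp p m)
    refine c.ext_of_unit (by simp [h1]) ?_
    rw [← cellComp_assoc, unit_slide, h3, cellComp_id]
  · change cellComp τ (c.slide d α hl hr).cell = cellId (proComp n q)
    refine (h (proComp n q) (𝟙 _) (𝟙 _) (cellComp (rightUnitorInv m)
      (hcomp α d.unit (by simp [hr]))) (by simp) (by simp)).unique ⟨?_, ?_, ?_⟩ ⟨?_, ?_, ?_⟩
    · simp [h1]
    · simp [h2]
    · rw [← cellComp_assoc, h3, unit_slide]
    · simp
    · simp
    · simp

end Slide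

end ConjointData

end DoubleCategory

namespace DoubleCategory

variable {D : Type u} [DoubleCategory.{t, w, v} D]

open DoubleCategory.StrongFiniteCoproducts (hcomp_congr)

/-! ### Opcartesian cells -/

namespace IsOpcartesian

/-- Opcartesianness is unaffected by a globular isomorphism on the source, which is used to remove
the unitors in front of the pasted cells. -/
lemma iso_comp {x y x' y' : D} {m m' : Pro x y} {P : Pro x' y'} {j : Cell m P}
    (h : IsOpcartesian j) (u : Cell m' m) (v : Cell m m') (huv : cellComp u v = cellId m')
    (hvu : cellComp v u = cellId m) (hul : left u = 𝟙 x) (hur : right u = 𝟙 y)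
    (hvl : left v = 𝟙 x) (hvr : right v = 𝟙 y) : IsOpcartesian (cellComp u j) := by
  intro z w k a b φ hl hr
  obtain ⟨ψ, ⟨h1, h2, h3⟩, h4⟩ := h k a b (cellComp v φ) (by simp [hl, hvl, hul])
    (by simp [hr, hvr, hur])
  refine ⟨ψ, ⟨h1, h2, ?_⟩, fun ψ' ⟨k1, k2, k3⟩ => h4 ψ' ⟨k1, k2, ?_⟩⟩
  · rw [cellComp_assoc, h3, ← cellComp_assoc, huv, id_cellComp]
  · rw [← k3, cellComp_assoc, ← cellComp_assoc, hvu, id_cellComp]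

lemma leftUnitorInv_comp {x y x' y' : D} {m : Pro x y} {P : Pro x' y'}
    {j : Cell (proComp (proId x) m) P} (h : IsOpcartesian j) :
    IsOpcartesian (cellComp (leftUnitorInv m) j) :=
  h.iso_comp _ (leftUnitorHom m) (by simp) (by simp) (by simp) (by simp) (by simp) (by simp)

lemma rightUnitorInv_comp {x y x' y' : D} {m : Pro x y} {P : Pro x' y'}
    {j : Cell (proComp m (proId y)) P} (h : IsOpcartesian j) :
    IsOpcartesian (cellComp (rightUnitorInv m) j) :=
  h.iso_comp _ (rightUnitorHom m) (by simp) (by simp) (by simp) (by simp) (by simp) (by simp)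

lemma ext {x y x' y' : D} {m : Pro x y} {P : Pro x' y'} {j : Cell m P} (h : IsOpcartesian j)
    {z w : D} {k : Pro z w} {ψ ψ' : Cell P k} (hl : left ψ = left ψ') (hr : right ψ = right ψ')
    (hj : cellComp j ψ = cellComp j ψ') : ψ = ψ' :=
  (h k _ _ (cellComp j ψ') (by simp) (by simp)).unique ⟨hl, hr, hj⟩ ⟨rfl, rfl, rfl⟩

/-- An opcartesian cell out of an identity proarrow with trivial left boundary exhibits a
companion of its right boundary. -/
lemma exists_companionData {x y : D} {f : x ⟶ y} {p : Pro x y} {j : Cell (proId x) p}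
    (h : IsOpcartesian j) (hl : left j = 𝟙 x) (hr : right j = f) :
    ∃ c : CompanionData f p, c.unit = j := by
  -- The counit is the factorization of `idCell f` through `j`, so the first companion equation
  -- holds by construction; the second is an equality of cells out of `p` and is tested after `j`.
  obtain ⟨e, ⟨h1, h2, h3⟩, -⟩ := h (proId y) f (𝟙 y) (idCell f) (by simp [hl]) (by simp [hr])
  have hje : right j = left e := hr.trans h1.symm
  refine ⟨⟨j, e, hl, hr, h1, h2, h3, h.ext (by simp [hl]) (by simp [h2]) ?_⟩, rfl⟩
  change cellComp j (cellComp _ (rightReduce j e hje)) = _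
  rw [← cellComp_assoc, ← leftUnitorInv_naturality, cellComp_assoc, hcomp_rightReduce,
    rightReduce_congr (a' := j) (b' := idCell (right j)) _ ?_ ?_, rightReduce_idCell,
    ← cellComp_assoc, leftUnitorInv_proId, rightUnitor_inv_hom, id_cellComp, cellComp_id]
  · rw [hl, idCell_id, id_cellComp]
  · rw [h3, hr]

/-- An opcartesian cell out of an identity proarrow with trivial right boundary exhibits a
conjoint of its left boundary. -/
lemma exists_conjointData {x y : D} {f : x ⟶ y} {p : Pro y x} {j : Cell (proId x) p}
    (h : IsOpcartesian j) (hl : left j = f) (hr : right j = 𝟙 x) :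
    ∃ c : ConjointData f p, c.unit = j := by
  obtain ⟨e, ⟨h1, h2, h3⟩, -⟩ := h (proId y) (𝟙 y) f (idCell f) (by simp [hl]) (by simp [hr])
  have hje : right e = left j := h2.trans hl.symm
  refine ⟨⟨j, e, hl, hr, h1, h2, h3, h.ext (by simp [h1]) (by simp [hr]) ?_⟩, rfl⟩
  change cellComp j (cellComp _ (leftReduce e j hje)) = _
  rw [← cellComp_assoc, ← rightUnitorInv_naturality, cellComp_assoc, hcomp_leftReduce,
    leftReduce_congr (b' := j) (a' := idCell (left j)) _ ?_ ?_, leftReduce_idCell,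
    ← cellComp_assoc, ← leftUnitorInv_proId, leftUnitor_inv_hom, id_cellComp, cellComp_id]
  · rw [h3, hl]
  · rw [hr, idCell_id, id_cellComp]

end IsOpcartesian

/-! ### Coproducts indexed by spans -/

namespace IsSpanCoproduct

variable {I J : Type} {x : I → D} {y : J → D} {A : I → J → Type}
  {m : ∀ i j, A i j → Pro (x i) (y j)} {X Y : D} {s : ∀ i, x i ⟶ X} {r : ∀ j, y j ⟶ Y}

lemma ext {P : Pro X Y} {κ : ∀ i j (a : A i j), Cell (m i j a) P} (h : IsSpanCoproduct m s r P κ)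
    {z w : D} {n : Pro z w} {ψ ψ' : Cell P n} (hl : left ψ = left ψ') (hr : right ψ = right ψ')
    (hκ : ∀ i j a, cellComp (κ i j a) ψ = cellComp (κ i j a) ψ') : ψ = ψ' :=
  (h.existsUnique n (left ψ') (right ψ') (fun i j a => cellComp (κ i j a) ψ')
    (by simp [h.left_eq]) (by simp [h.right_eq])).unique ⟨hl, hr, hκ⟩ ⟨rfl, rfl, fun _ _ _ => rfl⟩

/-- Uniqueness of coproducts. Only the composite identity on `P` is recorded, being the one needed
to transport universal properties from chosen coproducts to arbitrary ones. -/
lemma exists_iso {P P' : Pro X Y} {κ : ∀ i j (a : A i j), Cell (m i j a) P}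
    {κ' : ∀ i j (a : A i j), Cell (m i j a) P'} (h : IsSpanCoproduct m s r P κ)
    (h' : IsSpanCoproduct m s r P' κ') :
    ∃ (e : Cell P P') (e' : Cell P' P), left e = 𝟙 X ∧ right e = 𝟙 Y ∧ left e' = 𝟙 X ∧
      right e' = 𝟙 Y ∧ cellComp e e' = cellId P ∧ (∀ i j a, cellComp (κ i j a) e = κ' i j a) ∧
      ∀ i j a, cellComp (κ' i j a) e' = κ i j a := by
  obtain ⟨e, ⟨h1, h2, h3⟩, -⟩ := h.existsUnique P' (𝟙 _) (𝟙 _) κ' (by simp [h'.left_eq])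
    (by simp [h'.right_eq])
  obtain ⟨e', ⟨k1, k2, k3⟩, -⟩ := h'.existsUnique P (𝟙 _) (𝟙 _) κ (by simp [h.left_eq])
    (by simp [h.right_eq])
  refine ⟨e, e', h1, h2, k1, k2, h.ext (by simp [h1, k1]) (by simp [h2, k2]) fun i j a => ?_,
    h3, k3⟩
  rw [← cellComp_assoc, h3, k3, cellComp_id]

/-- A proarrow is the coproduct of the family consisting of itself. -/
lemma single {x y : D} (m : Pro x y) :
    IsSpanCoproduct (I := PUnit) (J := PUnit) (A := fun _ _ => PUnit) (fun _ _ _ => m)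
      (fun _ => 𝟙 x) (fun _ => 𝟙 y) m (fun _ _ _ => cellId m) where
  left_eq _ _ _ := left_cellId m
  right_eq _ _ _ := right_cellId m
  existsUnique n f g φ hl hr := by
    refine ⟨φ ⟨⟩ ⟨⟩ ⟨⟩, ⟨by simp [hl], by simp [hr], fun _ _ _ => by simp⟩, fun ψ ⟨_, _, h⟩ => ?_⟩
    rw [← h ⟨⟩ ⟨⟩ ⟨⟩, id_cellComp]

end IsSpanCoproduct

/-! ### Companions and conjoints of coprojections and codiagonals -/

namespace StrongFiniteCoproducts

variable (S : StrongFiniteCoproducts D)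

section

variable {I J K : Type} [Finite I] [Finite J] [Finite K] {x : I → D} {y : J → D} {z : K → D}
  {A : I → J → Type} {B : J → K → Type} [∀ i j, Finite (A i j)] [∀ j k, Finite (B j k)]
  {X Y Z : D} {s : ∀ i, x i ⟶ X} {r : ∀ j, y j ⟶ Y} {q : ∀ k, z k ⟶ Z}

/-- Normalization is an equality of cofans, not a definitional one. Abstracting over the cofans and
eliminating the equalities yields coproducts of proarrows whose ends are literally `X` and `Y`, in
particular a single object. -/
lemma exists_isSpanCoproduct (hx : S.cofan x = Cofan.mk X s) (hy : S.cofan y = Cofan.mk Y r)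
    (m : ∀ i j, A i j → Pro (x i) (y j)) :
    ∃ (P : Pro X Y) (κ : ∀ i j (a : A i j), Cell (m i j a) P), IsSpanCoproduct m s r P κ := by
  suffices h : ∀ (cx : Cofan x) (cy : Cofan y), S.cofan x = cx → S.cofan y = cy →
      ∃ (P : Pro cx.pt cy.pt) (κ : ∀ i j (a : A i j), Cell (m i j a) P),
        IsSpanCoproduct m cx.inj cy.inj P κ from h _ _ hx hy
  rintro _ _ rfl rfl
  exact ⟨_, _, S.isSpanCoproduct m⟩

/-- The axiom on external composition speaks of chosen coproducts; it extends to arbitrary ones `P`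
and `Q` by conjugating with the external composite of their comparison isomorphisms. -/
lemma isSpanCoproduct_hcomp (hx : S.cofan x = Cofan.mk X s) (hy : S.cofan y = Cofan.mk Y r)
    (hz : S.cofan z = Cofan.mk Z q) {m : ∀ i j, A i j → Pro (x i) (y j)}
    {n : ∀ j k, B j k → Pro (y j) (z k)} {P : Pro X Y} {Q : Pro Y Z}
    {κ : ∀ i j (a : A i j), Cell (m i j a) P} {ν : ∀ j k (b : B j k), Cell (n j k b) Q}
    (hP : IsSpanCoproduct m s r P κ) (hQ : IsSpanCoproduct n r q Q ν) :
    IsSpanCoproduct (compFamily m n) s q (proComp P Q)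
      (fun i k a => hcomp (κ i a.1 a.2.1) (ν a.1 k a.2.2)
        ((hP.right_eq _ _ _).trans (hQ.left_eq _ _ _).symm)) := by
  suffices h : ∀ (cx : Cofan x) (cy : Cofan y) (cz : Cofan z), S.cofan x = cx → S.cofan y = cy →
      S.cofan z = cz → ∀ {P : Pro cx.pt cy.pt} {Q : Pro cy.pt cz.pt}
      {κ : ∀ i j (a : A i j), Cell (m i j a) P} {ν : ∀ j k (b : B j k), Cell (n j k b) Q}
      (hP : IsSpanCoproduct m cx.inj cy.inj P κ) (hQ : IsSpanCoproduct n cy.inj cz.inj Q ν),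
      IsSpanCoproduct (compFamily m n) cx.inj cz.inj (proComp P Q)
        (fun i k a => hcomp (κ i a.1 a.2.1) (ν a.1 k a.2.2)
        ((hP.right_eq _ _ _).trans (hQ.left_eq _ _ _).symm)) from h _ _ _ hx hy hz hP hQ
  rintro _ _ _ rfl rfl rfl P Q κ ν hP hQ
  obtain ⟨e, e', hel, her, hel', her', hee, he, he'⟩ := hP.exists_iso (S.isSpanCoproduct m)
  obtain ⟨d, d', hdl, hdr, hdl', hdr', hdd, hd, hd'⟩ := hQ.exists_iso (S.isSpanCoproduct n)
  refine ⟨fun i k a => (left_hcomp _ _ _).trans (hP.left_eq _ _ _),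
    fun i k a => (right_hcomp _ _ _).trans (hQ.right_eq _ _ _), fun p f g φ hl hr => ?_⟩
  obtain ⟨ψ, ⟨h1, h2, h3⟩, h4⟩ := (S.isSpanCoproduct_comp m n).existsUnique p f g φ hl hr
  refine ⟨cellComp (hcomp e d (her.trans hdl.symm)) ψ, ⟨by simp [hel, h1], by simp [hdr, h2],
    fun i k a => ?_⟩, fun ψ' ⟨k1, k2, k3⟩ => ?_⟩
  · rw [← h3]
    exact (cellComp_assoc _ _ _).symm.trans (congrArg (cellComp · ψ)
      ((hcomp_cellComp _ _ _ _ _ _).symm.trans (hcomp_congr _ (he _ _ _) (hd _ _ _))))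
  · rw [← h4 (cellComp (hcomp e' d' (her'.trans hdl'.symm)) ψ') ⟨by simp [hel', k1],
      by simp [hdr', k2], fun i k a => ?_⟩, ← cellComp_assoc, ← hcomp_cellComp,
      hcomp_congr _ hee hdd, hcomp_id, id_cellComp]
    rw [← k3]
    exact (cellComp_assoc _ _ _).symm.trans (congrArg (cellComp · ψ')
      ((hcomp_cellComp _ _ _ _ _ _).symm.trans (hcomp_congr _ (he' _ _ _) (hd' _ _ _))))

end

lemma cofan_eq_mk {I : Type} [Finite I] (x : I → D) :
    S.cofan x = Cofan.mk (S.sum x) (S.inj x) := rfl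

variable {I : Type} [Finite I]

/-- Coprojections have companions, and reshaping the coprojections of proarrows by them gives
invertible cells. -/
lemma exists_companionData_inj (x : I → D) (i : I) :
    ∃ (p : Pro (x i) (S.sum x)) (c : CompanionData (S.inj x i) p),
      ∀ {y : I → D} (m : ∀ i, Pro (x i) (y i)),
        IsOpcartesian
          (cellComp (leftUnitorInv (m i)) (hcomp c.unit (S.inclPro m i) (by simp))) := by
  -- The span is `1 ← 1 → I` picking `i`: its fibre over `j` is a point when `j = i` and empty
  -- otherwise, so a family of cells out of it is one cell, and the single coprojection is
  -- opcartesian.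
  obtain ⟨P, κ, hP⟩ := S.exists_isSpanCoproduct (S.cofan_single (x i)) (S.cofan_eq_mk x)
    (A := fun _ j => PLift (i = j)) (fun _ j a => match j, a with | _, ⟨rfl⟩ => proId (x i))
  have hκ : IsOpcartesian (κ ⟨⟩ i ⟨rfl⟩) := by
    intro z w k a b φ hl hr
    obtain ⟨ψ, ⟨h1, h2, h3⟩, h4⟩ := hP.existsUnique k a b
      (fun _ j e => match j, e with | _, ⟨rfl⟩ => φ)
      (by rintro ⟨⟩ _ ⟨rfl⟩; exact hl.trans (by rw [hP.left_eq]))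
      (by rintro ⟨⟩ _ ⟨rfl⟩; exact hr.trans (by rw [hP.right_eq]))
    refine ⟨ψ, ⟨h1, h2, h3 ⟨⟩ i ⟨rfl⟩⟩, fun ψ' ⟨k1, k2, k3⟩ => h4 ψ' ⟨k1, k2, ?_⟩⟩
    rintro ⟨⟩ _ ⟨rfl⟩
    exact k3
  obtain ⟨c, hc⟩ := hκ.exists_companionData (hP.left_eq _ _ _) (hP.right_eq _ _ _)
  refine ⟨P, c, fun {y} m => IsOpcartesian.leftUnitorInv_comp ?_⟩
  intro z w k a b φ hl hr
  have hl' : left φ = 𝟙 _ ≫ a := by simpa using hl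
  have hr' : right φ = S.inj y i ≫ b := by simpa using hr
  -- Composing the span picking `i` with the identity span of `I` gives the span picking `i` again,
  -- so `P ⊙ Σ m` is the coproduct of the single proarrow `proId (x i) ⊙ m i`.
  obtain ⟨ψ, ⟨h1, h2, h3⟩, h4⟩ := (S.isSpanCoproduct_hcomp (S.cofan_single (x i))
    (S.cofan_eq_mk x) (S.cofan_eq_mk y) hP (S.isSpanCoproduct_sumPro m)).existsUnique k a b
      (fun _ j e => match j, e with | _, ⟨_, ⟨rfl⟩, ⟨rfl⟩⟩ => φ)
      (by rintro ⟨⟩ _ ⟨_, ⟨rfl⟩, ⟨rfl⟩⟩; exact hl')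
      (by rintro ⟨⟩ _ ⟨_, ⟨rfl⟩, ⟨rfl⟩⟩; exact hr')
  refine ⟨ψ, ⟨h1, h2, ?_⟩, fun ψ' ⟨k1, k2, k3⟩ => h4 ψ' ⟨k1, k2, ?_⟩⟩
  · rw [hcomp_congr _ hc rfl]
    exact h3 ⟨⟩ i ⟨i, ⟨rfl⟩, ⟨rfl⟩⟩
  · rintro ⟨⟩ _ ⟨_, ⟨rfl⟩, ⟨rfl⟩⟩
    rw [hcomp_congr _ hc rfl] at k3
    exact k3

/-- The same argument over the opposite span `I ← 1 → 1`, whose coproduct runs from `S.sum x` to `x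
i`. -/
lemma exists_conjointData_inj (x : I → D) (i : I) :
    ∃ (p : Pro (S.sum x) (x i)) (c : ConjointData (S.inj x i) p),
      ∀ {y : I → D} (m : ∀ i, Pro (y i) (x i)),
        IsOpcartesian
          (cellComp (rightUnitorInv (m i)) (hcomp (S.inclPro m i) c.unit (by simp))) := by
  obtain ⟨P, κ, hP⟩ := S.exists_isSpanCoproduct (S.cofan_eq_mk x) (S.cofan_single (x i))
    (A := fun j _ => PLift (i = j)) (fun j _ a => match j, a with | _, ⟨rfl⟩ => proId (x i))
  have hκ : IsOpcartesian (κ i ⟨⟩ ⟨rfl⟩) := by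
    intro z w k a b φ hl hr
    obtain ⟨ψ, ⟨h1, h2, h3⟩, h4⟩ := hP.existsUnique k a b
      (fun j _ e => match j, e with | _, ⟨rfl⟩ => φ)
      (by rintro _ ⟨⟩ ⟨rfl⟩; exact hl.trans (by rw [hP.left_eq]))
      (by rintro _ ⟨⟩ ⟨rfl⟩; exact hr.trans (by rw [hP.right_eq]))
    refine ⟨ψ, ⟨h1, h2, h3 i ⟨⟩ ⟨rfl⟩⟩, fun ψ' ⟨k1, k2, k3⟩ => h4 ψ' ⟨k1, k2, ?_⟩⟩
    rintro _ ⟨⟩ ⟨rfl⟩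
    exact k3
  obtain ⟨c, hc⟩ := hκ.exists_conjointData (hP.left_eq _ _ _) (hP.right_eq _ _ _)
  refine ⟨P, c, fun {y} m => IsOpcartesian.rightUnitorInv_comp ?_⟩
  intro z w k a b φ hl hr
  have hl' : left φ = S.inj y i ≫ a := by simpa using hl
  have hr' : right φ = 𝟙 _ ≫ b := by simpa using hr
  obtain ⟨ψ, ⟨h1, h2, h3⟩, h4⟩ := (S.isSpanCoproduct_hcomp (S.cofan_eq_mk y)
    (S.cofan_eq_mk x) (S.cofan_single (x i)) (S.isSpanCoproduct_sumPro m) hP).existsUnique k a b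
      (fun j _ e => match j, e with | _, ⟨_, ⟨rfl⟩, ⟨rfl⟩⟩ => φ)
      (by rintro _ ⟨⟩ ⟨_, ⟨rfl⟩, ⟨rfl⟩⟩; exact hl')
      (by rintro _ ⟨⟩ ⟨_, ⟨rfl⟩, ⟨rfl⟩⟩; exact hr')
  refine ⟨ψ, ⟨h1, h2, ?_⟩, fun ψ' ⟨k1, k2, k3⟩ => h4 ψ' ⟨k1, k2, ?_⟩⟩
  · rw [hcomp_congr _ rfl hc]
    exact h3 i ⟨⟩ ⟨i, ⟨rfl⟩, ⟨rfl⟩⟩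
  · rintro _ ⟨⟩ ⟨_, ⟨rfl⟩, ⟨rfl⟩⟩
    rw [hcomp_congr _ rfl hc] at k3
    exact k3

lemma sum_hom_ext {x : I → D} {z : D} {f g : S.sum x ⟶ z}
    (h : ∀ i, S.inj x i ≫ f = S.inj x i ≫ g) : f = g :=
  Cofan.IsColimit.hom_ext (S.isColimit x) _ _ h

lemma inclPro_codiagPro {z w : D} (n : Pro z w) (i : I) :
    cellComp (S.inclPro (fun _ : I => n) i) (S.codiagPro I n) = cellId n :=
  S.inclPro_descPro _ _ _ _ _ i

variable (I) in
/-- Codiagonals have companions, and reshaping the codiagonals at proarrows by them gives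
invertible cells. -/
lemma exists_companionData_codiag (z : D) :
    ∃ (p : Pro (S.sum fun _ : I => z) z) (c : CompanionData (S.codiag I z) p),
      ∀ {w : D} (n : Pro z w),
        IsOpcartesian (cellComp (leftUnitorInv (S.sumPro fun _ : I => n))
          (hcomp c.unit (S.codiagPro I n) (by simp [S.left_codiagPro]))) := by
  -- The span is `I ← I → 1`, with every fibre a point.
  obtain ⟨P, κ, hP⟩ := S.exists_isSpanCoproduct (S.cofan_eq_mk fun _ : I => z) (S.cofan_single z)
    (A := fun _ _ => PUnit) (fun _ _ _ => proId z)
  have hκl (i : I) : left (κ i ⟨⟩ ⟨⟩) = S.inj (fun _ => z) i := hP.left_eq _ _ _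
  have hκr (i : I) : right (κ i ⟨⟩ ⟨⟩) = 𝟙 z := hP.right_eq _ _ _
  -- The identity on `Σ z` is itself the coproduct of the identities on `z`, so the coprojections of
  -- `P` glue to a candidate unit over `𝟙` and the codiagonal.
  obtain ⟨η, ⟨hηl, hηr, hη⟩, -⟩ := existsUnique_of_isSpanCoproduct
    (S.isSpanCoproduct_id fun _ : I => z) P (𝟙 _) (S.codiag I z) (fun i => κ i ⟨⟩ ⟨⟩)
    (by simp [hκl]) (by simp [hκr, S.inj_codiag])
  -- Cells out of `P` and suitably bounded cells out of the identity of `Σ z` are both families of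
  -- cells out of `proId z`; restriction along `η` matches the two.
  have hη' : IsOpcartesian η := by
    intro a b k f g φ hl hr
    obtain ⟨ψ, ⟨h1, h2, h3⟩, h4⟩ := hP.existsUnique k f g
      (fun i _ _ => cellComp (idCell (S.inj (fun _ : I => z) i)) φ) (by simp [hl, hηl])
      (by simp [hr, hηr, ← Category.assoc, S.inj_codiag])
    refine ⟨ψ, ⟨h1, h2, (S.isSpanCoproduct_id _).ext (by simp [h1, hl])
      (by simp [h2, hr]) ?_⟩, fun ψ' ⟨k1, k2, k3⟩ => h4 ψ' ⟨k1, k2, fun i _ _ => ?_⟩⟩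
    · rintro i _ ⟨rfl⟩
      exact (cellComp_assoc _ _ _).symm.trans ((congrArg (cellComp · ψ) (hη i)).trans
        (h3 i ⟨⟩ ⟨⟩))
    · rw [← k3, ← cellComp_assoc]
      exact congrArg (cellComp · ψ') (hη i).symm
  obtain ⟨c, rfl⟩ := hη'.exists_companionData hηl hηr
  have hc (i : I) : cellComp (idCell (S.inj _ i)) c.unit = κ i ⟨⟩ ⟨⟩ := hη i
  refine ⟨P, c, fun {w} n => ?_⟩
  intro a b k f g φ hl hr
  -- Restricted along the `i`-th coprojection, the pasted cell is `κ i ⊙ n` up to a unitor, since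
  -- `∇` restricts to the identity of `n`.
  have key (i : I) : cellComp (S.inclPro (fun _ : I => n) i)
      (cellComp (leftUnitorInv (S.sumPro fun _ : I => n))
          (hcomp c.unit (S.codiagPro I n) (by simp [S.left_codiagPro]))) =
      cellComp (leftUnitorInv n) (hcomp (κ i ⟨⟩ ⟨⟩) (cellId n) (by simp [hκr])) := by
    rw [← cellComp_assoc, ← leftUnitorInv_naturality, cellComp_assoc, ← hcomp_cellComp,
      hcomp_congr _ ((congrArg (fun f => cellComp (idCell f) c.unit)
        (S.left_inclPro (fun _ : I => n) i)).trans (hc i)) (S.inclPro_codiagPro n i)]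
  have hl' : left φ = f := by simpa using hl
  have hr' : right φ = S.codiag I w ≫ g := by simpa [S.right_codiagPro] using hr
  -- With `n` regarded as the coproduct of itself alone, `P ⊙ n` is the coproduct of copies of
  -- `proId z ⊙ n` over `I ← I → 1`.
  have hex (φ' : ∀ i : I, Cell (proComp (proId z) n) k) (hφl : ∀ i, left (φ' i) = S.inj _ i ≫ f)
      (hφr : ∀ i, right (φ' i) = g) : ∃! ψ : Cell (proComp P n) k, left ψ = f ∧ right ψ = g ∧
        ∀ i, cellComp (hcomp (κ i ⟨⟩ ⟨⟩) (cellId n) (by simp [hκr])) ψ = φ' i := by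
    obtain ⟨ψ, ⟨h1, h2, h3⟩, h4⟩ := (S.isSpanCoproduct_hcomp (S.cofan_eq_mk fun _ : I => z)
      (S.cofan_single z) (S.cofan_single w) hP (IsSpanCoproduct.single n)).existsUnique k f g
      (fun i _ _ => φ' i) (fun i _ _ => hφl i)
      (fun i _ _ => (hφr i).trans (Category.id_comp g).symm)
    exact ⟨ψ, ⟨h1, h2, fun i => h3 i ⟨⟩ ⟨⟨⟩, ⟨⟩, ⟨⟩⟩⟩,
      fun ψ' ⟨k1, k2, k3⟩ => h4 ψ' ⟨k1, k2, fun i _ _ => k3 i⟩⟩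
  obtain ⟨ψ, ⟨h1, h2, h3⟩, h4⟩ := hex
    (fun i => cellComp (leftUnitorHom n) (cellComp (S.inclPro (fun _ : I => n) i) φ))
    (by simp [hl']) (by intro i; simp [hr', ← Category.assoc, S.inj_codiag])
  refine ⟨ψ, ⟨h1, h2, S.sumPro_hom_ext (by simp [h1, hl']) (by simp [h2, hr', S.right_codiagPro])
    fun i => ?_⟩, fun ψ' ⟨k1, k2, k3⟩ => h4 ψ' ⟨k1, k2, fun i => ?_⟩⟩
  · rw [← cellComp_assoc, key, cellComp_assoc, h3, ← cellComp_assoc, leftUnitor_inv_hom,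
      id_cellComp]
  · rw [← k3, ← cellComp_assoc (S.inclPro _ i), key, cellComp_assoc, ← cellComp_assoc,
      leftUnitor_hom_inv, id_cellComp]

variable (I) in
-- The same argument over the opposite span `1 ← I → I`, with the cells of `P` glued over the
-- codiagonal on the left and `𝟙` on the right.
lemma exists_conjointData_codiag (z : D) :
    ∃ (p : Pro z (S.sum fun _ : I => z)) (c : ConjointData (S.codiag I z) p),
      ∀ {w : D} (n : Pro w z),
        IsOpcartesian (cellComp (rightUnitorInv (S.sumPro fun _ : I => n))
          (hcomp (S.codiagPro I n) c.unit (by simp [S.right_codiagPro]))) := by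
  obtain ⟨P, κ, hP⟩ := S.exists_isSpanCoproduct (S.cofan_single z) (S.cofan_eq_mk fun _ : I => z)
    (A := fun _ _ => PUnit) (fun _ _ _ => proId z)
  have hκl (i : I) : left (κ ⟨⟩ i ⟨⟩) = 𝟙 z := hP.left_eq _ _ _
  have hκr (i : I) : right (κ ⟨⟩ i ⟨⟩) = S.inj (fun _ => z) i := hP.right_eq _ _ _
  obtain ⟨η, ⟨hηl, hηr, hη⟩, -⟩ := existsUnique_of_isSpanCoproduct
    (S.isSpanCoproduct_id fun _ : I => z) P (S.codiag I z) (𝟙 _) (fun i => κ ⟨⟩ i ⟨⟩)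
    (by simp [hκl, S.inj_codiag]) (by simp [hκr])
  have hη' : IsOpcartesian η := by
    intro a b k f g φ hl hr
    obtain ⟨ψ, ⟨h1, h2, h3⟩, h4⟩ := hP.existsUnique k f g
      (fun _ i _ => cellComp (idCell (S.inj (fun _ : I => z) i)) φ)
      (by simp [hl, hηl, ← Category.assoc, S.inj_codiag]) (by simp [hr, hηr])
    refine ⟨ψ, ⟨h1, h2, (S.isSpanCoproduct_id _).ext (by simp [h1, hl])
      (by simp [h2, hr]) ?_⟩, fun ψ' ⟨k1, k2, k3⟩ => h4 ψ' ⟨k1, k2, fun _ i _ => ?_⟩⟩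
    · rintro i _ ⟨rfl⟩
      exact (cellComp_assoc _ _ _).symm.trans ((congrArg (cellComp · ψ) (hη i)).trans
        (h3 ⟨⟩ i ⟨⟩))
    · rw [← k3, ← cellComp_assoc]
      exact congrArg (cellComp · ψ') (hη i).symm
  obtain ⟨c, rfl⟩ := hη'.exists_conjointData hηl hηr
  have hc (i : I) : cellComp (idCell (S.inj _ i)) c.unit = κ ⟨⟩ i ⟨⟩ := hη i
  refine ⟨P, c, fun {w} n => ?_⟩
  intro a b k f g φ hl hr
  have key (i : I) : cellComp (S.inclPro (fun _ : I => n) i)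
      (cellComp (rightUnitorInv (S.sumPro fun _ : I => n))
          (hcomp (S.codiagPro I n) c.unit (by simp [S.right_codiagPro]))) =
      cellComp (rightUnitorInv n) (hcomp (cellId n) (κ ⟨⟩ i ⟨⟩) (by simp [hκl])) := by
    rw [← cellComp_assoc, ← rightUnitorInv_naturality, cellComp_assoc, ← hcomp_cellComp,
      hcomp_congr _ (S.inclPro_codiagPro n i)
        ((congrArg (fun f => cellComp (idCell f) c.unit)
          (S.right_inclPro (fun _ : I => n) i)).trans (hc i))]
  have hl' : left φ = S.codiag I w ≫ f := by simpa [S.left_codiagPro] using hl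
  have hr' : right φ = g := by simpa using hr
  have hex (φ' : ∀ i : I, Cell (proComp n (proId z)) k) (hφl : ∀ i, left (φ' i) = f)
      (hφr : ∀ i, right (φ' i) = S.inj _ i ≫ g) : ∃! ψ : Cell (proComp n P) k,
        left ψ = f ∧ right ψ = g ∧
        ∀ i, cellComp (hcomp (cellId n) (κ ⟨⟩ i ⟨⟩) (by simp [hκl])) ψ = φ' i := by
    obtain ⟨ψ, ⟨h1, h2, h3⟩, h4⟩ := (S.isSpanCoproduct_hcomp (S.cofan_single w)
      (S.cofan_single z) (S.cofan_eq_mk fun _ : I => z) (IsSpanCoproduct.single n)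
      hP).existsUnique k f g
      (fun _ i _ => φ' i) (fun _ i _ => (hφl i).trans (Category.id_comp f).symm)
      (fun _ i _ => hφr i)
    exact ⟨ψ, ⟨h1, h2, fun i => h3 ⟨⟩ i ⟨⟨⟩, ⟨⟩, ⟨⟩⟩⟩,
      fun ψ' ⟨k1, k2, k3⟩ => h4 ψ' ⟨k1, k2, fun _ i _ => k3 i⟩⟩
  obtain ⟨ψ, ⟨h1, h2, h3⟩, h4⟩ := hex
    (fun i => cellComp (rightUnitorHom n) (cellComp (S.inclPro (fun _ : I => n) i) φ))
    (by intro i; simp [hl', ← Category.assoc, S.inj_codiag]) (by simp [hr'])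
  refine ⟨ψ, ⟨h1, h2, S.sumPro_hom_ext (by simp [h1, hl', S.left_codiagPro]) (by simp [h2, hr'])
    fun i => ?_⟩, fun ψ' ⟨k1, k2, k3⟩ => h4 ψ' ⟨k1, k2, fun i => ?_⟩⟩
  · rw [← cellComp_assoc, key, cellComp_assoc, h3, ← cellComp_assoc, rightUnitor_inv_hom,
      id_cellComp]
  · rw [← k3, ← cellComp_assoc (S.inclPro _ i), key, cellComp_assoc, ← cellComp_assoc,
      rightUnitor_hom_inv, id_cellComp]

end StrongFiniteCoproducts

end DoubleCategory

namespace DoubleCategory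

variable {D : Type u} [DoubleCategory.{t, w, v} D]

open DoubleCategory.StrongFiniteCoproducts (hcomp_congr)

lemma Carries.cell {x y : D} {m n : Pro x y} (θ : Globular m n) :
    Carries θ θ.cell (cellId n) :=
  cellComp_id _

/-! ### Coherence of reshaped cells -/

namespace CompanionData

variable {X Y Z X' Y' Z' : Loose D} {f : X.obj ⟶ X'.obj} {g : Y.obj ⟶ Y'.obj} {h : Z.obj ⟶ Z'.obj}
  {p : X ⟶ X'} {q : Y ⟶ Y'} {r : Z ⟶ Z'} (c : CompanionData f p) (d : CompanionData g q)
  (e : CompanionData h r)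

/-- The test for equality used below: the projection to `n` is cancellable, so it is enough that
both 2-cells carry one and the same `π` to it. -/
lemma cancel {n : X' ⟶ Y'} {k : X ⟶ Y'} {θ θ' : k ⟶ p ≫ n} {π : Cell (D := D) k n}
    (h : Carries θ π (leftReduce c.counit (cellId n) (by simp)))
    (h' : Carries θ' π (leftReduce c.counit (cellId n) (by simp))) : θ = θ' :=
  Globular.ext (c.cancel_leftReduce (n := n) (θ.left_eq.trans θ'.left_eq.symm)
    (Eq.trans h (Eq.symm h')))

lemma carries_slide_whiskerLeft {m : X ⟶ Y} {n n' : X' ⟶ Y'} (α : Cell (D := D) m n)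
    (hl : left α = f) (hr : right α = g) (τ : n ⟶ n') :
    Carries (c.slide d α hl hr ≫ p ◁ τ)
      (rightReduce (cellComp α τ.cell) d.counit (by simp [hr]))
      (leftReduce c.counit (cellId n') (by simp)) := by
  refine Carries.comp (((c.carries_slide d α hl hr).post τ.cell).congr
    ((rightReduce_cellComp _ _ _ _).trans (rightReduce_congr _ rfl ?_))
    ((leftReduce_cellComp _ _ _ _).trans (leftReduce_congr _ ?_ (id_cellComp _))))
    (Carries.whiskerLeft_leftReduce c.counit (Carries.cell τ) (by simp) (by simp))
  · simp
  · simp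

/-- Both sides carry the reduction of `cellComp α τ.cell` with the counit of `q` to the projection,
by `H`. -/
lemma slide_naturality {m m' : X ⟶ Y} {n n' : X' ⟶ Y'} {α : Cell (D := D) m n}
    (hl : left α = f) (hr : right α = g) {α' : Cell (D := D) m' n'} (hl' : left α' = f)
    (hr' : right α' = g) (θ : m ⟶ m') (τ : n ⟶ n')
    (H : cellComp θ.cell α' = cellComp α τ.cell) :
    θ ▷ q ≫ c.slide d α' hl' hr' = c.slide d α hl hr ≫ p ◁ τ :=
  c.cancel
    ((Carries.whiskerRight_rightReduce (show Carries θ (cellComp α τ.cell) α' from H) d.counit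
      (by simp [hr]) (by simp [hr'])).comp (c.carries_slide d α' hl' hr'))
    (c.carries_slide_whiskerLeft d α hl hr τ)

/-- Two comparison cells are allowed so that the lemma serves both transformations: for the
coprojections `κ` is trivial and `τ` is the unit comparison of `⊕`, for the codiagonals the roles
are reversed. -/
lemma slide_id {m : X ⟶ X} {n : X' ⟶ X'} {α : Cell (D := D) m n} (hl : left α = f)
    (hr : right α = f) (κ : m ⟶ 𝟙 X) (τ : n ⟶ 𝟙 X')
    (H : cellComp α τ.cell = cellComp κ.cell (idCell f)) :
    c.slide c α hl hr ≫ p ◁ τ = κ ▷ p ≫ (λ_ p).hom ≫ (ρ_ p).inv := by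
  refine c.cancel ((c.carries_slide_whiskerLeft c α hl hr τ).congr
    (rightReduce_congr _ H rfl) rfl) ?_
  refine (Carries.whiskerRight_rightReduce (a' := idCell f) rfl c.counit (by simp)
    (by simp)).comp (((Carries.leftUnitor c.counit).congr ?_ rfl).comp
      ((Carries.rightUnitor c.counit).symm.congr rfl ?_))
  · rw [leftReduce_eq_rightReduce]
    exact rightReduce_congr _ (congrArg idCell c.left_counit) rfl
  · rw [← leftReduce_eq_rightReduce]
    exact leftReduce_congr _ rfl ((congrArg idCell c.right_counit).trans (idCell_id _))

/-- The right-hand pasting is followed step by step: the counit of `h` is moved leftwards, first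
through `α'` becoming the counit of `g`, then through `α` becoming the counit of `f`. -/
lemma slide_comp {m : X ⟶ Y} {m' : Y ⟶ Z} {n : X' ⟶ Y'} {n' : Y' ⟶ Z'} {k : X ⟶ Z} {l : X' ⟶ Z'}
    {α : Cell (D := D) m n} {α' : Cell (D := D) m' n'} {β : Cell (D := D) k l} (hl : left α = f)
    (hr : right α = g) (hl' : left α' = g) (hr' : right α' = h) (hl'' : left β = f)
    (hr'' : right β = h) (κ : k ⟶ m ≫ m') (τ : l ⟶ n ≫ n')
    (H : cellComp β τ.cell = cellComp κ.cell (hcomp α α' (hr.trans hl'.symm))) :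
    c.slide e β hl'' hr'' ≫ p ◁ τ = κ ▷ r ≫ (α_ _ _ _).hom ≫ m ◁ d.slide e α' hl' hr' ≫
      (α_ _ _ _).inv ≫ c.slide d α hl hr ▷ n' ≫ (α_ _ _ _).hom := by
  refine c.cancel ((c.carries_slide_whiskerLeft e β hl'' hr'' τ).congr
    (rightReduce_congr _ H rfl) rfl) ?_
  refine (Carries.whiskerRight_rightReduce (a' := hcomp α α' (hr.trans hl'.symm)) rfl e.counit
    (by simp [hr']) (by simp [hr'])).comp ?_
  refine (Carries.associator_hcomp_rightReduce α α' e.counit (hr.trans hl'.symm)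
    (by simp [hr'])).comp ?_
  refine (Carries.whiskerLeft α (d.carries_slide e α' hl' hr') (by simp [hr, hl'])
    (by simp [hr])).comp ?_
  refine (Carries.associator_hcomp_leftReduce α d.counit (cellId n') (by simp [hr])
    (by simp)).symm.comp ?_
  refine (Carries.whiskerRight (c.carries_slide d α hl hr) (cellId n') (by simp) (by simp)).comp ?_
  exact (Carries.associator_leftReduce_hcomp c.counit (cellId n) (cellId n') (by simp)
    (by simp)).congr rfl (leftReduce_congr _ rfl (hcomp_id _ _))

end CompanionData

namespace ConjointData

variable {X Y Z X' Y' Z' : Loose D} {f : X.obj ⟶ X'.obj} {g : Y.obj ⟶ Y'.obj} {h : Z.obj ⟶ Z'.obj}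
  {p : X' ⟶ X} {q : Y' ⟶ Y} {r : Z' ⟶ Z} (c : ConjointData f p) (d : ConjointData g q)
  (e : ConjointData h r)

lemma cancel {n : Y' ⟶ X'} {k : Y' ⟶ X} {θ θ' : k ⟶ n ≫ p} {π : Cell (D := D) k n}
    (h : Carries θ π (rightReduce (cellId n) c.counit (by simp)))
    (h' : Carries θ' π (rightReduce (cellId n) c.counit (by simp))) : θ = θ' :=
  Globular.ext (c.cancel_rightReduce (n := n) (θ.right_eq.trans θ'.right_eq.symm)
    (Eq.trans h (Eq.symm h')))

lemma carries_slide_whiskerRight {m : X ⟶ Y} {n n' : X' ⟶ Y'} (α : Cell (D := D) m n)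
    (hl : left α = f) (hr : right α = g) (τ : n ⟶ n') :
    Carries (c.slide d α hl hr ≫ τ ▷ q)
      (leftReduce c.counit (cellComp α τ.cell) (by simp [hl]))
      (rightReduce (cellId n') d.counit (by simp)) := by
  refine Carries.comp (((c.carries_slide d α hl hr).post τ.cell).congr
    ((leftReduce_cellComp _ _ _ _).trans (leftReduce_congr _ ?_ rfl))
    ((rightReduce_cellComp _ _ _ _).trans (rightReduce_congr _ (id_cellComp _) ?_)))
    (Carries.whiskerRight_rightReduce (Carries.cell τ) d.counit (by simp) (by simp))
  · simp
  · simp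

lemma slide_naturality {m m' : X ⟶ Y} {n n' : X' ⟶ Y'} {α : Cell (D := D) m n}
    (hl : left α = f) (hr : right α = g) {α' : Cell (D := D) m' n'} (hl' : left α' = f)
    (hr' : right α' = g) (θ : m ⟶ m') (τ : n ⟶ n')
    (H : cellComp θ.cell α' = cellComp α τ.cell) :
    p ◁ θ ≫ c.slide d α' hl' hr' = c.slide d α hl hr ≫ τ ▷ q :=
  d.cancel
    ((Carries.whiskerLeft_leftReduce c.counit (show Carries θ (cellComp α τ.cell) α' from H)
      (by simp [hl]) (by simp [hl'])).comp (c.carries_slide d α' hl' hr'))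
    (c.carries_slide_whiskerRight d α hl hr τ)

lemma slide_id {m : X ⟶ X} {n : X' ⟶ X'} {α : Cell (D := D) m n} (hl : left α = f)
    (hr : right α = f) (κ : m ⟶ 𝟙 X) (τ : n ⟶ 𝟙 X')
    (H : cellComp α τ.cell = cellComp κ.cell (idCell f)) :
    c.slide c α hl hr ≫ τ ▷ p = p ◁ κ ≫ (ρ_ p).hom ≫ (λ_ p).inv := by
  refine c.cancel ((c.carries_slide_whiskerRight c α hl hr τ).congr
    (leftReduce_congr _ rfl H) rfl) ?_
  refine (Carries.whiskerLeft_leftReduce c.counit (b' := idCell f) rfl (by simp)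
    (by simp)).comp (((Carries.rightUnitor c.counit).congr ?_ rfl).comp
      ((Carries.leftUnitor c.counit).symm.congr rfl ?_))
  · rw [← leftReduce_eq_rightReduce]
    exact leftReduce_congr _ rfl (congrArg idCell c.right_counit)
  · rw [leftReduce_eq_rightReduce]
    exact rightReduce_congr _ ((congrArg idCell c.left_counit).trans (idCell_id _)) rfl

lemma slide_comp {m : X ⟶ Y} {m' : Y ⟶ Z} {n : X' ⟶ Y'} {n' : Y' ⟶ Z'} {k : X ⟶ Z} {l : X' ⟶ Z'}
    {α : Cell (D := D) m n} {α' : Cell (D := D) m' n'} {β : Cell (D := D) k l} (hl : left α = f)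
    (hr : right α = g) (hl' : left α' = g) (hr' : right α' = h) (hl'' : left β = f)
    (hr'' : right β = h) (κ : k ⟶ m ≫ m') (τ : l ⟶ n ≫ n')
    (H : cellComp β τ.cell = cellComp κ.cell (hcomp α α' (hr.trans hl'.symm))) :
    c.slide e β hl'' hr'' ≫ τ ▷ r = p ◁ κ ≫ (α_ _ _ _).inv ≫ c.slide d α hl hr ▷ m' ≫
      (α_ _ _ _).hom ≫ n ◁ d.slide e α' hl' hr' ≫ (α_ _ _ _).inv := by
  refine e.cancel ((c.carries_slide_whiskerRight e β hl'' hr'' τ).congr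
    (leftReduce_congr _ rfl H) rfl) ?_
  refine (Carries.whiskerLeft_leftReduce c.counit (b' := hcomp α α' (hr.trans hl'.symm)) rfl
    (by simp [hl]) (by simp [hl])).comp ?_
  refine (Carries.associator_leftReduce_hcomp c.counit α α' (by simp [hl])
    (hr.trans hl'.symm)).symm.comp ?_
  refine (Carries.whiskerRight (c.carries_slide d α hl hr) α' (by simp [hr, hl'])
    (by simp [hl'])).comp ?_
  refine (Carries.associator_hcomp_leftReduce (cellId n) d.counit α' (by simp)
    (by simp [hl'])).comp ?_
  refine (Carries.whiskerLeft (cellId n) (d.carries_slide e α' hl' hr') (by simp) (by simp)).comp ?_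
  exact (Carries.associator_hcomp_rightReduce (cellId n) (cellId n') e.counit (by simp)
    (by simp)).symm.congr rfl (rightReduce_congr _ (hcomp_id _ _) rfl)

end ConjointData

end DoubleCategory

/-- An invertible 2-cell in a power of a bicategory, from its components. -/
def powerIso {I : Type} {B : Type u} [Bicategory.{w, v} B] {x y : I → B} {f g : x ⟶ y}
    (e : ∀ i, f i ≅ g i) : f ≅ g where
  hom := fun i => (e i).hom
  inv := fun i => (e i).inv
  hom_inv_id := funext fun i => (e i).hom_inv_id
  inv_hom_id := funext fun i => (e i).inv_hom_id

/-- A pseudonatural transformation, from the inverses of its structure 2-cells. -/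
def strongTransOfInv {B : Type u} [Bicategory.{w, v} B] {C : Type u₂} [Bicategory.{w₂, v₂} C]
    {F G : Pseudofunctor B C} (app : ∀ a, F.obj a ⟶ G.obj a)
    (naturality : ∀ {a b : B} (f : a ⟶ b), app a ≫ G.map f ≅ F.map f ≫ app b)
    (naturality_naturality : ∀ {a b : B} {f g : a ⟶ b} (η : f ⟶ g),
      app a ◁ G.map₂ η ≫ (naturality g).hom = (naturality f).hom ≫ F.map₂ η ▷ app b)
    (naturality_id : ∀ a : B, (naturality (𝟙 a)).hom ≫ (F.mapId a).hom ▷ app a =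
      app a ◁ (G.mapId a).hom ≫ (ρ_ (app a)).hom ≫ (λ_ (app a)).inv)
    (naturality_comp : ∀ {a b c : B} (f : a ⟶ b) (g : b ⟶ c),
      (naturality (f ≫ g)).hom ≫ (F.mapComp f g).hom ▷ app c =
        app a ◁ (G.mapComp f g).hom ≫ (α_ _ _ _).inv ≫ (naturality f).hom ▷ G.map g ≫
          (α_ _ _ _).hom ≫ F.map f ◁ (naturality g).hom ≫ (α_ _ _ _).inv) :
    Pseudofunctor.StrongTrans F G where
  app := app
  naturality f := (naturality f).symm
  naturality_naturality η := by
    rw [Iso.symm_hom, Iso.symm_hom, Iso.eq_inv_comp, ← Category.assoc, Iso.comp_inv_eq,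
      naturality_naturality]
  naturality_id a := by
    rw [Iso.symm_hom, Iso.inv_comp_eq, ← Category.assoc, naturality_id]
    simp
  naturality_comp f g := by
    rw [Iso.symm_hom, Iso.inv_comp_eq, ← Category.assoc, naturality_comp]
    simp

/-! ### The four pseudonatural transformations -/

namespace DoubleCategory.StrongFiniteCoproducts

variable {D : Type u} [DoubleCategory.{t, w, v} D] (S : StrongFiniteCoproducts D) {I : Type}
  [Finite I]

lemma inclPro_directSum_mapId (x : I → Loose D) (i : I) :
    cellComp (S.inclPro (D := D) ((𝟙 x : x ⟶ x)) i) ((S.directSum I).mapId x).hom.cell =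
      idCell (S.inj (fun i => (x i).obj) i) :=
  S.inclPro_sumId_hom _ i

lemma inclPro_directSum_mapComp {x y z : I → Loose D} (m : x ⟶ y) (n : y ⟶ z) (i : I) :
    cellComp (S.inclPro (D := D) (m ≫ n) i) ((S.directSum I).mapComp m n).hom.cell =
      hcomp (S.inclPro (D := D) m i) (S.inclPro (D := D) n i) (by simp) :=
  S.inclPro_sumComp_hom (D := D) m n i

lemma codiagPro_map₂ {x y : Loose D} {m n : x ⟶ y} (θ : m ⟶ n) :
    cellComp (S.sumMap (I := I) fun _ => θ).cell (S.codiagPro (D := D) I n) =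
      cellComp (S.codiagPro (D := D) I m) θ.cell :=
  S.sumPro_hom_ext (by simp [S.left_codiagPro]) (by simp [S.right_codiagPro]) fun i => by
    rw [← cellComp_assoc, ← cellComp_assoc, inclPro_sumMap, cellComp_assoc, inclPro_codiagPro,
      inclPro_codiagPro, id_cellComp, cellComp_id]

/-- Compatibility of the codiagonals with identities; the trailing identity cell is the trivial `τ`
in the hypothesis of `slide_id`. -/
lemma codiagPro_proId (z : D) :
    cellComp (S.codiagPro I (proId z)) (cellId (proId z)) =
      cellComp (S.sumId fun _ : I => z).hom.cell (idCell (S.codiag I z)) := by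
  refine S.sumPro_hom_ext ?_ ?_ fun i => ?_
  · rw [cellComp_id, left_codiagPro, left_cellComp, left_idCell]
    exact ((congrArg (· ≫ _) (Globular.left_eq _)).trans (Category.id_comp _)).symm
  · rw [cellComp_id, right_codiagPro, right_cellComp, right_idCell]
    exact ((congrArg (· ≫ _) (Globular.right_eq _)).trans (Category.id_comp _)).symm
  · rw [cellComp_id, inclPro_codiagPro, ← cellComp_assoc, inclPro_sumId_hom, ← idCell_comp,
      inj_codiag, idCell_id]

lemma codiagPro_proComp {x y z : D} (m : Pro x y) (n : Pro y z) :
    S.codiagPro I (proComp m n) =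
      cellComp (S.sumComp (fun _ : I => m) fun _ : I => n).hom.cell
        (hcomp (S.codiagPro I m) (S.codiagPro I n)
          ((S.right_codiagPro I m).trans (S.left_codiagPro I n).symm)) := by
  refine S.sumPro_hom_ext ?_ ?_ fun i => ?_
  · rw [left_codiagPro, left_cellComp, left_hcomp, left_codiagPro]
    exact ((congrArg (· ≫ _) (Globular.left_eq _)).trans (Category.id_comp _)).symm
  · rw [right_codiagPro, right_cellComp, right_hcomp, right_codiagPro]
    exact ((congrArg (· ≫ _) (Globular.right_eq _)).trans (Category.id_comp _)).symm
  · rw [inclPro_codiagPro, ← cellComp_assoc, inclPro_sumComp_hom, ← hcomp_cellComp,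
      hcomp_congr _ (S.inclPro_codiagPro m i) (S.inclPro_codiagPro n i), hcomp_id]

section Companions

/-- The pseudonatural transformation `1 ⟶ Δ ∘ ⊕` given by companions of the coprojections. -/
noncomputable def injCompanionTrans
    {p : ∀ (x : I → Loose D) (i : I), x i ⟶ (S.directSum I).obj x}
    (c : ∀ (x : I → Loose D) (i : I), CompanionData (S.inj (fun i => (x i).obj) i) (p x i))
    (hc : ∀ {x y : I → Loose D} (m : x ⟶ y) (i : I),
      IsIso ((c x i).slide (c y i) (S.inclPro (D := D) m i) (S.left_inclPro (D := D) m i)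
        (S.right_inclPro (D := D) m i))) :
    Pseudofunctor.StrongTrans (Pseudofunctor.id (I → Loose D))
      ((S.directSum I).comp (diagonal I (Loose D))) where
  app x := p x
  naturality m := powerIso fun i => @asIso _ _ _ _ _ (hc m i)
  naturality_naturality {x y m n} θ := funext fun i =>
    (c x i).slide_naturality (c y i) (S.left_inclPro (D := D) m i) (S.right_inclPro (D := D) m i)
      (S.left_inclPro (D := D) n i) (S.right_inclPro (D := D) n i) (θ i) (S.sumMap θ)
      (S.inclPro_sumMap θ i).symm
  naturality_id x := funext fun i =>
    (c x i).slide_id (S.left_inclPro _ i) (S.right_inclPro _ i) (𝟙 _)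
      (((S.directSum I).mapId x).hom ≫ 𝟙 _) (by
        refine (congrArg (cellComp _) (cellComp_id _)).trans ?_
        exact (S.inclPro_directSum_mapId x i).trans (id_cellComp _).symm)
  naturality_comp {x y z} m n := funext fun i =>
    (c x i).slide_comp (c y i) (c z i) (S.left_inclPro (D := D) m i)
      (S.right_inclPro (D := D) m i) (S.left_inclPro (D := D) n i) (S.right_inclPro (D := D) n i)
      (S.left_inclPro _ i) (S.right_inclPro _ i) (𝟙 _)
      (((S.directSum I).mapComp m n).hom ≫ 𝟙 _) (by
        refine (congrArg (cellComp _) (cellComp_id _)).trans ?_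
        exact (S.inclPro_directSum_mapComp m n i).trans (id_cellComp _).symm)

/-- The pseudonatural transformation `⊕ ∘ Δ ⟶ 1` given by companions of the codiagonals. -/
noncomputable def codiagCompanionTrans
    {p : ∀ z : Loose D, (S.directSum I).obj (fun _ => z) ⟶ z}
    (c : ∀ z : Loose D, CompanionData (S.codiag I z.obj) (p z))
    (hc : ∀ {z z' : Loose D} (n : z ⟶ z'),
      IsIso (CompanionData.slide (p := p z) (q := p z') (c z) (c z')
        (S.codiagPro (D := D) I n) (S.left_codiagPro (D := D) I n)
        (S.right_codiagPro (D := D) I n))) :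
    Pseudofunctor.StrongTrans ((diagonal I (Loose D)).comp (S.directSum I))
      (Pseudofunctor.id (Loose D)) where
  app z := p z
  naturality n := @asIso _ _ _ _ _ (hc n)
  naturality_naturality {x y m n} θ :=
    CompanionData.slide_naturality (p := p x) (q := p y) (c x) (c y)
      (S.left_codiagPro (D := D) I m) (S.right_codiagPro (D := D) I m)
      (S.left_codiagPro (D := D) I n) (S.right_codiagPro (D := D) I n)
        ((S.directSum I).map₂ ((diagonal I (Loose D)).map₂ θ)) θ
      (S.codiagPro_map₂ θ)
  naturality_id z :=
    (c z).slide_id (S.left_codiagPro I _) (S.right_codiagPro I _)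
      ((S.directSum I).map₂ (𝟙 _) ≫ ((S.directSum I).mapId fun _ => z).hom) (𝟙 _) (by
        rw [(S.directSum I).map₂_id, Category.id_comp]
        exact S.codiagPro_proId z.obj)
  naturality_comp {x y z} m n :=
    (c x).slide_comp (c y) (c z) (S.left_codiagPro (D := D) I m) (S.right_codiagPro (D := D) I m)
      (S.left_codiagPro (D := D) I n) (S.right_codiagPro (D := D) I n)
      (S.left_codiagPro I _) (S.right_codiagPro I _)
      ((S.directSum I).map₂ (𝟙 _) ≫ ((S.directSum I).mapComp (fun _ => m) fun _ => n).hom) (𝟙 _) (by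
        rw [(S.directSum I).map₂_id, Category.id_comp]
        exact (cellComp_id _).trans (S.codiagPro_proComp (D := D) m n))

end Companions

section Conjoints

/-- The pseudonatural transformation `1 ⟶ ⊕ ∘ Δ` given by conjoints of the codiagonals. -/
noncomputable def codiagConjointTrans
    {p : ∀ z : Loose D, z ⟶ (S.directSum I).obj (fun _ => z)}
    (c : ∀ z : Loose D, ConjointData (S.codiag I z.obj) (p z))
    (hc : ∀ {z z' : Loose D} (n : z ⟶ z'),
      IsIso (ConjointData.slide (p := p z) (q := p z') (c z) (c z')
        (S.codiagPro (D := D) I n) (S.left_codiagPro (D := D) I n)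
        (S.right_codiagPro (D := D) I n))) :
    Pseudofunctor.StrongTrans (Pseudofunctor.id (Loose D))
      ((diagonal I (Loose D)).comp (S.directSum I)) :=
  -- Conjoint reshaping produces a cell in the direction opposite to the structure cell of a strong
  -- transformation, so the axioms are verified for the inverses.
  strongTransOfInv (F := Pseudofunctor.id (Loose D))
    (G := (diagonal I (Loose D)).comp (S.directSum I)) (fun z => p z)
    (fun n => @asIso _ _ _ _ _ (hc n))
    (fun {x y m n} θ =>
      ConjointData.slide_naturality (p := p x) (q := p y) (c x) (c y)
        (S.left_codiagPro (D := D) I m)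
        (S.right_codiagPro (D := D) I m) (S.left_codiagPro (D := D) I n)
        (S.right_codiagPro (D := D) I n)
        ((S.directSum I).map₂ ((diagonal I (Loose D)).map₂ θ)) θ (S.codiagPro_map₂ θ))
    (fun z => (c z).slide_id (S.left_codiagPro I _) (S.right_codiagPro I _)
      ((S.directSum I).map₂ (𝟙 _) ≫ ((S.directSum I).mapId fun _ => z).hom) (𝟙 _) (by
        rw [(S.directSum I).map₂_id, Category.id_comp]
        exact S.codiagPro_proId z.obj))
    (fun {x y z} m n =>
      (c x).slide_comp (c y) (c z) (S.left_codiagPro (D := D) I m)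
        (S.right_codiagPro (D := D) I m) (S.left_codiagPro (D := D) I n)
        (S.right_codiagPro (D := D) I n) (S.left_codiagPro I _) (S.right_codiagPro I _)
        ((S.directSum I).map₂ (𝟙 _) ≫ ((S.directSum I).mapComp (fun _ => m) fun _ => n).hom)
        (𝟙 _) (by
          rw [(S.directSum I).map₂_id, Category.id_comp]
          exact (cellComp_id _).trans (S.codiagPro_proComp (D := D) m n)))

/-- The pseudonatural transformation `Δ ∘ ⊕ ⟶ 1` given by conjoints of the coprojections. -/
noncomputable def injConjointTrans
    {p : ∀ (x : I → Loose D) (i : I), (S.directSum I).obj x ⟶ x i}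
    (c : ∀ (x : I → Loose D) (i : I), ConjointData (S.inj (fun i => (x i).obj) i) (p x i))
    (hc : ∀ {x y : I → Loose D} (m : x ⟶ y) (i : I),
      IsIso ((c x i).slide (c y i) (S.inclPro (D := D) m i) (S.left_inclPro (D := D) m i)
        (S.right_inclPro (D := D) m i))) :
    Pseudofunctor.StrongTrans ((S.directSum I).comp (diagonal I (Loose D)))
      (Pseudofunctor.id (I → Loose D)) :=
  strongTransOfInv (F := (S.directSum I).comp (diagonal I (Loose D)))
    (G := Pseudofunctor.id (I → Loose D)) (fun x => p x)
    (fun m => powerIso fun i => @asIso _ _ _ _ _ (hc m i))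
    (fun {x y m n} θ => funext fun i =>
      (c x i).slide_naturality (c y i) (S.left_inclPro (D := D) m i)
        (S.right_inclPro (D := D) m i) (S.left_inclPro (D := D) n i)
        (S.right_inclPro (D := D) n i) (θ i) (S.sumMap θ) (S.inclPro_sumMap θ i).symm)
    (fun x => funext fun i =>
      (c x i).slide_id (S.left_inclPro _ i) (S.right_inclPro _ i) (𝟙 _)
        (((S.directSum I).mapId x).hom ≫ 𝟙 _) (by
          refine (congrArg (cellComp _) (cellComp_id _)).trans ?_
          exact (S.inclPro_directSum_mapId x i).trans (id_cellComp _).symm))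
    (fun {x y z} m n => funext fun i =>
      (c x i).slide_comp (c y i) (c z i) (S.left_inclPro (D := D) m i)
        (S.right_inclPro (D := D) m i) (S.left_inclPro (D := D) n i)
        (S.right_inclPro (D := D) n i) (S.left_inclPro _ i) (S.right_inclPro _ i) (𝟙 _)
        (((S.directSum I).mapComp m n).hom ≫ 𝟙 _) (by
          refine (congrArg (cellComp _) (cellComp_id _)).trans ?_
          exact (S.inclPro_directSum_mapComp m n i).trans (id_cellComp _).symm))

end Conjoints

end DoubleCategory.StrongFiniteCoproducts

namespace DoubleCategory

variable {D : Type u} [DoubleCategory.{t, w, v} D]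

open DoubleCategory.StrongFiniteCoproducts (hcomp_congr)

/-! ### Coherence equations from reductions -/

section

variable {A A' B B' : Loose D}

lemma Carries.eq_of_iso {m n k : A ⟶ B} {θ θ' : m ⟶ n} {e : n ≅ k} {π : Cell (D := D) m k}
    (h : Carries θ π e.hom.cell) (h' : Carries θ' π e.hom.cell) : θ = θ' := by
  rw [← cancel_mono e.hom]
  exact Globular.ext (Eq.trans h (Eq.symm h'))

/-- Naturality of a transformation with components `a ⊙ b ≅ 1` that is a composite of two
transformations with structure cells `φ` and `ψ`. -/
lemma retraction_naturality {m : A ⟶ A'} {n : B ⟶ B'} {a : A ⟶ B} {b : B ⟶ A} {a' : A' ⟶ B'}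
    {b' : B' ⟶ A'} (φ : m ≫ a' ⟶ a ≫ n) (ψ : n ≫ b' ⟶ b ≫ m) (e : a ≫ b ≅ 𝟙 A)
    (e' : a' ≫ b' ≅ 𝟙 A') {x : Cell (D := D) a (proId A.obj)} {y : Cell (D := D) b (proId A.obj)}
    {x' : Cell (D := D) a' (proId A'.obj)} {y' : Cell (D := D) b' (proId A'.obj)}
    {β : Cell (D := D) n m} (hxy : right x = left y) (hxy' : right x' = left y')
    (hx' : right (cellId (D := D) m) = left x') (hxβ : right x = left β)
    (hβy' : right β = left y') (hy : right y = left (cellId (D := D) m))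
    (hφ : Carries φ (rightReduce (cellId m) x' hx') (leftReduce x β hxβ))
    (hψ : Carries ψ (rightReduce β y' hβy') (leftReduce y (cellId m) hy))
    (he : Carries e.hom (leftReduce x y hxy) (cellId (proId A.obj)))
    (he' : Carries e'.hom (leftReduce x' y' hxy') (cellId (proId A'.obj))) :
    m ◁ e'.hom ≫ (ρ_ m).hom ≫ (λ_ m).inv =
      (α_ _ _ _).inv ≫ φ ▷ b' ≫ (α_ _ _ _).hom ≫ a ◁ ψ ≫ (α_ _ _ _).inv ≫ e.hom ▷ m := by
  have hl : leftReduce (cellId (proId A.obj)) (cellId (D := D) m) (by simp) =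
      (λ_ m).hom.cell := by
    rw [leftReduce_congr _ ((idCell_id A.obj).symm.trans
      (congrArg idCell (left_cellId (D := D) m).symm)) rfl, leftReduce_idCell]
    exact cellComp_id _
  have hr : rightReduce (cellId (D := D) m) (cellId (proId A'.obj)) (by simp) =
      (ρ_ m).hom.cell := by
    rw [rightReduce_congr _ rfl ((idCell_id A'.obj).symm.trans
      (congrArg idCell (right_cellId (D := D) m).symm)), rightReduce_idCell]
    exact cellComp_id _
  -- Composing with the invertible `λ_ m` loses nothing; both sides then carry the reduction of `m ⊙
  -- (a' ⊙ b')` by `x'` and `y'` to the unitor.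
  refine Carries.eq_of_iso (e := λ_ m) (π := rightReduce (cellId (D := D) m)
    (leftReduce x' y' hxy') (by simpa using hx')) ?_ ?_
  · refine (Carries.whiskerLeft_rightReduce (D := D) (cellId (D := D) m) he'
      (by simpa using hx') ((right_cellId _).trans (left_cellId _).symm)).comp
        (Carries.comp (π' := cellId (D := D) m) ?_ ?_)
    · exact (Carries.cell (ρ_ m).hom).congr hr.symm rfl
    · exact Carries.symm (Carries.cell (λ_ m).hom)
  · refine (Carries.associator_rightReduce_leftReduce (cellId (D := D) m) x' y' hx' hxy').symm.comp
      ?_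
    refine (Carries.whiskerRight_rightReduce hφ y' (by simpa using hxy')
      (by simpa using hβy')).comp ?_
    refine (Carries.associator_leftReduce_rightReduce x β y' hxβ hβy').comp ?_
    refine (Carries.whiskerLeft_leftReduce x hψ (by simpa using hxβ) (by simpa using hxy)).comp ?_
    refine (Carries.associator_leftReduce_leftReduce x y (cellId (D := D) m) hxy hy).symm.comp ?_
    exact (Carries.whiskerRight_leftReduce he (cellId (D := D) m) (by simpa using hy)
      ((right_cellId _).trans (left_cellId _).symm)).congr rfl hl

/-- Left triangulators point out of the identity, hence the need for this form with `e` and `e'`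
inverted. -/
lemma retraction_naturality_inv {m : A ⟶ A'} {n : B ⟶ B'} {a : A ⟶ B} {b : B ⟶ A} {a' : A' ⟶ B'}
    {b' : B' ⟶ A'} {φ : m ≫ a' ⟶ a ≫ n} {ψ : n ≫ b' ⟶ b ≫ m} {e : a ≫ b ≅ 𝟙 A}
    {e' : a' ≫ b' ≅ 𝟙 A'} (h : m ◁ e'.hom ≫ (ρ_ m).hom ≫ (λ_ m).inv =
      (α_ _ _ _).inv ≫ φ ▷ b' ≫ (α_ _ _ _).hom ≫ a ◁ ψ ≫ (α_ _ _ _).inv ≫ e.hom ▷ m) :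
    m ◁ e'.inv ≫ (α_ _ _ _).inv ≫ φ ▷ b' ≫ (α_ _ _ _).hom ≫ a ◁ ψ ≫ (α_ _ _ _).inv =
      (ρ_ m).hom ≫ (λ_ m).inv ≫ e.inv ▷ m := by
  rw [← cancel_epi (m ◁ e'.hom), ← cancel_mono (e.hom ▷ m)]
  simp only [Category.assoc, Bicategory.inv_hom_whiskerRight, Category.comp_id]
  rw [h, ← Category.assoc (m ◁ e'.hom), ← Bicategory.whiskerLeft_comp, e'.hom_inv_id,
    Bicategory.whiskerLeft_id, Category.id_comp]

/-- The cell `s` is followed around the swallowtail: `σ` replaces its trivial right factor by `u`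
and `y`, `τ` exchanges `u` for `u'`, and `σ'` removes the factor again. When `s` is a cancellable
counit, the composite is therefore the identity. -/
lemma carries_swallowtail_unit {p : A ⟶ B} {b b' : B ⟶ B'} {c : B' ⟶ B} {z : D}
    {s : Cell (D := D) p (proId z)} {u : Cell (D := D) b (proId z)}
    {u' : Cell (D := D) b' (proId z)} {y : Cell (D := D) c (proId z)} (σ : 𝟙 B ⟶ b ≫ c)
    (τ : p ≫ b ⟶ p ≫ b') (σ' : b' ≫ c ⟶ 𝟙 B) (hu : right s = left u) (hu' : right s = left u')
    (huy : right u = left y) (huy' : right u' = left y)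
    (hσ : Carries σ (idCell (right s)) (leftReduce u y huy))
    (hτ : Carries τ (leftReduce s u hu) (leftReduce s u' hu'))
    (hσ' : Carries σ' (leftReduce u' y huy') (idCell (right s))) :
    Carries ((ρ_ p).inv ≫ p ◁ σ ≫ (α_ _ _ _).inv ≫ τ ▷ c ≫ (α_ _ _ _).hom ≫ p ◁ σ' ≫
      (ρ_ p).hom) s s := by
  refine (Carries.rightUnitor s).symm.comp ?_
  refine ((Carries.whiskerLeft_leftReduce s hσ (by simp) (by simpa using hu)).congr
    (leftReduce_eq_rightReduce _ _ _) rfl).comp ?_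
  refine (Carries.associator_leftReduce_leftReduce s u y hu huy).symm.comp ?_
  refine (Carries.whiskerRight_leftReduce hτ y (by simpa using huy) (by simpa using huy')).comp ?_
  refine (Carries.associator_leftReduce_leftReduce s u' y hu' huy').comp ?_
  refine ((Carries.whiskerLeft_leftReduce s hσ' (by simpa using hu') (by simp)).congr
    rfl (leftReduce_eq_rightReduce _ _ _)).comp ?_
  exact Carries.rightUnitor s

lemma carries_swallowtail_counit {q : A ⟶ B} {c c' : A' ⟶ A} {b : A ⟶ A'} {z : D}
    {s : Cell (D := D) q (proId z)} {u : Cell (D := D) b (proId z)}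
    {y : Cell (D := D) c (proId z)} {y' : Cell (D := D) c' (proId z)} (σ : 𝟙 A ⟶ b ≫ c)
    (τ : c ≫ q ⟶ c' ≫ q) (σ' : b ≫ c' ⟶ 𝟙 A) (hy : right y = left s) (hy' : right y' = left s)
    (huy : right u = left y) (huy' : right u = left y')
    (hσ : Carries σ (idCell (left s)) (leftReduce u y huy))
    (hτ : Carries τ (leftReduce y s hy) (leftReduce y' s hy'))
    (hσ' : Carries σ' (leftReduce u y' huy') (idCell (left s))) :
    Carries ((λ_ q).inv ≫ σ ▷ q ≫ (α_ _ _ _).hom ≫ b ◁ τ ≫ (α_ _ _ _).inv ≫ σ' ▷ q ≫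
      (λ_ q).hom) s s := by
  refine (Carries.leftUnitor s).symm.comp ?_
  refine (Carries.whiskerRight_leftReduce hσ s (by simp) (by simpa using hy)).comp ?_
  refine (Carries.associator_leftReduce_leftReduce u y s huy hy).comp ?_
  refine (Carries.whiskerLeft_leftReduce u hτ (by simpa using huy) (by simpa using huy')).comp ?_
  refine (Carries.associator_leftReduce_leftReduce u y' s huy' hy').symm.comp ?_
  refine (Carries.whiskerRight_leftReduce hσ' s (by simpa using hy') (by simp)).comp ?_
  exact Carries.leftUnitor s

end

namespace StrongFiniteCoproducts

variable (S : StrongFiniteCoproducts D) {I : Type} [Finite I]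

/-! ### Coproducts of arrows, cells, companions and conjoints -/

/-- The coproduct of a family of arrows. -/
def sumHom {x y : I → D} (f : ∀ i, x i ⟶ y i) : S.sum x ⟶ S.sum y :=
  Cofan.IsColimit.desc (S.isColimit x) fun i => f i ≫ S.inj y i

@[simp]
lemma inj_sumHom {x y : I → D} (f : ∀ i, x i ⟶ y i) (i : I) :
    S.inj x i ≫ S.sumHom f = f i ≫ S.inj y i :=
  Cofan.IsColimit.fac (S.isColimit x) _ i

lemma sumHom_inj_codiag (x : I → D) : S.sumHom (S.inj x) ≫ S.codiag I (S.sum x) = 𝟙 _ :=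
  S.sum_hom_ext fun i => by
    rw [← Category.assoc, inj_sumHom, Category.assoc, inj_codiag]

/-- Naturality of `∇` at the arrow `∇`, giving the two descriptions of the boundary of
`codiagCompanionCounit` and `codiagConjointCounit`. -/
lemma sumHom_codiag_codiag (z : D) :
    S.sumHom (fun _ : I => S.codiag I z) ≫ S.codiag I z =
      S.codiag I (S.sum fun _ : I => z) ≫ S.codiag I z :=
  S.sum_hom_ext fun i => by
    rw [← Category.assoc, inj_sumHom, ← Category.assoc, Category.assoc (S.codiag I z), inj_codiag,
      inj_codiag, Category.comp_id, Category.id_comp]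

lemma sumPro_proId_hom_ext {x : I → D} {z w : D} {n : Pro z w} {ψ ψ' : Cell (proId (S.sum x)) n}
    (hl : left ψ = left ψ') (hr : right ψ = right ψ')
    (h : ∀ i, cellComp (idCell (S.inj x i)) ψ = cellComp (idCell (S.inj x i)) ψ') : ψ = ψ' :=
  (S.isSpanCoproduct_id x).ext hl hr (by rintro i _ ⟨rfl⟩; exact h i)

/-- The cell from the identity of a coproduct determined by a family of cells. -/
lemma exists_cell_proId {x : I → D} {z w : D} {n : Pro z w} (f : S.sum x ⟶ z) (g : S.sum x ⟶ w)
    (φ : ∀ i, Cell (proId (x i)) n) (hl : ∀ i, left (φ i) = S.inj x i ≫ f)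
    (hr : ∀ i, right (φ i) = S.inj x i ≫ g) :
    ∃ ψ : Cell (proId (S.sum x)) n, left ψ = f ∧ right ψ = g ∧
      ∀ i, cellComp (idCell (S.inj x i)) ψ = φ i :=
  (existsUnique_of_isSpanCoproduct (S.isSpanCoproduct_id x) n f g φ hl hr).exists

/-- The counit of the coproduct of a family of companions. -/
lemma exists_sumCompanion {x y : I → D} {f : ∀ i, x i ⟶ y i} {p : ∀ i, Pro (x i) (y i)}
    (c : ∀ i, CompanionData (f i) (p i)) :
    ∃ e : CompanionData (S.sumHom f) (S.sumPro p), ∀ i,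
      cellComp (S.inclPro p i) e.counit = cellComp (c i).counit (idCell (S.inj y i)) := by
  -- The units glue because the identity of a coproduct is the coproduct of identities; both
  -- companion equations can then be checked on coprojections.
  obtain ⟨η, hηl, hηr, hη⟩ := S.exists_cell_proId (𝟙 _) (S.sumHom f)
    (fun i => cellComp (c i).unit (S.inclPro p i)) (by simp) (by simp)
  have hr : right η = left (S.descPro (m := p) (S.sumHom f) (𝟙 _)
    (fun i => cellComp (c i).counit (idCell (S.inj y i))) (by simp) (by simp)) := by simp [hηr]
  refine ⟨⟨η, S.descPro (S.sumHom f) (𝟙 _) (fun i => cellComp (c i).counit (idCell (S.inj y i)))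
    (by simp) (by simp), hηl, hηr, by simp, by simp, ?_, ?_⟩, fun i => by simp⟩
  · refine S.sumPro_proId_hom_ext (by simp [hηl]) (by simp [hηr]) fun i => ?_
    rw [← cellComp_assoc, hη, cellComp_assoc, inclPro_descPro, ← cellComp_assoc,
      (c i).unit_counit, ← idCell_comp, ← idCell_comp, inj_sumHom]
  · refine S.sumPro_hom_ext (by simp [hηl]) (by simp) fun i => ?_
    change cellComp _ (cellComp _ (rightReduce η _ hr)) = _
    rw [← cellComp_assoc, ← leftUnitorInv_naturality, cellComp_assoc, hcomp_rightReduce,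
      rightReduce_congr (a' := cellComp (c i).unit (S.inclPro p i))
        (b' := cellComp (c i).counit (idCell (right (S.inclPro p i)))) _ ?_ ?_,
      ← rightReduce_cellComp (c i).unit (c i).counit (by simp) (S.inclPro p i), ← cellComp_assoc,
      (c i).leftUnitorInv_rightReduce, id_cellComp, cellComp_id]
    · rw [left_inclPro, hη]
    · rw [inclPro_descPro, right_inclPro]

lemma exists_sumConjoint {x y : I → D} {f : ∀ i, x i ⟶ y i} {p : ∀ i, Pro (y i) (x i)}
    (c : ∀ i, ConjointData (f i) (p i)) :
    ∃ e : ConjointData (S.sumHom f) (S.sumPro p), ∀ i,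
      cellComp (S.inclPro p i) e.counit = cellComp (c i).counit (idCell (S.inj y i)) := by
  obtain ⟨η, hηl, hηr, hη⟩ := S.exists_cell_proId (S.sumHom f) (𝟙 _)
    (fun i => cellComp (c i).unit (S.inclPro p i)) (by simp) (by simp)
  have hr : right (S.descPro (m := p) (𝟙 _) (S.sumHom f)
    (fun i => cellComp (c i).counit (idCell (S.inj y i))) (by simp) (by simp)) = left η := by
    simp [hηl]
  refine ⟨⟨η, S.descPro (𝟙 _) (S.sumHom f) (fun i => cellComp (c i).counit (idCell (S.inj y i)))
    (by simp) (by simp), hηl, hηr, by simp, by simp, ?_, ?_⟩, fun i => by simp⟩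
  · refine S.sumPro_proId_hom_ext (by simp [hηl]) (by simp [hηr]) fun i => ?_
    rw [← cellComp_assoc, hη, cellComp_assoc, inclPro_descPro, ← cellComp_assoc,
      (c i).unit_counit, ← idCell_comp, ← idCell_comp, inj_sumHom]
  · refine S.sumPro_hom_ext (by simp) (by simp [hηr]) fun i => ?_
    change cellComp _ (cellComp _ (leftReduce _ η hr)) = _
    rw [← cellComp_assoc, ← rightUnitorInv_naturality, cellComp_assoc, hcomp_leftReduce,
      leftReduce_congr (b' := cellComp (c i).unit (S.inclPro p i))
        (a' := cellComp (c i).counit (idCell (left (S.inclPro p i)))) _ ?_ ?_,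
      ← leftReduce_cellComp (c i).counit (c i).unit (by simp) (S.inclPro p i), ← cellComp_assoc,
      (c i).rightUnitorInv_leftReduce, id_cellComp, cellComp_id]
    · rw [inclPro_descPro, left_inclPro]
    · rw [right_inclPro, hη]

/-- The coproduct of a family of companions. -/
noncomputable def sumCompanion {x y : I → D} {f : ∀ i, x i ⟶ y i} {p : ∀ i, Pro (x i) (y i)}
    (c : ∀ i, CompanionData (f i) (p i)) : CompanionData (S.sumHom f) (S.sumPro p) :=
  (S.exists_sumCompanion c).choose

lemma inclPro_sumCompanion_counit {x y : I → D} {f : ∀ i, x i ⟶ y i} {p : ∀ i, Pro (x i) (y i)}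
    (c : ∀ i, CompanionData (f i) (p i)) (i : I) :
    cellComp (S.inclPro p i) (S.sumCompanion c).counit =
      cellComp (c i).counit (idCell (S.inj y i)) :=
  (S.exists_sumCompanion c).choose_spec i

/-- The coproduct of a family of conjoints. -/
noncomputable def sumConjoint {x y : I → D} {f : ∀ i, x i ⟶ y i} {p : ∀ i, Pro (y i) (x i)}
    (c : ∀ i, ConjointData (f i) (p i)) : ConjointData (S.sumHom f) (S.sumPro p) :=
  (S.exists_sumConjoint c).choose

lemma inclPro_sumConjoint_counit {x y : I → D} {f : ∀ i, x i ⟶ y i} {p : ∀ i, Pro (y i) (x i)}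
    (c : ∀ i, ConjointData (f i) (p i)) (i : I) :
    cellComp (S.inclPro p i) (S.sumConjoint c).counit =
      cellComp (c i).counit (idCell (S.inj y i)) :=
  (S.exists_sumConjoint c).choose_spec i

/-- The comparisons `κ` and `κ'` are kept general so that composition and unit comparisons of `⊕`
are handled together. -/
lemma sumMap_cellComp {x y : I → D} {m m' : ∀ i, Pro (x i) (y i)}
    (θ : ∀ i, Globular (m i) (m' i)) {k k' : Pro (S.sum x) (S.sum y)}
    (κ : Globular (S.sumPro m) k) (κ' : Globular (S.sumPro m') k') {j : ∀ i, Cell (m i) k}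
    {j' : ∀ i, Cell (m' i) k'} (hj : ∀ i, cellComp (S.inclPro m i) κ.cell = j i)
    (hj' : ∀ i, cellComp (S.inclPro m' i) κ'.cell = j' i) {z w : D} {n : Pro z w}
    {π : Cell k n} {π' : Cell k' n} (hl : left π = left π') (hr : right π = right π')
    (h : ∀ i, cellComp (j i) π = cellComp (θ i).cell (cellComp (j' i) π')) :
    cellComp (S.sumMap θ).cell (cellComp κ'.cell π') = cellComp κ.cell π := by
  refine S.sumPro_hom_ext (by simp [hl]) (by simp [hr]) fun i => ?_
  rw [← cellComp_assoc _ κ.cell, hj, h, ← cellComp_assoc, inclPro_sumMap, cellComp_assoc, ← hj',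
    cellComp_assoc]

/-- Reductions along a 2-cell induced by a family of 2-cells can be checked on coprojections. -/
lemma carries_directSum {x y : I → Loose D} {m m' : x ⟶ y} (θ : m ⟶ m')
    {k k' : (S.directSum I).obj x ⟶ (S.directSum I).obj y} (κ : (S.directSum I).map m ≅ k)
    (κ' : (S.directSum I).map m' ≅ k') {j : ∀ i, Cell (D := D) (m i) k}
    {j' : ∀ i, Cell (D := D) (m' i) k'}
    (hj : ∀ i, cellComp (S.inclPro (D := D) m i) κ.hom.cell = j i)
    (hj' : ∀ i, cellComp (S.inclPro (D := D) m' i) κ'.hom.cell = j' i) {z w : D} {n : Pro z w}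
    {π : Cell (D := D) k n} {π' : Cell (D := D) k' n} (hl : left π = left π')
    (hr : right π = right π')
    (h : ∀ i, cellComp (j i) π = cellComp (θ i).cell (cellComp (j' i) π')) :
    Carries (κ.inv ≫ (S.directSum I).map₂ θ ≫ κ'.hom) π π' := by
  refine Carries.comp (π' := cellComp κ.hom.cell π) (Carries.symm rfl) ?_
  exact (cellComp_assoc _ _ _).trans
    (S.sumMap_cellComp (D := D) θ κ.hom κ'.hom hj hj' hl hr h)

end StrongFiniteCoproducts

end DoubleCategory

namespace DoubleCategory

variable {D : Type u} [DoubleCategory.{t, w, v} D]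

/-- `carries_slide` composed with a further cell `β`. The results are abstracted as `γ`, `x` and `y`
so that simplified forms can be supplied directly. -/
lemma CompanionData.carries_slide_post {X Y X' Y' : Loose D} {f : X.obj ⟶ X'.obj}
    {g : Y.obj ⟶ Y'.obj} {p : X ⟶ X'} {q : Y ⟶ Y'} (c : CompanionData f p)
    (d : CompanionData g q) {m : X ⟶ Y} {n : X' ⟶ Y'} {α : Cell (D := D) m n} (hl : left α = f)
    (hr : right α = g) {z w : D} {k : Pro z w} (β : Cell (D := D) n k) {γ : Cell (D := D) m k}
    (hγ : cellComp α β = γ) {x : Cell (D := D) p (proId z)} {y : Cell (D := D) q (proId w)}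
    (hx : cellComp c.counit (idCell (left β)) = x) (hy : cellComp d.counit (idCell (right β)) = y) :
    Carries (c.slide d α hl hr) (rightReduce γ y (by simp [← hγ, ← hy, hr]))
      (leftReduce x β (by simp [← hx])) := by
  subst hγ hx hy
  exact ((c.carries_slide d α hl hr).post β).congr (rightReduce_cellComp _ _ _ _)
    ((leftReduce_cellComp _ _ _ _).trans (leftReduce_congr _ rfl (id_cellComp _)))

lemma ConjointData.carries_slide_post {X Y X' Y' : Loose D} {f : X.obj ⟶ X'.obj}
    {g : Y.obj ⟶ Y'.obj} {p : X' ⟶ X} {q : Y' ⟶ Y} (c : ConjointData f p)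
    (d : ConjointData g q) {m : X ⟶ Y} {n : X' ⟶ Y'} {α : Cell (D := D) m n} (hl : left α = f)
    (hr : right α = g) {z w : D} {k : Pro z w} (β : Cell (D := D) n k) {γ : Cell (D := D) m k}
    (hγ : cellComp α β = γ) {x : Cell (D := D) p (proId z)} {y : Cell (D := D) q (proId w)}
    (hx : cellComp c.counit (idCell (left β)) = x) (hy : cellComp d.counit (idCell (right β)) = y) :
    Carries (c.slide d α hl hr) (leftReduce x γ (by simp [← hγ, ← hx, hl]))
      (rightReduce β y (by simp [← hy])) := by
  subst hγ hx hy
  exact ((c.carries_slide d α hl hr).post β).congr (leftReduce_cellComp _ _ _ _)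
    ((rightReduce_cellComp _ _ _ _).trans (rightReduce_congr _ (id_cellComp _) rfl))

lemma CompanionData.right_counit_idCell {x y z : D} {f : x ⟶ y} {p : Pro x y}
    (c : CompanionData f p) (g : y ⟶ z) : right (cellComp c.counit (idCell g)) = g := by simp

lemma CompanionData.left_counit_idCell {x y z : D} {f : x ⟶ y} {p : Pro x y}
    (c : CompanionData f p) (g : y ⟶ z) : left (cellComp c.counit (idCell g)) = f ≫ g := by simp

lemma ConjointData.right_counit_idCell {x y z : D} {f : x ⟶ y} {p : Pro y x}
    (c : ConjointData f p) (g : y ⟶ z) : right (cellComp c.counit (idCell g)) = f ≫ g := by simp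

lemma ConjointData.left_counit_idCell {x y z : D} {f : x ⟶ y} {p : Pro y x}
    (c : ConjointData f p) (g : y ⟶ z) : left (cellComp c.counit (idCell g)) = g := by simp

/-! ### The biadjunction given by companions -/

namespace StrongFiniteCoproducts

variable (S : StrongFiniteCoproducts D) {I : Type} [Finite I]

lemma idCell_inj_codiag (z : D) (i : I) :
    cellComp (idCell (S.inj (fun _ : I => z) i)) (idCell (S.codiag I z)) = cellId (proId z) := by
  rw [← idCell_comp, inj_codiag, idCell_id]

section

variable {x : I → D} {p : ∀ i, Pro (x i) (S.sum x)} (c : ∀ i, CompanionData (S.inj x i) (p i))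

/-- The counit of the coproduct of the companions of coprojections, followed by the codiagonal. -/
noncomputable def injCompanionCounit : Cell (S.sumPro p) (proId (S.sum x)) :=
  cellComp (S.sumCompanion c).counit (idCell (S.codiag I (S.sum x)))

@[simp]
lemma left_injCompanionCounit : left (S.injCompanionCounit c) = 𝟙 (S.sum x) := by
  simp [injCompanionCounit, sumHom_inj_codiag]

@[simp]
lemma right_injCompanionCounit : right (S.injCompanionCounit c) = S.codiag I (S.sum x) := by
  simp [injCompanionCounit]

@[simp]
lemma inclPro_injCompanionCounit (i : I) :
    cellComp (S.inclPro p i) (S.injCompanionCounit c) = (c i).counit := by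
  rw [injCompanionCounit, ← cellComp_assoc, inclPro_sumCompanion_counit, cellComp_assoc,
    ← idCell_comp, inj_codiag, idCell_id, cellComp_id]

end

section

variable {z : D} {q : Pro (S.sum fun _ : I => z) z} (d : CompanionData (S.codiag I z) q)

/-- The counit of the coproduct of companions of codiagonals, followed by the codiagonal. -/
noncomputable def codiagCompanionCounit : Cell (S.sumPro fun _ : I => q) (proId z) :=
  cellComp (S.sumCompanion fun _ : I => d).counit (idCell (S.codiag I z))

@[simp]
lemma left_codiagCompanionCounit :
    left (S.codiagCompanionCounit d) = S.codiag I (S.sum fun _ : I => z) ≫ S.codiag I z := by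
  simp [codiagCompanionCounit, sumHom_codiag_codiag]

@[simp]
lemma right_codiagCompanionCounit : right (S.codiagCompanionCounit d) = S.codiag I z := by
  simp [codiagCompanionCounit]

@[simp]
lemma inclPro_codiagCompanionCounit (i : I) :
    cellComp (S.inclPro (fun _ : I => q) i) (S.codiagCompanionCounit d) = d.counit := by
  rw [codiagCompanionCounit, ← cellComp_assoc, inclPro_sumCompanion_counit, cellComp_assoc,
    ← idCell_comp, inj_codiag, idCell_id, cellComp_id]

lemma codiagPro_counit_companion :
    cellComp (S.codiagPro I q) d.counit = S.codiagCompanionCounit d :=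
  S.sumPro_hom_ext (by simp [left_codiagPro]) (by simp [right_codiagPro]) fun i => by
    rw [← cellComp_assoc, inclPro_codiagPro, id_cellComp, inclPro_codiagCompanionCounit]

end

section Companions

variable {S} {p : ∀ (x : I → Loose D) (i : I), x i ⟶ (S.directSum I).obj x}
  (c : ∀ (x : I → Loose D) (i : I), CompanionData (S.inj (fun i => (x i).obj) i) (p x i))
  (hc : ∀ {x y : I → Loose D} (m : x ⟶ y) (i : I),
    IsIso ((c x i).slide (c y i) (S.inclPro (D := D) m i) (S.left_inclPro (D := D) m i)
      (S.right_inclPro (D := D) m i)))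
  {q : ∀ z : Loose D, (S.directSum I).obj (fun _ => z) ⟶ z}
  (d : ∀ z : Loose D, CompanionData (S.codiag I z.obj) (q z))
  (hd : ∀ {z z' : Loose D} (n : z ⟶ z'),
    IsIso (CompanionData.slide (p := q z) (q := q z') (d z) (d z')
      (S.codiagPro (D := D) I n) (S.left_codiagPro (D := D) I n) (S.right_codiagPro (D := D) I n)))

/-- The companion of `Σ ι ≫ ∇ = 1`. -/
noncomputable def companionTriangleLeft (x : I → Loose D) :
    (S.directSum I).map (p x) ≫ q ((S.directSum I).obj x) ≅ 𝟙 ((S.directSum I).obj x) :=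
  CompanionData.isoId (p := (S.directSum I).map (p x) ≫ q ((S.directSum I).obj x))
    ((S.sumCompanion (D := D) (c x)).comp (d ((S.directSum I).obj x))) (S.sumHom_inj_codiag _)

/-- The companion of `ι ≫ ∇ = 1`. -/
noncomputable def companionTriangleRight (z : Loose D) (i : I) :
    p (fun _ => z) i ≫ q z ≅ 𝟙 z :=
  CompanionData.isoId (p := p (fun _ => z) i ≫ q z) ((c (fun _ => z) i).comp (d z))
    (S.inj_codiag _ _)

/-- True by construction: the triangle isomorphism is the counit of a composite companion, which is
defined as exactly this reduction. -/
lemma carries_companionTriangleLeft (x : I → Loose D) :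
    Carries (companionTriangleLeft c d x).hom
      (leftReduce (S.injCompanionCounit (D := D) (c x)) (d ((S.directSum I).obj x)).counit
        ((S.right_injCompanionCounit (D := D) (c x)).trans
          (d ((S.directSum I).obj x)).left_counit.symm))
      (cellId (proId ((S.directSum I).obj x).obj)) :=
  Carries.cell _

lemma carries_companionTriangleRight (z : Loose D) (i : I) :
    Carries (companionTriangleRight c d z i).hom
      (leftReduce (cellComp (c (fun _ => z) i).counit (idCell (S.codiag I z.obj))) (d z).counit
        (((c _ i).right_counit_idCell _).trans (d z).left_counit.symm)) (cellId (proId z.obj)) :=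
  Carries.cell _

/-- On the `i`-th coprojection the codiagonal disappears and the claim is `carries_slide` for the
component of `ι i` at `m`. -/
lemma carries_directSum_injCompanion {x y : I → Loose D} (m : x ⟶ y) :
    Carries (((S.directSum I).mapComp m (p y)).inv ≫
        (S.directSum I).map₂ ((S.injCompanionTrans c hc).naturality m).hom ≫
          ((S.directSum I).mapComp (p x) (fun _ => (S.directSum I).map m)).hom)
      (rightReduce (cellId (S.sumPro (D := D) m)) (S.injCompanionCounit (D := D) (c y))
        ((right_cellId _).trans (S.left_injCompanionCounit (D := D) (c y)).symm))
      (leftReduce (S.injCompanionCounit (D := D) (c x)) (S.codiagPro I (S.sumPro (D := D) m))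
        ((S.right_injCompanionCounit (D := D) (c x)).trans (S.left_codiagPro I _).symm)) := by
  refine S.carries_directSum _ _ _ (S.inclPro_directSum_mapComp m (p y))
    (S.inclPro_directSum_mapComp (p x) fun _ => (S.directSum I).map m)
    ((left_rightReduce _ _ _).trans ((left_cellId _).trans
      ((S.left_injCompanionCounit (D := D) (c x)).symm.trans (left_leftReduce _ _ _).symm)))
    ((right_rightReduce _ _ _).trans ((S.right_injCompanionCounit (D := D) (c y)).trans
      ((S.right_codiagPro I _).symm.trans (right_leftReduce _ _ _).symm))) fun i => ?_
  refine (hcomp_rightReduce _ _ _ _ _ _).trans ?_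
  refine Eq.trans ?_ (congrArg (cellComp _) (hcomp_leftReduce _ _ _ _ _ _)).symm
  refine Eq.trans (rightReduce_congr _ (cellComp_id _) (S.inclPro_injCompanionCounit _ i)) ?_
  refine Eq.trans ?_ (congrArg (cellComp _)
    (leftReduce_congr _ (S.inclPro_injCompanionCounit _ i) (S.inclPro_codiagPro _ i))).symm
  exact Eq.symm ((c x i).carries_slide (c y i) (S.inclPro (D := D) m i) _ _)

end Companions

end StrongFiniteCoproducts

end DoubleCategory

namespace DoubleCategory

lemma Carries.id_comp_comp_id {D : Type u} [DoubleCategory.{t, w, v} D] {X Y : Loose D}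
    {m n : X ⟶ Y} {θ : m ⟶ n} {x' y' : D} {k : Pro x' y'} {π : Cell (D := D) m k}
    {π' : Cell (D := D) n k} (h : Carries θ π π') : Carries (𝟙 m ≫ θ ≫ 𝟙 n) π π' := by
  rwa [Category.id_comp, Category.comp_id]

namespace StrongFiniteCoproducts

variable {D : Type u} [DoubleCategory.{t, w, v} D] {S : StrongFiniteCoproducts D} {I : Type}
  [Finite I] {p : ∀ (x : I → Loose D) (i : I), x i ⟶ (S.directSum I).obj x}
  (c : ∀ (x : I → Loose D) (i : I), CompanionData (S.inj (fun i => (x i).obj) i) (p x i))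
  (hc : ∀ {x y : I → Loose D} (m : x ⟶ y) (i : I),
    IsIso ((c x i).slide (c y i) (S.inclPro (D := D) m i) (S.left_inclPro (D := D) m i)
      (S.right_inclPro (D := D) m i)))
  {q : ∀ z : Loose D, (S.directSum I).obj (fun _ => z) ⟶ z}
  (d : ∀ z : Loose D, CompanionData (S.codiag I z.obj) (q z))
  (hd : ∀ {z z' : Loose D} (n : z ⟶ z'),
    IsIso (CompanionData.slide (p := q z) (q := q z') (d z) (d z')
      (S.codiagPro (D := D) I n) (S.left_codiagPro (D := D) I n) (S.right_codiagPro (D := D) I n)))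

lemma companionTriangleLeft_naturality {x y : I → Loose D} (m : x ⟶ y) :
    (S.directSum I).map m ◁ (companionTriangleLeft c d y).hom ≫ (ρ_ _).hom ≫ (λ_ _).inv =
      (α_ _ _ _).inv ≫ (((S.directSum I).mapComp m (p y)).inv ≫
        (S.directSum I).map₂ ((S.injCompanionTrans c hc).naturality m).hom ≫
          ((S.directSum I).mapComp (p x) (fun _ => (S.directSum I).map m)).hom) ▷
            q ((S.directSum I).obj y) ≫ (α_ _ _ _).hom ≫ (S.directSum I).map (p x) ◁
        ((S.codiagCompanionTrans d hd).naturality ((S.directSum I).map m)).hom ≫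
          (α_ _ _ _).inv ≫ (companionTriangleLeft c d x).hom ▷ (S.directSum I).map m :=
  retraction_naturality _ _ (companionTriangleLeft c d x) (companionTriangleLeft c d y) _ _ _ _
    ((S.right_codiagPro (D := D) I _).trans (d ((S.directSum I).obj y)).left_counit.symm)
    ((d ((S.directSum I).obj x)).right_counit.trans (left_cellId _).symm)
    (carries_directSum_injCompanion c hc m) (CompanionData.carries_slide _ _ _ _ _)
    (carries_companionTriangleLeft c d x) (carries_companionTriangleLeft c d y)

lemma companionTriangleRight_naturality {z z' : Loose D} (g : z ⟶ z') (i : I) :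
    g ◁ (companionTriangleRight c d z' i).hom ≫ (ρ_ _).hom ≫ (λ_ _).inv =
      (α_ _ _ _).inv ≫ ((S.injCompanionTrans c hc).naturality fun _ => g).hom i ▷ q z' ≫
        (α_ _ _ _).hom ≫ p (fun _ => z) i ◁
          (𝟙 _ ≫ ((S.codiagCompanionTrans d hd).naturality g).hom ≫ 𝟙 _) ≫
          (α_ _ _ _).inv ≫ (companionTriangleRight c d z i).hom ▷ g := by
  refine retraction_naturality _ _ (companionTriangleRight c d z i)
    (companionTriangleRight c d z' i) _ _ _ _
    ((S.right_codiagPro (D := D) I _).trans (d z').left_counit.symm)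
    ((d z).right_counit.trans (left_cellId _).symm)
    (CompanionData.carries_slide_post (c (fun _ => z) i) (c (fun _ => z') i) _ _
      (S.codiagPro (D := D) I g) (S.inclPro_codiagPro (D := D) g i) ?_ ?_)
    (Carries.id_comp_comp_id (CompanionData.carries_slide (p := q z) (q := q z') (d z)
      (d z') (S.codiagPro (D := D) I g) (S.left_codiagPro (D := D) I g)
      (S.right_codiagPro (D := D) I g)))
    (carries_companionTriangleRight c d z i) (carries_companionTriangleRight c d z' i)
  · exact congrArg (fun f => cellComp _ (idCell f)) (S.left_codiagPro (D := D) I g)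
  · exact congrArg (fun f => cellComp _ (idCell f)) (S.right_codiagPro (D := D) I g)

lemma companion_swallowtail_unit (x : I → Loose D) (i : I) :
    (ρ_ (p x i)).inv ≫ p x i ◁ (𝟙 _ ≫ (companionTriangleLeft c d x).inv ≫ 𝟙 _) ≫ (α_ _ _ _).inv ≫
      ((S.injCompanionTrans c hc).naturality (p x)).inv i ▷ q ((S.directSum I).obj x) ≫
      (α_ _ _ _).hom ≫
      p x i ◁ (companionTriangleRight c d ((S.directSum I).obj x) i).hom ≫ (ρ_ (p x i)).hom =
        𝟙 (p x i) := by
  have hs : left (cellComp (c (fun _ => (S.directSum I).obj x) i).counit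
      (idCell (S.codiag I ((S.directSum I).obj x).obj))) = 𝟙 _ :=
    ((c _ i).left_counit_idCell _).trans (S.inj_codiag _ i)
  have h1 : idCell (right (c x i).counit) = cellId (proId ((S.directSum I).obj x).obj) :=
    (congrArg idCell (c x i).right_counit).trans (idCell_id _)
  have h2 : cellComp (c x i).counit (idCell (left (S.injCompanionCounit (D := D) (c x)))) =
      (c x i).counit :=
    (congrArg (fun f => cellComp (c x i).counit (idCell f))
      (S.left_injCompanionCounit (D := D) (c x))).trans
      ((congrArg (cellComp _) (idCell_id _)).trans (cellComp_id _))
  -- The middle cell of the swallowtail is the structure cell of `ι` at its own companion `p x`;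
  -- following it by `injCompanionCounit` turns the coprojection of `p x` into the counit of `p x
  -- i`.
  have hτ := CompanionData.carries_slide_post (c x i) (c (fun _ => (S.directSum I).obj x) i)
    (S.left_inclPro (D := D) (p x) i) (S.right_inclPro (D := D) (p x) i)
    (S.injCompanionCounit (D := D) (c x)) (S.inclPro_injCompanionCounit (D := D) (c x) i) h2
    (congrArg (fun f => cellComp _ (idCell f)) (S.right_injCompanionCounit (D := D) (c x)))
  refine Globular.ext ((c x i).cancel_counit ?_ (Eq.trans ?_ (id_cellComp _).symm))
  · exact (Globular.left_eq _).trans (Globular.left_eq _).symm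
  exact carries_swallowtail_unit (s := (c x i).counit) (u := S.injCompanionCounit (D := D) (c x))
    (u' := cellComp (c (fun _ => (S.directSum I).obj x) i).counit (idCell (S.codiag I _)))
    (y := (d ((S.directSum I).obj x)).counit) _ _ _
    ((c x i).right_counit.trans (S.left_injCompanionCounit (D := D) (c x)).symm)
    ((c x i).right_counit.trans hs.symm)
    ((S.right_injCompanionCounit (D := D) (c x)).trans (d ((S.directSum I).obj x)).left_counit.symm)
    (((c _ i).right_counit_idCell _).trans (d ((S.directSum I).obj x)).left_counit.symm)
    (Carries.id_comp_comp_id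
      ((Carries.symm (carries_companionTriangleLeft c d x)).congr h1.symm rfl))
    ((Carries.symm (e := @asIso _ _ _ _ _ (hc (p x) i)) hτ).congr rfl
      (leftReduce_eq_rightReduce _ _ _).symm)
    ((carries_companionTriangleRight c d ((S.directSum I).obj x) i).congr rfl h1.symm)

lemma companion_swallowtail_counit (z : Loose D) :
    (λ_ (q z)).inv ≫ (companionTriangleLeft c d fun _ => z).inv ▷ q z ≫ (α_ _ _ _).hom ≫
      (S.directSum I).map (p fun _ => z) ◁ ((S.codiagCompanionTrans d hd).naturality (q z)).inv ≫
      (α_ _ _ _).inv ≫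
      (((S.directSum I).mapComp (p fun _ => z) fun _ => q z).inv ≫
        (S.directSum I).map₂ (powerIso fun i => companionTriangleRight c d z i).hom ≫
          ((S.directSum I).mapId fun _ => z).hom) ▷ q z ≫ (λ_ (q z)).hom = 𝟙 (q z) := by
  have hl := S.left_codiagCompanionCounit (D := D) (d z)
  have hr := S.right_codiagCompanionCounit (D := D) (d z)
  -- The triangle computation ends at the identity of `Σ z`; the extra codiagonal brings it down to
  -- `z`, where the counit tested against lives.
  have h1 := ((Carries.symm (carries_companionTriangleLeft c d fun _ => z)).post
    (idCell (S.codiag I z.obj))).congr (id_cellComp _) (leftReduce_cellComp _ _ _ _)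
  have h2 : cellComp (d z).counit (idCell (right (d z).counit)) = (d z).counit :=
    (congrArg (fun f => cellComp (d z).counit (idCell f)) (d z).right_counit).trans
      ((congrArg (cellComp _) (idCell_id _)).trans (cellComp_id _))
  have hτ := CompanionData.carries_slide_post (p := q ((S.directSum I).obj fun _ => z)) (q := q z)
    (d ((S.directSum I).obj fun _ => z)) (d z)
    (S.left_codiagPro (D := D) I (q z)) (S.right_codiagPro (D := D) I (q z))
    (d z).counit (S.codiagPro_counit_companion (D := D) (d z))
    (congrArg (fun f => cellComp _ (idCell f)) (d z).left_counit) h2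
  have hu : right (cellComp (S.injCompanionCounit (D := D) (c fun _ => z))
      (idCell (S.codiag I z.obj))) = S.codiag I _ ≫ S.codiag I z.obj :=
    (right_cellComp _ _).trans (congrArg₂ (· ≫ ·)
      (S.right_injCompanionCounit (D := D) (c fun _ => z)) (right_idCell _))
  have hu' : left (cellComp (S.injCompanionCounit (D := D) (c fun _ => z))
      (idCell (S.codiag I z.obj))) = S.codiag I z.obj :=
    (left_cellComp _ _).trans ((congrArg₂ (· ≫ ·)
      (S.left_injCompanionCounit (D := D) (c fun _ => z)) (left_idCell _)).trans
        (Category.id_comp _))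
  refine Globular.ext ((d z).cancel_counit ?_ (Eq.trans ?_ (id_cellComp _).symm))
  · exact (Globular.left_eq _).trans (Globular.left_eq _).symm
  refine carries_swallowtail_counit (s := (d z).counit)
    (u := cellComp (S.injCompanionCounit (D := D) (c fun _ => z)) (idCell (S.codiag I z.obj)))
    (y := cellComp (d ((S.directSum I).obj fun _ => z)).counit (idCell (S.codiag I z.obj)))
    (y' := S.codiagCompanionCounit (D := D) (d z)) _ _ _
    (((d _).right_counit_idCell _).trans (d z).left_counit.symm) (hr.trans (d z).left_counit.symm)
    (hu.trans ((d ((S.directSum I).obj fun _ => z)).left_counit_idCell _).symm) (hu.trans hl.symm)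
    ?_ ?_ ?_
  · refine h1.congr (congrArg idCell (d z).left_counit.symm) (leftReduce_congr _ ?_ rfl)
    exact congrArg (fun f => cellComp _ (idCell f)) (left_idCell _)
  · exact (Carries.symm (e := @asIso _ _ _ _ _ (hd (q z))) hτ).congr rfl
      (leftReduce_eq_rightReduce _ _ _).symm
  -- The image under `⊕` of the pointwise triangle isomorphisms is checked on coprojections, where
  -- it becomes `carries_companionTriangleRight`.
  · refine S.carries_directSum _ _ _ (S.inclPro_directSum_mapComp _ _)
      (S.inclPro_directSum_mapId _) ?_ ?_ fun i => ?_
    · exact (left_leftReduce _ _ _).trans (hu'.trans ((left_idCell _).trans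
        (d z).left_counit).symm)
    · exact (right_leftReduce _ _ _).trans (hr.trans ((right_idCell _).trans
        (d z).left_counit).symm)
    · refine (hcomp_leftReduce _ _ _ _ _ _).trans ((leftReduce_congr _
        ((cellComp_assoc _ _ _).symm.trans (congrArg (cellComp · _)
          (S.inclPro_injCompanionCounit (D := D) (c fun _ => z) i)))
        (S.inclPro_codiagCompanionCounit (D := D) (d z) i)).trans ?_)
      refine (Eq.symm (carries_companionTriangleRight c d z i)).trans (congrArg (cellComp _) ?_)
      refine Eq.trans ?_ (congrArg (fun f => cellComp _ (idCell f)) (d z).left_counit).symm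
      exact (S.idCell_inj_codiag z.obj i).symm

/-- The biadjunction `⊕ ⊣ Δ` given by companions of coprojections and codiagonals. -/
noncomputable def companionBiadjunction :
    Biadjunction (S.directSum I) (diagonal I (Loose D)) where
  unit := S.injCompanionTrans c hc
  counit := S.codiagCompanionTrans d hd
  triangulatorLeft x := (companionTriangleLeft c d x).symm
  triangulatorRight z := powerIso (companionTriangleRight c d z)
  triangulatorLeft_naturality m :=
    retraction_naturality_inv (companionTriangleLeft_naturality c hc d hd m)
  triangulatorRight_naturality g := funext (companionTriangleRight_naturality c hc d hd g)
  swallowtail_unit x := funext (companion_swallowtail_unit c hc d x)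
  swallowtail_counit z := companion_swallowtail_counit c d hd z

end StrongFiniteCoproducts

end DoubleCategory

/-! ### The biadjunction given by conjoints -/

namespace DoubleCategory.StrongFiniteCoproducts

variable {D : Type u} [DoubleCategory.{t, w, v} D]

section

variable (S : StrongFiniteCoproducts D) {I : Type} [Finite I]

section

variable {x : I → D} {p : ∀ i, Pro (S.sum x) (x i)} (c : ∀ i, ConjointData (S.inj x i) (p i))

/-- The counit of the coproduct of the conjoints of coprojections, followed by the codiagonal. -/
noncomputable def injConjointCounit : Cell (S.sumPro p) (proId (S.sum x)) :=
  cellComp (S.sumConjoint c).counit (idCell (S.codiag I (S.sum x)))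

@[simp]
lemma left_injConjointCounit : left (S.injConjointCounit c) = S.codiag I (S.sum x) := by
  simp [injConjointCounit]

@[simp]
lemma right_injConjointCounit : right (S.injConjointCounit c) = 𝟙 (S.sum x) := by
  simp [injConjointCounit, sumHom_inj_codiag]

@[simp]
lemma inclPro_injConjointCounit (i : I) :
    cellComp (S.inclPro p i) (S.injConjointCounit c) = (c i).counit := by
  rw [injConjointCounit, ← cellComp_assoc, inclPro_sumConjoint_counit, cellComp_assoc,
    idCell_inj_codiag, cellComp_id]

end

section

variable {z : D} {q : Pro z (S.sum fun _ : I => z)} (d : ConjointData (S.codiag I z) q)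

/-- The counit of the coproduct of conjoints of codiagonals, followed by the codiagonal. -/
noncomputable def codiagConjointCounit : Cell (S.sumPro fun _ : I => q) (proId z) :=
  cellComp (S.sumConjoint fun _ : I => d).counit (idCell (S.codiag I z))

@[simp]
lemma left_codiagConjointCounit : left (S.codiagConjointCounit d) = S.codiag I z := by
  simp [codiagConjointCounit]

@[simp]
lemma right_codiagConjointCounit :
    right (S.codiagConjointCounit d) = S.codiag I (S.sum fun _ : I => z) ≫ S.codiag I z := by
  simp [codiagConjointCounit, sumHom_codiag_codiag]

@[simp]
lemma inclPro_codiagConjointCounit (i : I) :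
    cellComp (S.inclPro (fun _ : I => q) i) (S.codiagConjointCounit d) = d.counit := by
  rw [codiagConjointCounit, ← cellComp_assoc, inclPro_sumConjoint_counit, cellComp_assoc,
    idCell_inj_codiag, cellComp_id]

lemma codiagPro_counit_conjoint :
    cellComp (S.codiagPro I q) d.counit = S.codiagConjointCounit d :=
  S.sumPro_hom_ext (by simp [left_codiagPro]) (by simp [right_codiagPro]) fun i => by
    rw [← cellComp_assoc, inclPro_codiagPro, id_cellComp, inclPro_codiagConjointCounit]

end

end

variable {S : StrongFiniteCoproducts D} {I : Type}
  [Finite I] {p : ∀ (x : I → Loose D) (i : I), (S.directSum I).obj x ⟶ x i}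
  (c : ∀ (x : I → Loose D) (i : I), ConjointData (S.inj (fun i => (x i).obj) i) (p x i))
  (hc : ∀ {x y : I → Loose D} (m : x ⟶ y) (i : I),
    IsIso ((c x i).slide (c y i) (S.inclPro (D := D) m i) (S.left_inclPro (D := D) m i)
      (S.right_inclPro (D := D) m i)))
  {q : ∀ z : Loose D, z ⟶ (S.directSum I).obj (fun _ => z)}
  (d : ∀ z : Loose D, ConjointData (S.codiag I z.obj) (q z))
  (hd : ∀ {z z' : Loose D} (n : z ⟶ z'),
    IsIso (ConjointData.slide (p := q z) (q := q z') (d z) (d z')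
      (S.codiagPro (D := D) I n) (S.left_codiagPro (D := D) I n) (S.right_codiagPro (D := D) I n)))

/-- The conjoint of `ι ≫ ∇ = 1`. -/
noncomputable def conjointTriangleLeft (z : Loose D) (i : I) : q z ≫ p (fun _ => z) i ≅ 𝟙 z :=
  ConjointData.isoId (p := q z ≫ p (fun _ => z) i) ((c (fun _ => z) i).comp (d z))
    (S.inj_codiag _ _)

/-- The conjoint of `Σ ι ≫ ∇ = 1`. -/
noncomputable def conjointTriangleRight (x : I → Loose D) :
    q ((S.directSum I).obj x) ≫ (S.directSum I).map (p x) ≅ 𝟙 ((S.directSum I).obj x) :=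
  ConjointData.isoId (p := q ((S.directSum I).obj x) ≫ (S.directSum I).map (p x))
    ((S.sumConjoint (D := D) (c x)).comp (d ((S.directSum I).obj x))) (S.sumHom_inj_codiag _)

/-- A composite conjoint has a right reduction as its counit; both factors land in identity
proarrows, so it is also the left reduction expected by the general lemmas. -/
lemma carries_conjointTriangleLeft (z : Loose D) (i : I) :
    Carries (conjointTriangleLeft c d z i).hom
      (leftReduce (d z).counit (cellComp (c (fun _ => z) i).counit (idCell (S.codiag I z.obj)))
        ((d z).right_counit.trans ((c _ i).left_counit_idCell _).symm)) (cellId (proId z.obj)) :=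
  (Carries.cell (conjointTriangleLeft c d z i).hom).congr (leftReduce_eq_rightReduce _ _ _).symm rfl

lemma carries_conjointTriangleRight (x : I → Loose D) :
    Carries (conjointTriangleRight c d x).hom
      (leftReduce (d ((S.directSum I).obj x)).counit (S.injConjointCounit (D := D) (c x))
        ((d ((S.directSum I).obj x)).right_counit.trans
          (S.left_injConjointCounit (D := D) (c x)).symm))
      (cellId (proId ((S.directSum I).obj x).obj)) :=
  (Carries.cell (conjointTriangleRight c d x).hom).congr (leftReduce_eq_rightReduce _ _ _).symm rfl

/-- Checked on coprojections as for companions, but with the inverse of the reshaped cell, since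
that is the structure cell here. -/
lemma carries_directSum_injConjoint {x y : I → Loose D} (m : x ⟶ y) :
    Carries (((S.directSum I).mapComp (fun _ => (S.directSum I).map m) (p y)).inv ≫
        (S.directSum I).map₂ ((S.injConjointTrans c hc).naturality m).hom ≫
          ((S.directSum I).mapComp (p x) m).hom)
      (rightReduce (S.codiagPro I (S.sumPro (D := D) m)) (S.injConjointCounit (D := D) (c y))
        ((S.right_codiagPro I _).trans (S.left_injConjointCounit (D := D) (c y)).symm))
      (leftReduce (S.injConjointCounit (D := D) (c x)) (cellId (S.sumPro (D := D) m))
        ((S.right_injConjointCounit (D := D) (c x)).trans (left_cellId _).symm)) := by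
  refine S.carries_directSum _ _ _
    (S.inclPro_directSum_mapComp (fun _ => (S.directSum I).map m) (p y))
    (S.inclPro_directSum_mapComp (p x) m)
    ((left_rightReduce _ _ _).trans ((S.left_codiagPro I _).trans
      ((S.left_injConjointCounit (D := D) (c x)).symm.trans (left_leftReduce _ _ _).symm)))
    ((right_rightReduce _ _ _).trans ((S.right_injConjointCounit (D := D) (c y)).trans
      ((right_cellId _).symm.trans (right_leftReduce _ _ _).symm))) fun i => ?_
  refine (hcomp_rightReduce _ _ _ _ _ _).trans ?_
  refine Eq.trans ?_ (congrArg (cellComp _) (hcomp_leftReduce _ _ _ _ _ _)).symm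
  refine Eq.trans (rightReduce_congr _ (S.inclPro_codiagPro _ i)
    (S.inclPro_injConjointCounit _ i)) ?_
  refine Eq.trans ?_ (congrArg (cellComp _)
    (leftReduce_congr _ (S.inclPro_injConjointCounit _ i) (cellComp_id _))).symm
  exact Eq.symm (Carries.symm (e := @asIso _ _ _ _ _ (hc m i))
    ((c x i).carries_slide (c y i) (S.inclPro (D := D) m i) _ _))

lemma conjointTriangleLeft_naturality {z z' : Loose D} (g : z ⟶ z') (i : I) :
    g ◁ (conjointTriangleLeft c d z' i).hom ≫ (ρ_ _).hom ≫ (λ_ _).inv =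
      (α_ _ _ _).inv ≫ (𝟙 _ ≫ ((S.codiagConjointTrans d hd).naturality g).hom ≫ 𝟙 _) ▷
          p (fun _ => z') i ≫
        (α_ _ _ _).hom ≫ q z ◁ ((S.injConjointTrans c hc).naturality fun _ => g).hom i ≫
          (α_ _ _ _).inv ≫ (conjointTriangleLeft c d z i).hom ▷ g := by
  refine retraction_naturality _ _ (conjointTriangleLeft c d z i)
    (conjointTriangleLeft c d z' i) _ _
    ((right_cellId _).trans (d z').left_counit.symm)
    ((d z).right_counit.trans (S.left_codiagPro (D := D) I g).symm)
    _ _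
    (Carries.id_comp_comp_id (Carries.symm (e := @asIso _ _ _ _ _ (hd g))
      (ConjointData.carries_slide (p := q z) (q := q z') (d z)
      (d z') (S.codiagPro (D := D) I g) (S.left_codiagPro (D := D) I g)
      (S.right_codiagPro (D := D) I g))))
    (Carries.symm (e := @asIso _ _ _ _ _ (hc (fun _ => g) i))
      (ConjointData.carries_slide_post (c (fun _ => z) i) (c (fun _ => z') i) _ _
      (S.codiagPro (D := D) I g) (S.inclPro_codiagPro (D := D) g i) ?_ ?_))
    (carries_conjointTriangleLeft c d z i) (carries_conjointTriangleLeft c d z' i)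
  · exact congrArg (fun f => cellComp _ (idCell f)) (S.left_codiagPro (D := D) I g)
  · exact congrArg (fun f => cellComp _ (idCell f)) (S.right_codiagPro (D := D) I g)

lemma conjointTriangleRight_naturality {x y : I → Loose D} (m : x ⟶ y) :
    (S.directSum I).map m ◁ (conjointTriangleRight c d y).hom ≫ (ρ_ _).hom ≫ (λ_ _).inv =
      (α_ _ _ _).inv ≫ ((S.codiagConjointTrans d hd).naturality ((S.directSum I).map m)).hom ▷
          (S.directSum I).map (p y) ≫ (α_ _ _ _).hom ≫
        q ((S.directSum I).obj x) ◁
          (((S.directSum I).mapComp (fun _ => (S.directSum I).map m) (p y)).inv ≫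
            (S.directSum I).map₂ ((S.injConjointTrans c hc).naturality m).hom ≫
              ((S.directSum I).mapComp (p x) m).hom) ≫
          (α_ _ _ _).inv ≫ (conjointTriangleRight c d x).hom ▷ (S.directSum I).map m :=
  retraction_naturality _ _ (conjointTriangleRight c d x) (conjointTriangleRight c d y) _ _
    ((right_cellId _).trans (d ((S.directSum I).obj y)).left_counit.symm)
    ((d ((S.directSum I).obj x)).right_counit.trans (S.left_codiagPro (D := D) I _).symm)
    _ _
    (Carries.symm (e := @asIso _ _ _ _ _ (hd ((S.directSum I).map m)))
      (ConjointData.carries_slide _ _ _ _ _))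
    (carries_directSum_injConjoint c hc m)
    (carries_conjointTriangleRight c d x) (carries_conjointTriangleRight c d y)

/-- Passing to conjoints exchanges unit and counit, so this mirrors the second companion
swallowtail: it is tested against the counit of the codiagonal's conjoint. -/
lemma conjoint_swallowtail_unit (z : Loose D) :
    (ρ_ (q z)).inv ≫ q z ◁ (((S.directSum I).mapId fun _ => z).inv ≫
        (S.directSum I).map₂ (powerIso fun i => conjointTriangleLeft c d z i).inv ≫
          ((S.directSum I).mapComp (fun _ => q z) (p fun _ => z)).hom) ≫ (α_ _ _ _).inv ≫
      ((S.codiagConjointTrans d hd).naturality (q z)).inv ▷ (S.directSum I).map (p fun _ => z) ≫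
      (α_ _ _ _).hom ≫ q z ◁ (conjointTriangleRight c d fun _ => z).hom ≫ (ρ_ (q z)).hom =
        𝟙 (q z) := by
  have hl := S.left_codiagConjointCounit (D := D) (d z)
  have hr := S.right_codiagConjointCounit (D := D) (d z)
  have h1 := ((carries_conjointTriangleRight c d fun _ => z).post
    (idCell (S.codiag I z.obj))).congr (leftReduce_cellComp _ _ _ _) (id_cellComp _)
  have h2 : cellComp (d z).counit (idCell (left (d z).counit)) = (d z).counit :=
    (congrArg (fun f => cellComp (d z).counit (idCell f)) (d z).left_counit).trans
      ((congrArg (cellComp _) (idCell_id _)).trans (cellComp_id _))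
  have hτ := ConjointData.carries_slide_post (p := q z) (q := q ((S.directSum I).obj fun _ => z))
    (d z) (d ((S.directSum I).obj fun _ => z))
    (S.left_codiagPro (D := D) I (q z)) (S.right_codiagPro (D := D) I (q z))
    (d z).counit (S.codiagPro_counit_conjoint (D := D) (d z)) h2
    (congrArg (fun f => cellComp _ (idCell f)) (d z).right_counit)
  have hy : left (cellComp (S.injConjointCounit (D := D) (c fun _ => z))
      (idCell (S.codiag I z.obj))) = S.codiag I _ ≫ S.codiag I z.obj :=
    (left_cellComp _ _).trans (congrArg₂ (· ≫ ·)
      (S.left_injConjointCounit (D := D) (c fun _ => z)) (left_idCell _))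
  have hy' : right (cellComp (S.injConjointCounit (D := D) (c fun _ => z))
      (idCell (S.codiag I z.obj))) = S.codiag I z.obj :=
    (right_cellComp _ _).trans ((congrArg₂ (· ≫ ·)
      (S.right_injConjointCounit (D := D) (c fun _ => z)) (right_idCell _)).trans
        (Category.id_comp _))
  refine Globular.ext ((d z).cancel_counit ?_ (Eq.trans ?_ (id_cellComp _).symm))
  · exact (Globular.right_eq _).trans (Globular.right_eq _).symm
  refine carries_swallowtail_unit (s := (d z).counit) (u := S.codiagConjointCounit (D := D) (d z))
    (u' := cellComp (d ((S.directSum I).obj fun _ => z)).counit (idCell (S.codiag I z.obj)))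
    (y := cellComp (S.injConjointCounit (D := D) (c fun _ => z)) (idCell (S.codiag I z.obj))) _ _ _
    ((d z).right_counit.trans hl.symm)
    ((d z).right_counit.trans
      ((d ((S.directSum I).obj fun _ => z)).left_counit_idCell _).symm)
    (hr.trans hy.symm)
    (((d ((S.directSum I).obj fun _ => z)).right_counit_idCell _).trans hy.symm)
    ?_ ?_ ?_
  · refine S.carries_directSum _ _ _ (S.inclPro_directSum_mapId _)
      (S.inclPro_directSum_mapComp _ _) ?_ ?_ fun i => ?_
    · exact ((left_idCell _).trans (d z).right_counit).trans (hl.symm.trans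
        (left_leftReduce _ _ _).symm)
    · exact ((right_idCell _).trans (d z).right_counit).trans (hy'.symm.trans
        (right_leftReduce _ _ _).symm)
    · refine Eq.trans ?_ (congrArg (cellComp _) ((hcomp_leftReduce _ _ _ _ _ _).trans
        (leftReduce_congr _ (S.inclPro_codiagConjointCounit (D := D) (d z) i)
          ((cellComp_assoc _ _ _).symm.trans (congrArg (cellComp · _)
          (S.inclPro_injConjointCounit (D := D) (c fun _ => z) i)))))).symm
      refine Eq.trans ?_ (Eq.symm (Carries.symm (carries_conjointTriangleLeft c d z i)))
      refine (congrArg (fun f => cellComp _ (idCell f)) (d z).right_counit).trans ?_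
      exact S.idCell_inj_codiag z.obj i
  · exact hτ.congr rfl (leftReduce_eq_rightReduce _ _ _).symm
  · refine h1.congr (leftReduce_congr _ ?_ rfl) (congrArg idCell (d z).right_counit.symm)
    exact congrArg (fun f => cellComp _ (idCell f)) (left_idCell _)

lemma conjoint_swallowtail_counit (x : I → Loose D) (i : I) :
    (λ_ (p x i)).inv ≫ (conjointTriangleLeft c d ((S.directSum I).obj x) i).inv ▷ p x i ≫
      (α_ _ _ _).hom ≫ q ((S.directSum I).obj x) ◁
        ((S.injConjointTrans c hc).naturality (p x)).inv i ≫ (α_ _ _ _).inv ≫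
      (𝟙 _ ≫ (conjointTriangleRight c d x).hom ≫ 𝟙 _) ▷ p x i ≫ (λ_ (p x i)).hom =
        𝟙 (p x i) := by
  have h1 : idCell (left (c x i).counit) = cellId (proId ((S.directSum I).obj x).obj) :=
    (congrArg idCell (c x i).left_counit).trans (idCell_id _)
  have hs : right (cellComp (c (fun _ => (S.directSum I).obj x) i).counit
      (idCell (S.codiag I ((S.directSum I).obj x).obj))) = 𝟙 _ :=
    ((c _ i).right_counit_idCell _).trans (S.inj_codiag _ i)
  have h2 : cellComp (c x i).counit (idCell (right (S.injConjointCounit (D := D) (c x)))) =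
      (c x i).counit :=
    (congrArg (fun f => cellComp (c x i).counit (idCell f))
      (S.right_injConjointCounit (D := D) (c x))).trans
      ((congrArg (cellComp _) (idCell_id _)).trans (cellComp_id _))
  have hτ := ConjointData.carries_slide_post (c (fun _ => (S.directSum I).obj x) i) (c x i)
    (S.left_inclPro (D := D) (p x) i) (S.right_inclPro (D := D) (p x) i)
    (S.injConjointCounit (D := D) (c x)) (S.inclPro_injConjointCounit (D := D) (c x) i)
    (congrArg (fun f => cellComp _ (idCell f)) (S.left_injConjointCounit (D := D) (c x))) h2
  refine Globular.ext ((c x i).cancel_counit ?_ (Eq.trans ?_ (id_cellComp _).symm))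
  · exact (Globular.right_eq _).trans (Globular.right_eq _).symm
  exact carries_swallowtail_counit (s := (c x i).counit)
    (u := (d ((S.directSum I).obj x)).counit)
    (y := cellComp (c (fun _ => (S.directSum I).obj x) i).counit (idCell (S.codiag I _)))
    (y' := S.injConjointCounit (D := D) (c x)) _ _ _
    (hs.trans (c x i).left_counit.symm)
    ((S.right_injConjointCounit (D := D) (c x)).trans (c x i).left_counit.symm)
    ((d ((S.directSum I).obj x)).right_counit.trans ((c _ i).left_counit_idCell _).symm)
    ((d ((S.directSum I).obj x)).right_counit.trans
      (S.left_injConjointCounit (D := D) (c x)).symm)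
    ((Carries.symm (carries_conjointTriangleLeft c d ((S.directSum I).obj x) i)).congr h1.symm rfl)
    (hτ.congr rfl (leftReduce_eq_rightReduce _ _ _).symm)
    (Carries.id_comp_comp_id ((carries_conjointTriangleRight c d x).congr rfl h1.symm))

/-- The biadjunction `Δ ⊣ ⊕` given by conjoints of codiagonals and coprojections. -/
noncomputable def conjointBiadjunction :
    Biadjunction (diagonal I (Loose D)) (S.directSum I) where
  unit := S.codiagConjointTrans d hd
  counit := S.injConjointTrans c hc
  triangulatorLeft z := (powerIso (conjointTriangleLeft c d z)).symm
  triangulatorRight x := conjointTriangleRight c d x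
  triangulatorLeft_naturality g := funext fun i =>
    retraction_naturality_inv (conjointTriangleLeft_naturality c hc d hd g i)
  triangulatorRight_naturality m := conjointTriangleRight_naturality c hc d hd m
  swallowtail_unit z := conjoint_swallowtail_unit c d hd z
  swallowtail_counit x := funext (conjoint_swallowtail_counit c hc d x)

end DoubleCategory.StrongFiniteCoproducts

namespace CategoryTheory.Pseudofunctor

/-! ### Equivalences of hom-categories from a biadjunction -/

variable {B : Type u} [Bicategory.{w, v} B] {C : Type u₂} [Bicategory.{w₂, v₂} C]
  (F : Pseudofunctor B C) (G : Pseudofunctor C B) {b : B} {c : C}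

/-- Transposition along a 1-cell `η : b ⟶ G (F b)`. -/
def transpose (η : b ⟶ G.obj (F.obj b)) (c : C) : (F.obj b ⟶ c) ⥤ (b ⟶ G.obj c) where
  obj f := η ≫ G.map f
  map θ := η ◁ G.map₂ θ
  map_id f := by rw [G.map₂_id, whiskerLeft_id]
  map_comp θ τ := by rw [G.map₂_comp, whiskerLeft_comp]

variable {F G}
variable {η : b ⟶ G.obj (F.obj b)} {ζ : F.obj (G.obj c) ⟶ c}
  {η' : G.obj c ⟶ G.obj (F.obj (G.obj c))} {ζ' : F.obj (G.obj (F.obj b)) ⟶ F.obj b}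
  (n : ∀ f : b ⟶ G.obj c, f ≫ η' ≅ η ≫ G.map (F.map f))
  (hn : ∀ {f g : b ⟶ G.obj c} (θ : f ⟶ g),
    θ ▷ η' ≫ (n g).hom = (n f).hom ≫ η ◁ G.map₂ (F.map₂ θ))
  (m : ∀ f : F.obj b ⟶ c, F.map (G.map f) ≫ ζ ≅ ζ' ≫ f)
  (hm : ∀ {f g : F.obj b ⟶ c} (θ : f ⟶ g),
    F.map₂ (G.map₂ θ) ▷ ζ ≫ (m g).hom = (m f).hom ≫ ζ' ◁ θ)
  (l : 𝟙 (F.obj b) ≅ F.map η ≫ ζ') (r : η' ≫ G.map ζ ≅ 𝟙 (G.obj c))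

variable (F G) in
/-- Transposition along a 1-cell `ζ : F (G c) ⟶ c`. -/
def cotranspose (ζ : F.obj (G.obj c) ⟶ c) (b : B) : (b ⟶ G.obj c) ⥤ (F.obj b ⟶ c) where
  obj f := F.map f ≫ ζ
  map θ := F.map₂ θ ▷ ζ
  map_id f := by rw [F.map₂_id, id_whiskerRight]
  map_comp θ τ := by rw [F.map₂_comp, comp_whiskerRight]

/-- Transposing twice is isomorphic to the identity. -/
def transposeCotranspose : transpose F G η c ⋙ cotranspose F G ζ b ≅ 𝟭 (F.obj b ⟶ c) :=
  NatIso.ofComponents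
    (fun f => whiskerRightIso (F.mapComp η (G.map f)) ζ ≪≫ α_ _ _ _ ≪≫
      whiskerLeftIso (F.map η) (m f) ≪≫ (α_ _ _ _).symm ≪≫ whiskerRightIso l.symm f ≪≫ λ_ f)
    (fun {f g} θ => by
      simp only [transpose, cotranspose, Functor.comp_obj, Functor.comp_map, Functor.id_obj,
        Functor.id_map, Iso.trans_hom, Iso.symm_hom, whiskerRightIso_hom, whiskerLeftIso_hom,
        Pseudofunctor.map₂_whisker_left, comp_whiskerRight, Category.assoc,
        inv_hom_whiskerRight_assoc, associator_naturality_middle_assoc]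
      rw [← whiskerLeft_comp_assoc, hm, whiskerLeft_comp_assoc,
        associator_inv_naturality_right_assoc, whisker_exchange_assoc, leftUnitor_naturality])

/-- Transposing twice is isomorphic to the identity. -/
def cotransposeTranspose : cotranspose F G ζ b ⋙ transpose F G η c ≅ 𝟭 (b ⟶ G.obj c) :=
  NatIso.ofComponents
    (fun f => whiskerLeftIso η (G.mapComp (F.map f) ζ) ≪≫ (α_ _ _ _).symm ≪≫
      whiskerRightIso (n f).symm (G.map ζ) ≪≫ α_ _ _ _ ≪≫ whiskerLeftIso f r ≪≫ ρ_ f)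
    (fun {f g} θ => by
      -- The isomorphism runs against `n`, so naturality is needed for its inverse.
      have h : η ◁ G.map₂ (F.map₂ θ) ≫ (n g).inv = (n f).inv ≫ θ ▷ η' := by
        rw [Iso.comp_inv_eq, Category.assoc, Iso.eq_inv_comp, hn]
      simp only [transpose, cotranspose, Functor.comp_obj, Functor.comp_map, Functor.id_obj,
        Functor.id_map, Iso.trans_hom, Iso.symm_hom, whiskerRightIso_hom, whiskerLeftIso_hom,
        Pseudofunctor.map₂_whisker_right, whiskerLeft_comp, Category.assoc,
        whiskerLeft_inv_hom_assoc, associator_inv_naturality_middle_assoc]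
      rw [← comp_whiskerRight_assoc, h, comp_whiskerRight_assoc, associator_naturality_left_assoc,
        ← whisker_exchange_assoc, rightUnitor_naturality])

end CategoryTheory.Pseudofunctor

namespace Biadjunction

variable {B : Type u} [Bicategory.{w, v} B] {C : Type u₂} [Bicategory.{w₂, v₂} C]
  {F : Pseudofunctor B C} {G : Pseudofunctor C B} (adj : Biadjunction F G)

/-- A biadjunction induces equivalences of hom-categories. -/
def homEquivalence (b : B) (c : C) : (F.obj b ⟶ c) ≌ (b ⟶ G.obj c) :=
  CategoryTheory.Equivalence.mk (F.transpose G (adj.unit.app b) c)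
    (F.cotranspose G (adj.counit.app c) b)
    (Pseudofunctor.transposeCotranspose (fun f => adj.counit.naturality f)
      (fun θ => adj.counit.naturality_naturality θ) (adj.triangulatorLeft b)).symm
    (Pseudofunctor.cotransposeTranspose (fun f => adj.unit.naturality f)
      (fun θ => adj.unit.naturality_naturality θ) (adj.triangulatorRight c))

end Biadjunction

/-! ### Universal properties and existence of the biadjunctions -/

namespace DoubleCategory.StrongFiniteCoproducts

variable {D : Type u} [DoubleCategory.{t, w, v} D] (S : StrongFiniteCoproducts D) {I : Type}
  [Finite I]

/-- Transposition sends `f` to `unit ≫ Δ f`, whose `i`-th component is `f` restricted along the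
`i`-th component of the unit; the two functors agree by definition. -/
lemma isBicategoricalCoproduct_unit (L : Biadjunction (S.directSum I) (diagonal I (Loose D)))
    (x : I → Loose D) :
    IsBicategoricalCoproduct (s := (S.directSum I).obj x) (fun i => L.unit.app x i) :=
  fun z => (L.homEquivalence x z).isEquivalence_functor

/-- Here the inverse transposition `f ↦ Δ f ≫ counit` is the functor in question, composition with
the components of the counit. -/
lemma isBicategoricalProduct_counit (R : Biadjunction (diagonal I (Loose D)) (S.directSum I))
    (x : I → Loose D) :
    IsBicategoricalProduct (s := (S.directSum I).obj x) (fun i => R.counit.app x i) :=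
  fun z => (R.homEquivalence z x).isEquivalence_inverse

lemma exists_companionBiadjunction (I : Type) [Finite I] :
    ∃ L : Biadjunction (S.directSum I) (diagonal I (Loose D)),
      S.IsCompanionOfInj L.unit ∧ S.IsCompanionOfCodiag L.counit := by
  -- Companions are chosen together with their opcartesian property, which supplies the
  -- invertibility required by the transformations; the description of the structure cells then
  -- holds by definition.
  choose p c hc using fun (x : I → Loose D) (i : I) =>
    S.exists_companionData_inj (fun i => (x i).obj) i
  choose q d hd using fun z : Loose D => S.exists_companionData_codiag I z.obj
  exact ⟨companionBiadjunction (p := p) c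
    (fun m i => CompanionData.isIso_slide _ _ _ _ _ (hc _ i m))
    (q := q) d (fun n => CompanionData.isIso_slide _ _ _ _ _ (hd _ n)),
    ⟨c, fun _ _ _ _ => rfl⟩, ⟨d, fun _ _ _ => rfl⟩⟩

lemma exists_conjointBiadjunction (I : Type) [Finite I] :
    ∃ R : Biadjunction (diagonal I (Loose D)) (S.directSum I),
      S.IsConjointOfCodiag R.unit ∧ S.IsConjointOfInj R.counit := by
  choose p c hc using fun (x : I → Loose D) (i : I) =>
    S.exists_conjointData_inj (fun i => (x i).obj) i
  choose q d hd using fun z : Loose D => S.exists_conjointData_codiag I z.obj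
  exact ⟨conjointBiadjunction (p := p) c (fun m i => ConjointData.isIso_slide _ _ _ _ _ (hc _ i m))
    (q := q) d (fun n => ConjointData.isIso_slide _ _ _ _ _ (hd _ n)),
    ⟨d, fun _ _ _ => rfl⟩, ⟨c, fun _ _ _ _ => rfl⟩⟩

end DoubleCategory.StrongFiniteCoproducts

theorem mainTheorem6 {D : Type u} [DoubleCategory.{t, w, v} D]
    (S : StrongFiniteCoproducts D) :
    HasDirectSums (Loose D) ∧
    ∀ (I : Type) [Finite I],
      ∃ (L : Biadjunction (S.directSum I) (diagonal I (Loose D)))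
        (R : Biadjunction (diagonal I (Loose D)) (S.directSum I)),
        S.IsCompanionOfInj L.unit ∧ S.IsCompanionOfCodiag L.counit ∧
        S.IsConjointOfCodiag R.unit ∧ S.IsConjointOfInj R.counit ∧
        ∀ x : I → Loose D,
          IsBicategoricalCoproduct (s := (S.directSum I).obj x) (fun i => L.unit.app x i) ∧
          IsBicategoricalProduct (s := (S.directSum I).obj x) (fun i => R.counit.app x i) := by
  refine ⟨fun I _ x => ?_, fun I _ => ?_⟩
  · obtain ⟨L, -⟩ := S.exists_companionBiadjunction I
    obtain ⟨R, -⟩ := S.exists_conjointBiadjunction I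
    exact ⟨(S.directSum I).obj x, fun i => L.unit.app x i, fun i => R.counit.app x i,
      S.isBicategoricalCoproduct_unit L x, S.isBicategoricalProduct_counit R x⟩
  · obtain ⟨L, hι, hcod⟩ := S.exists_companionBiadjunction I
    obtain ⟨R, hcod', hι'⟩ := S.exists_conjointBiadjunction I
    exact ⟨L, R, hι, hcod, hcod', hι', fun x =>
      ⟨S.isBicategoricalCoproduct_unit L x, S.isBicategoricalProduct_counit R x⟩⟩
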